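/- **Conventions.** A gap constraint for a string $p\in\Sigma^*$ is a triple $C=(i,j,L)$ with $1\le i<j\le|p|$ and $L\subseteq\Sigma^*$. It is *regular* if $L$ is given by a (possibly incomplete) DFA $A$, with $\mathrm{size}(C)$ the number of states plus the number of defined transitions of $A$; it is a *semilinear length constraint* if $L=\{v : |v|\in S\}$ for a semilinear set $S=\bigcup_{r}L(x_{r,0};x_{r,1},\dots,x_{r,m_r})$ given by the numbers $x_{r,s}$, with $\mathrm{size}(C)=\sum_r(m_r+1)$, where $L(x_0;x_1,\dots,x_m)=\{x_0+\sum_{s=1}^m k_sx_s : k_s\in\mathbb{N}_0\}$. An instance of $\mathrm{MATCH}_{\mathcal L}$, $\mathcal L\in\{\mathrm{REG},\mathrm{SEMI}\}$, consists of a text $w$ and a pattern $p$ with $|p|\le|w|$ over an alphabet $\{1,\dots,\sigma\}$, $\sigma\le|w|$, and a non-empty finite set $\mathcal C$ of regular (respectively semilinear length) constraints for $p$ that contains at most one constraint for each pair $(i,j)$, where $\mathrm{size}(C)\le|w|^2$ (respectively $\mathrm{size}(C)\le|w|$) for all $C\in\mathcal C$. The question is whether there are positions $e(1)<\dots<e(|p|)$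 of $w$ with $w[e(i)]=p[i]$ for all $i$ and $w[e(i)+1..e(j)-1]\in L$ for all $(i,j,L)\in\mathcal C$. The set $\mathcal C$ is *non-intersecting* if for all $(i,j,L),(i',j',L')\in\mathcal C$ the intervals $[i,j-1]$ and $[i',j'-1]$ are disjoint or one contains the other; $\mathrm{MATCH}_{\mathcal L,\mathcal H}$ is the restriction of $\mathrm{MATCH}_{\mathcal L}$ to non-intersecting sets $\mathcal C$. Running times refer to the unit-cost RAM whose memory words have a length logarithmic in the input length (long enough to hold each number of the input, and to address the memory used within the time bound). SETH is the hypothesis that for every $\varepsilon>0$ there is a $k\in\mathbb{N}$ such that satisfiability of $k$-CNF formulas with $n$ variables and $m$ clauses cannot be solved in time $O(2^{n(1-\varepsilon)}\operatorname{poly}(m))$ for any polynomial. **Theorem.** Let $\mathcal L\in\{\mathrm{REG},\mathrm{SEMI}\}$ and let $g,h$ be real numbers with $g+h<3$. Unless SETH fails, $\mathrm{MATCH}_{\mathcal L,\mathcal H}$ cannot be solved in $O(|w|^g|\mathcal C|^h)$ time. Moreover, there is an absolute constant $s$ such that this holds already for the restriction to instances in which every constraint has size at most $s$. -/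

import Mathlib

/-! ### The unit-cost RAM with words of logarithmic length -/

namespace RAM

/-- Instructions of the RAM. Memory cells are indexed by natural numbers, and `d`, `a`, `b` are
(fixed) addresses of cells; `l` is a position in the program. Subtraction is truncated at `0`,
division rounds down. -/
inductive Instr where
  | const (d v : ℕ)
  | copy (d a : ℕ)
  | add (d a b : ℕ)
  | sub (d a b : ℕ)
  | mul (d a b : ℕ)
  | div (d a b : ℕ)
  | mod (d a b : ℕ)
  /-- `mem[d] := mem[mem[a]]` -/
  | load (d a : ℕ)
  /-- `mem[mem[d]] := mem[a]` -/
  | store (d a : ℕ)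
  /-- `mem[d] := input[mem[a]]` (and `0` beyond the end of the input) -/
  | read (d a : ℕ)
  | jump (l : ℕ)
  /-- jump to `l` if `mem[a] = 0` -/
  | jumpZero (a l : ℕ)
  /-- stop and answer `b` -/
  | halt (b : Bool)

abbrev Program := List Instr

structure Config where
  pc : ℕ
  mem : ℕ → ℕ

/-- All memory cells are `0` at the start; the input is in a separate read-only array. -/
def init : Config := ⟨0, fun _ => 0⟩

def Config.set (c : Config) (d v : ℕ) : Config := ⟨c.pc + 1, Function.update c.mem d v⟩

/-- The effect of one instruction. -/
def Instr.exec (input : List ℕ) (c : Config) : Instr → Config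
  | .const d v => c.set d v
  | .copy d a => c.set d (c.mem a)
  | .add d a b => c.set d (c.mem a + c.mem b)
  | .sub d a b => c.set d (c.mem a - c.mem b)
  | .mul d a b => c.set d (c.mem a * c.mem b)
  | .div d a b => c.set d (c.mem a / c.mem b)
  | .mod d a b => c.set d (c.mem a % c.mem b)
  | .load d a => c.set d (c.mem (c.mem a))
  | .store d a => c.set (c.mem d) (c.mem a)
  | .read d a => c.set d (input.getD (c.mem a) 0)
  | .jump l => ⟨l, c.mem⟩
  | .jumpZero a l => if c.mem a = 0 then ⟨l, c.mem⟩ else ⟨c.pc + 1, c.mem⟩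
  | .halt _ => c

/-- One step of the program; nothing happens once the program counter has left the program. -/
def step (P : Program) (input : List ℕ) (c : Config) : Config :=
  match P[c.pc]? with
  | some i => i.exec input c
  | none => c

/-- The configuration after `i` steps. -/
def configAt (P : Program) (input : List ℕ) (i : ℕ) : Config := (step P input)^[i] init

/-- The answer given in a configuration, if the program halts there. -/
def answer (P : Program) (c : Config) : Option Bool :=
  match P[c.pc]? with
  | some (.halt b) => some b
  | _ => none

/-- The length in bits of a memory word, for a given input and time bound `t`: a constant `c` times
the logarithm of the sum of the number of input entries, the largest input entry, and `t`. So a word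
can hold any input entry and any address that can be needed within time `t`. If `t` and the input
entries are polynomially bounded in the input length `N`, these are words of `O(log N)` bits. -/
noncomputable def wordLength (c : ℕ) (input : List ℕ) (t : ℝ) : ℕ :=
  c * Nat.log 2 (input.length + input.foldr max 0 + ⌈t⌉₊ + 2)

/-- The decision problem "does `yes x` hold?", for instances `x` with `inst x`, given to the machine
as the list `enc x` of numbers, can be solved in time `O(t x)`: a single program answers correctly
within `K * t x` steps on every instance `x`, while all numbers that it ever stores fit into words
of the length above. -/
def SolvableInTime {α : Type} (enc : α → List ℕ) (inst yes : α → Prop) (t : α → ℝ) : Prop :=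
  ∃ (P : Program) (K c : ℕ), ∀ x, inst x → ∃ T : ℕ, (T : ℝ) ≤ K * t x ∧
    (∃ b : Bool, answer P (configAt P (enc x) T) = some b ∧ (b = true ↔ yes x)) ∧
    ∀ i ≤ T, ∀ a, (configAt P (enc x) i).mem a < 2 ^ wordLength c (enc x) (t x)

end RAM

/-! ### The strong exponential time hypothesis -/

/-- A formula in conjunctive normal form over the variables `0, …, numVars - 1`; the literal
`(v, true)` is the variable `v` and `(v, false)` is its negation. -/
structure CNF where
  numVars : ℕ
  clauses : List (List (Fin numVars × Bool))

namespace CNF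

def Satisfiable (F : CNF) : Prop :=
  ∃ A : Fin F.numVars → Bool, ∀ c ∈ F.clauses, ∃ l ∈ c, A l.1 = l.2

/-- Every clause has at most `k` literals. -/
def IsKCNF (k : ℕ) (F : CNF) : Prop := ∀ c ∈ F.clauses, c.length ≤ k

def encode (F : CNF) : List ℕ :=
  [F.numVars, F.clauses.length] ++
    F.clauses.flatMap fun c => c.length :: c.map fun l => 2 * (l.1 : ℕ) + l.2.toNat

end CNF

/-- For every `ε > 0` there is a `k` such that satisfiability of `k`-CNF formulas with `n` variables
and `m` clauses cannot be solved in time `O(2 ^ (n (1 - ε)) poly(m))`, for any polynomial. -/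
def SETH : Prop :=
  ∀ ε : ℝ, 0 < ε → ∃ k : ℕ, ∀ a : ℕ,
    ¬ RAM.SolvableInTime CNF.encode (CNF.IsKCNF k) CNF.Satisfiable
      (fun F => (2 : ℝ) ^ ((F.numVars : ℝ) * (1 - ε)) * ((F.clauses.length : ℝ) + 1) ^ a)

/-! ### Representations of gap-constraint languages -/

/-- A deterministic finite automaton over the alphabet `{0, …, σ - 1}`, possibly incomplete:
`step q a = none` means that the transition is undefined. -/
structure PartialDFA (σ : ℕ) where
  numStates : ℕ
  start : Fin numStates
  step : Fin numStates → Fin σ → Option (Fin numStates)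
  accept : Fin numStates → Bool

namespace PartialDFA

variable {σ : ℕ}

/-- The complete automaton with the additional rejecting sink `none`. -/
def toDFA (A : PartialDFA σ) : DFA (Fin σ) (Option (Fin A.numStates)) where
  step q a := q.bind fun q => A.step q a
  start := some A.start
  accept := {q | ∃ s, q = some s ∧ A.accept s = true}

def language (A : PartialDFA σ) : Set (List (Fin σ)) := A.toDFA.accepts

/-- The list of all defined transitions. -/
def transitions (A : PartialDFA σ) : List (Fin A.numStates × Fin σ × Fin A.numStates) :=
  (List.finRange A.numStates).flatMap fun q =>
    (List.finRange σ).filterMap fun a => (A.step q a).map fun r => (q, a, r)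

def size (A : PartialDFA σ) : ℕ := A.numStates + A.transitions.length

def encode (A : PartialDFA σ) : List ℕ :=
  [A.numStates, (A.start : ℕ), A.transitions.length] ++
    (List.finRange A.numStates).map (fun q => (A.accept q).toNat) ++
    A.transitions.flatMap fun t => [(t.1 : ℕ), (t.2.1 : ℕ), (t.2.2 : ℕ)]

end PartialDFA

/-- A representation `L(x₀; x₁, …, xₘ)` of a linear set. -/
structure LinearRep where
  base : ℕ
  periods : List ℕ
  pos : ∀ x ∈ periods, 0 < x

namespace LinearRep

def toSet (L : LinearRep) : Set ℕ :=
  {x | ∃ k : Fin L.periods.length → ℕ, x = L.base + ∑ i, k i * L.periods.get i}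

def size (L : LinearRep) : ℕ := L.periods.length + 1

def encode (L : LinearRep) : List ℕ := L.periods.length :: L.base :: L.periods

end LinearRep

/-- A semilinear set, represented as a finite union of linear sets. -/
abbrev SemilinearRep := List LinearRep

namespace SemilinearRep

def toSet (S : SemilinearRep) : Set ℕ := {x | ∃ L ∈ S, x ∈ L.toSet}

def size (S : SemilinearRep) : ℕ := (S.map LinearRep.size).sum

def encode (S : SemilinearRep) : List ℕ := S.length :: S.flatMap LinearRep.encode

end SemilinearRep

/-- The two kinds of gap constraints: regular and semilinear length constraints. -/
inductive ConstraintKind where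
  | reg
  | semi

namespace ConstraintKind

/-- Regular constraints are represented by automata, semilinear ones by semilinear sets. -/
def Rep (σ : ℕ) : ConstraintKind → Type
  | reg => PartialDFA σ
  | semi => SemilinearRep

/-- The represented gap-constraint language. -/
def language {σ : ℕ} : (𝓛 : ConstraintKind) → 𝓛.Rep σ → Set (List (Fin σ))
  | reg => fun A => PartialDFA.language A
  | semi => fun S => {v | v.length ∈ SemilinearRep.toSet S}

def size {σ : ℕ} : (𝓛 : ConstraintKind) → 𝓛.Rep σ → ℕ
  | reg => fun A => PartialDFA.size A
  | semi => fun S => SemilinearRep.size S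

def encode {σ : ℕ} : (𝓛 : ConstraintKind) → 𝓛.Rep σ → List ℕ
  | reg => fun A => PartialDFA.encode A
  | semi => fun S => SemilinearRep.encode S

/-- The standing bound on the size of a single constraint for a text of length `n`. -/
def sizeBound (n : ℕ) : ConstraintKind → ℕ
  | reg => n ^ 2
  | semi => n

end ConstraintKind

/-! ### The matching problem -/

/-- A gap constraint `(i, j, L)` for a string of length `m` over `{0, …, σ - 1}`. Positions are
counted from `0`. -/
structure GapConstraint (𝓛 : ConstraintKind) (σ m : ℕ) where
  left : Fin m
  right : Fin m
  lt : left < right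
  rep : 𝓛.Rep σ

namespace GapConstraint

variable {𝓛 : ConstraintKind} {σ m : ℕ}

def language (C : GapConstraint 𝓛 σ m) : Set (List (Fin σ)) := 𝓛.language C.rep

def size (C : GapConstraint 𝓛 σ m) : ℕ := 𝓛.size C.rep

/-- The positions `left, …, right - 1`. -/
def interval (C : GapConstraint 𝓛 σ m) : Finset (Fin m) := Finset.Ico C.left C.right

def encode (C : GapConstraint 𝓛 σ m) : List ℕ :=
  [(C.left : ℕ), (C.right : ℕ)] ++ 𝓛.encode C.rep

end GapConstraint

/-- The factor of `v` strictly between the positions `e i` and `e j`. -/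
def gap {α : Type} (v : List α) {m : ℕ} (e : Fin m → Fin v.length) (i j : Fin m) : List α :=
  (v.drop ((e i : ℕ) + 1)).take ((e j : ℕ) - (e i : ℕ) - 1)

/-- An instance of the matching problem with constraints of kind `𝓛`: a text and a pattern over an
integer alphabet, and a non-empty set of gap constraints for the pattern with at most one constraint
for every pair of positions (listed in any order). -/
structure MatchInstance (𝓛 : ConstraintKind) where
  σ : ℕ
  text : List (Fin σ)
  pattern : List (Fin σ)
  constraints : List (GapConstraint 𝓛 σ pattern.length)
  alphabet_le : σ ≤ text.length
  pattern_le : pattern.length ≤ text.length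
  nonempty : constraints ≠ []
  nodup : (constraints.map fun C => (C.left, C.right)).Nodup
  size_le : ∀ C ∈ constraints, C.size ≤ 𝓛.sizeBound text.length

namespace MatchInstance

variable {𝓛 : ConstraintKind}

/-- The pattern is a `𝓒`-subsequence of the text, where `𝓒` is the set of constraints. -/
def IsMatch (I : MatchInstance 𝓛) : Prop :=
  ∃ e : Fin I.pattern.length → Fin I.text.length, StrictMono e ∧
    (∀ i, I.text.get (e i) = I.pattern.get i) ∧
    ∀ C ∈ I.constraints, gap I.text e C.left C.right ∈ C.language

/-- The constraints are pairwise non-intersecting. -/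
def NonIntersecting (I : MatchInstance 𝓛) : Prop :=
  ∀ C ∈ I.constraints, ∀ C' ∈ I.constraints,
    C.interval ∩ C'.interval = C.interval ∨ C.interval ∩ C'.interval = C'.interval ∨
      C.interval ∩ C'.interval = ∅

def encode (I : MatchInstance 𝓛) : List ℕ :=
  [I.σ, I.text.length] ++ I.text.map (fun x => (x : ℕ)) ++
    [I.pattern.length] ++ I.pattern.map (fun x => (x : ℕ)) ++
    [I.constraints.length] ++ I.constraints.flatMap GapConstraint.encode

end MatchInstance

/-! The proof reduces satisfiability to the search for an orthogonal triple of vectors, and encodes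
this search in a matching instance whose text length and number of constraints are both linear in
the number of vectors. The variables are split into three groups of about `n / 3`, with `N`
assignments each. An assignment of a group becomes the 0/1 vector that marks the clauses it leaves
unsatisfied; the formula is satisfiable iff some triple of vectors, one per group, has no common 1
(`satisfiable_iff`).

The left half of the text lists the vectors of the first family, the right half those of the second
family in mirror image. The vectors of the third family are stored in the constraints between a
pattern position and its mirror image. A text cell has width 20 and a single nonzero letter, whose
offset codes a bit and a stage; filler blocks form the stages 0 and 2, vectors the stage 1.
Constraints between neighbours keep pattern blocks intact and forbid a jump over stage 1, so some
pattern block `j` must land on a vector of the first family (`exists_stage_eq_one`). The mirror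
constraints force equal stages on the right, hence a vector of the second family there, and for
every 1 of the third vector `j` they forbid that both matched bits are 1
(`exists_triple_of_isEmbedding`). Conversely an orthogonal triple gives an embedding
(`exists_isEmbedding_of_triple`). The mirror intervals are nested and those of neighbours are
singletons, so the constraints are non-intersecting. Only gap lengths matter, so one construction
serves both kinds of constraints, with constant size.

Text length and number of constraints are `Θ(N m)` up to the shift from `m` to `m + 1`. With `g + h
≤ 3 δ` and `δ < 1`, a solver in time `|w| ^ g * |C| ^ h` would decide satisfiability in time `2 ^ (n
δ) poly(m)`, against SETH. It remains to compute the instance on the RAM. A small language of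
expressions (`NatExpr`) and list generators (`Gen`) is compiled to RAM code; its cost charges the
values of constants, sums and products and so also bounds the memory contents. The assumed solver is
then simulated on the generated list (`SolvableInTime.of_reduction`). -/

namespace RAM

/-! ### Runs with bounded time and bounded memory contents -/

/-- `c'` is reached from `c` in at most `B` steps, and all memory contents on the way are at
most `V`. -/
def Runs (P : Program) (inp : List ℕ) (V B : ℕ) (c c' : Config) : Prop :=
  ∃ T ≤ B, (step P inp)^[T] c = c' ∧ ∀ i ≤ T, ∀ a, ((step P inp)^[i] c).mem a ≤ V

section Runs

variable {P : Program} {inp : List ℕ} {V B B₁ B₂ : ℕ} {c c' c'' : Config}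

theorem Runs.refl (h : ∀ a, c.mem a ≤ V) : Runs P inp V 0 c c :=
  ⟨0, le_rfl, rfl, fun i hi a => by obtain rfl : i = 0 := by omega
                                    exact h a⟩

theorem Runs.mono (h : Runs P inp V B₁ c c') (hB : B₁ ≤ B₂) : Runs P inp V B₂ c c' := by
  obtain ⟨T, hT, h⟩ := h
  exact ⟨T, hT.trans hB, h⟩

theorem Runs.of_pc_eq {b b' : ℕ} {mem : ℕ → ℕ} (h : Runs P inp V B c ⟨b, mem⟩) (e : b = b') :
    Runs P inp V B c ⟨b', mem⟩ := e ▸ h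

theorem Runs.trans (h₁ : Runs P inp V B₁ c c') (h₂ : Runs P inp V B₂ c' c'') :
    Runs P inp V (B₁ + B₂) c c'' := by
  obtain ⟨T₁, hT₁, e₁, m₁⟩ := h₁
  obtain ⟨T₂, hT₂, e₂, m₂⟩ := h₂
  refine ⟨T₂ + T₁, by omega, by rw [Function.iterate_add_apply, e₁, e₂], fun i hi a => ?_⟩
  rcases le_total i T₁ with h | h
  · exact m₁ i h a
  · obtain ⟨j, rfl⟩ := Nat.exists_eq_add_of_le' h
    rw [Function.iterate_add_apply, e₁]
    exact m₂ j (by omega) a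

theorem Runs.le_right {b : ℕ} {mem : ℕ → ℕ} (h : Runs P inp V B c ⟨b, mem⟩) (a : ℕ) :
    mem a ≤ V := by
  obtain ⟨T, -, e, m⟩ := h
  simpa [e] using m T le_rfl a

theorem Runs.single (h : ∀ a, c.mem a ≤ V) (h' : ∀ a, (step P inp c).mem a ≤ V) :
    Runs P inp V 1 c (step P inp c) := by
  refine ⟨1, le_rfl, rfl, fun i hi a => ?_⟩
  rcases Nat.le_one_iff_eq_zero_or_eq_one.1 hi with rfl | rfl
  · exact h a
  · exact h' a

theorem step_eq {i : Instr} (h : P[c.pc]? = some i) : step P inp c = i.exec inp c := by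
  simp [step, h]

theorem update_le {mem : ℕ → ℕ} {d v : ℕ} (h : ∀ a, mem a ≤ V) (hv : v ≤ V) (a : ℕ) :
    Function.update mem d v a ≤ V := by
  by_cases ha : a = d
  · subst ha
    simpa using hv
  · simpa [ha] using h a

/-- One instruction that writes the value `v` into the cell `d`. -/
theorem Runs.write {i : Instr} {b : ℕ} {mem : ℕ → ℕ} (d v : ℕ) (hi : P[b]? = some i)
    (he : i.exec inp ⟨b, mem⟩ = ⟨b + 1, Function.update mem d v⟩)
    (h : ∀ a, mem a ≤ V) (hv : v ≤ V) :
    Runs P inp V 1 ⟨b, mem⟩ ⟨b + 1, Function.update mem d v⟩ := by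
  have hs : step P inp ⟨b, mem⟩ = ⟨b + 1, Function.update mem d v⟩ := by
    rw [step_eq (by exact hi), he]
  exact hs ▸ Runs.single h (hs ▸ update_le h hv)

/-- One instruction that only changes the program counter. -/
theorem Runs.goto {i : Instr} {b : ℕ} {mem : ℕ → ℕ} (l : ℕ) (hi : P[b]? = some i)
    (he : i.exec inp ⟨b, mem⟩ = ⟨l, mem⟩) (h : ∀ a, mem a ≤ V) :
    Runs P inp V 1 ⟨b, mem⟩ ⟨l, mem⟩ := by
  have hs : step P inp ⟨b, mem⟩ = ⟨l, mem⟩ := by rw [step_eq (by exact hi), he]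
  exact hs ▸ Runs.single h (hs ▸ h)

end Runs

/-- The program `P` contains the code `is` at position `b`. -/
def CodeAt (P : Program) (b : ℕ) : List Instr → Prop
  | [] => True
  | i :: is => P[b]? = some i ∧ CodeAt P (b + 1) is

theorem codeAt_append {P : Program} {is js : List Instr} {b : ℕ} :
    CodeAt P b (is ++ js) ↔ CodeAt P b is ∧ CodeAt P (b + is.length) js := by
  induction is generalizing b with
  | nil => simp [CodeAt]
  | cons i is ih => simp [CodeAt, ih, and_assoc, Nat.add_comm, Nat.add_left_comm]

theorem codeAt_of_eq_append (pre is post : List Instr) :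
    CodeAt (pre ++ is ++ post) pre.length is := by
  induction is generalizing pre with
  | nil => trivial
  | cons i is ih =>
    refine ⟨by simp, ?_⟩
    have := ih (pre ++ [i])
    simpa using this

/-! ### Arithmetic expressions with bounded iteration -/

inductive Op where
  | add | sub | mul | div | mod

namespace Op

def apply : Op → ℕ → ℕ → ℕ
  | add => (· + ·)
  | sub => (· - ·)
  | mul => (· * ·)
  | div => (· / ·)
  | mod => (· % ·)

def instr : Op → ℕ → ℕ → ℕ → Instr
  | add => .add
  | sub => .sub
  | mul => .mul
  | div => .div
  | mod => .mod

/-- The results of additions and multiplications are charged, so that the cost of an expression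
also bounds the numbers that occur. -/
def charge : Op → ℕ → ℕ → ℕ
  | add => (· + ·)
  | mul => (· * ·)
  | _ => fun _ _ => 0

theorem exec_instr (o : Op) (inp : List ℕ) (c : Config) (d a b : ℕ) :
    (o.instr d a b).exec inp c =
      ⟨c.pc + 1, Function.update c.mem d (o.apply (c.mem a) (c.mem b))⟩ := by
  cases o <;> rfl

theorem apply_le (o : Op) {x y V : ℕ} (hx : x ≤ V) (hc : o.charge x y ≤ V) : o.apply x y ≤ V := by
  cases o
  · exact hc
  · exact (Nat.sub_le _ _).trans hx
  · exact hc
  · exact (Nat.div_le_self _ _).trans hx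
  · exact (Nat.mod_le _ _).trans hx

end Op

/-- Expressions; `var x` is the value at position `x` of the environment, a list to which `op`,
`bind` and `iter` append the values of subexpressions. -/
inductive NatExpr where
  | const (v : ℕ)
  | var (x : ℕ)
  | op (o : Op) (e₁ e₂ : NatExpr)
  | read (e : NatExpr)
  | bind (e₁ e₂ : NatExpr)
  /-- Iterates `body`; it sees the number of rounds, the accumulator, and the current round. -/
  | iter (count start body : NatExpr)

namespace NatExpr

variable (inp : List ℕ)

/-- The accumulator after `i` rounds. -/
def iterate (f : ℕ → ℕ → ℕ) (z : ℕ) : ℕ → ℕ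
  | 0 => z
  | i + 1 => f (iterate f z i) i

def eval : NatExpr → List ℕ → ℕ
  | const v, _ => v
  | var x, ρ => ρ.getD x 0
  | op o e₁ e₂, ρ => o.apply (e₁.eval ρ) (e₂.eval (ρ ++ [e₁.eval ρ]))
  | read e, ρ => inp.getD (e.eval ρ) 0
  | bind e₁ e₂, ρ => e₂.eval (ρ ++ [e₁.eval ρ])
  | iter count start body, ρ =>
    iterate (fun acc i => body.eval (ρ ++ [count.eval ρ, acc, i]))
      (start.eval (ρ ++ [count.eval ρ])) (count.eval ρ)

/-- In `iter`, a round pays two instructions for the test and four for the update and the jump back.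
The other four are the initialisation of the counter, the final test and the copy of the result. -/
def cost : NatExpr → List ℕ → ℕ
  | const v, _ => v + 1
  | var _, _ => 1
  | op o e₁ e₂, ρ => e₁.cost ρ + e₂.cost (ρ ++ [e₁.eval inp ρ]) +
      o.charge (e₁.eval inp ρ) (e₂.eval inp (ρ ++ [e₁.eval inp ρ])) + 1
  | read e, ρ => e.cost ρ + 1
  | bind e₁ e₂, ρ => e₁.cost ρ + e₂.cost (ρ ++ [e₁.eval inp ρ]) + 1
  | iter count start body, ρ => count.cost ρ + start.cost (ρ ++ [count.eval inp ρ]) + 4 +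
      ∑ i ∈ Finset.range (count.eval inp ρ),
        (body.cost (ρ ++ [count.eval inp ρ,
          iterate (fun acc i => body.eval inp (ρ ++ [count.eval inp ρ, acc, i]))
            (start.eval inp (ρ ++ [count.eval inp ρ])) i, i]) + 6)

/-- The code of an expression for an environment of length `n`, to be placed at position `b`. The
environment is in the cells `1, …, n`, and the value goes to the cell `n + 1`. -/
def compile : NatExpr → ℕ → ℕ → List Instr
  | const v, n, _ => [.const (n + 1) v]
  | var x, n, _ => if x < n then [.copy (n + 1) (x + 1)] else [.const (n + 1) 0]
  | op o e₁ e₂, n, b =>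
    e₁.compile n b ++ (e₂.compile (n + 1) (b + (e₁.compile n b).length) ++
      [o.instr (n + 1) (n + 1) (n + 2)])
  | read e, n, b => e.compile n b ++ [.read (n + 1) (n + 1)]
  | bind e₁ e₂, n, b =>
    e₁.compile n b ++ (e₂.compile (n + 1) (b + (e₁.compile n b).length) ++
      [.copy (n + 1) (n + 2)])
  | iter count start body, n, b =>
    let b₁ := b + (count.compile n b).length
    let b₂ := b₁ + (start.compile (n + 1) b₁).length
    let l := (body.compile (n + 3) (b₂ + 3)).length
    count.compile n b ++ (start.compile (n + 1) b₁ ++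
      -- The cells `n + 1`, `n + 2`, `n + 3` hold the count, the accumulator and the round, in the
      -- order in which the body sees them; `n + 4` receives the test value and the value of the
      -- body. The exit leads to the last copy.
      ([.const (n + 3) 0, .sub (n + 4) (n + 1) (n + 3), .jumpZero (n + 4) (b₂ + 3 + l + 4)] ++
      (body.compile (n + 3) (b₂ + 3) ++
      [.copy (n + 2) (n + 4), .const (n + 4) 1, .add (n + 3) (n + 3) (n + 4), .jump (b₂ + 1),
        .copy (n + 1) (n + 2)])))

/-- The cells from `width` on are not used. -/
def width : NatExpr → ℕ → ℕ
  | const _, n => n + 2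
  | var _, n => n + 2
  | op _ e₁ e₂, n => max (e₁.width n) (e₂.width (n + 1))
  | read e, n => e.width n
  | bind e₁ e₂, n => max (e₁.width n) (e₂.width (n + 1))
  | iter count start body, n =>
    max (count.width n) (max (start.width (n + 1)) (body.width (n + 3)))

theorem add_two_le_width (e : NatExpr) (n : ℕ) : n + 2 ≤ e.width n := by
  induction e generalizing n with
  | const v => exact le_rfl
  | var x => exact le_rfl
  | op o e₁ e₂ ih₁ ih₂ => exact (ih₁ n).trans (le_max_left _ _)
  | read e ih => exact ih n
  | bind e₁ e₂ ih₁ ih₂ => exact (ih₁ n).trans (le_max_left _ _)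
  | iter count start body ih₁ ih₂ ih₃ => exact (ih₁ n).trans (le_max_left _ _)

end NatExpr

/-- The environment `ρ` is in the memory cells `1, …, ρ.length`. -/
def Holds (ρ : List ℕ) (mem : ℕ → ℕ) : Prop := ∀ i (h : i < ρ.length), mem (i + 1) = ρ[i]

theorem Holds.congr {ρ : List ℕ} {mem mem' : ℕ → ℕ} (h : Holds ρ mem)
    (hm : ∀ a, a ≤ ρ.length → mem' a = mem a) : Holds ρ mem' := fun i hi => by
  rw [hm _ (by omega), h i hi]

theorem Holds.append {ρ : List ℕ} {mem : ℕ → ℕ} (h : Holds ρ mem) {v : ℕ}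
    (hv : mem (ρ.length + 1) = v) : Holds (ρ ++ [v]) mem := fun i hi => by
  by_cases hi' : i < ρ.length
  · rw [h i hi', List.getElem_append_left hi']
  · obtain rfl : i = ρ.length := by simp at hi; omega
    simp [hv]

theorem getD_le {inp : List ℕ} {V : ℕ} (h : ∀ x ∈ inp, x ≤ V) (i : ℕ) : inp.getD i 0 ≤ V := by
  rw [List.getD_eq_getElem?_getD]
  by_cases hi : i < inp.length
  · simpa [hi] using h _ (List.getElem_mem hi)
  · simp [hi]

open NatExpr in
-- Scratch cells lie above the environment and below `width`, so subexpressions cannot damage the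
-- environment, nor anything stored from `width` on. Since values are charged, one inequality `cost
-- ≤ V` also controls all memory contents.
theorem NatExpr.compile_runs {P : Program} {inp : List ℕ} {V : ℕ} (hinp : ∀ x ∈ inp, x ≤ V)
    (e : NatExpr) (ρ : List ℕ) (b : ℕ) (mem : ℕ → ℕ)
    (hP : CodeAt P b (e.compile ρ.length b)) (hρ : Holds ρ mem) (hm : ∀ a, mem a ≤ V)
    (hV : e.cost inp ρ ≤ V) :
    ∃ mem', Runs P inp V (e.cost inp ρ) ⟨b, mem⟩ ⟨b + (e.compile ρ.length b).length, mem'⟩ ∧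
      mem' (ρ.length + 1) = e.eval inp ρ ∧
      ∀ a, a ≤ ρ.length ∨ e.width ρ.length ≤ a → mem' a = mem a := by
  induction e generalizing ρ b mem with
  | const v =>
    simp only [cost] at hV
    refine ⟨_, (Runs.write (ρ.length + 1) v hP.1 rfl hm (by omega)).mono
      (by simp [cost]), by simp [eval], fun a ha => ?_⟩
    simp only [width] at ha
    rw [Function.update_of_ne (by omega)]
  | var x =>
    have key : (if x < ρ.length then mem (x + 1) else 0) = ρ.getD x 0 := by
      split_ifs with hx
      · simp [hρ x hx, hx]
      · simp [hx]
    have hl : ((var x).compile ρ.length b).length = 1 := by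
      simp only [compile]
      split_ifs <;> rfl
    rw [hl]
    refine ⟨Function.update mem (ρ.length + 1) (ρ.getD x 0), Runs.write _ _
      (i := if x < ρ.length then .copy (ρ.length + 1) (x + 1) else .const (ρ.length + 1) 0)
      ?_ ?_ hm ?_, by simp [eval], fun a ha => ?_⟩
    · simp only [compile] at hP
      split_ifs at hP ⊢ with hx <;> exact hP.1
    · rw [← key]
      split_ifs with hx <;> rfl
    · rw [← key]
      split_ifs with hx
      · exact hm _
      · exact Nat.zero_le _
    · simp only [width] at ha
      rw [Function.update_of_ne (by omega)]
  | op o e₁ e₂ ih₁ ih₂ =>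
    simp only [compile, codeAt_append, List.length_append] at hP ⊢
    simp only [cost] at hV ⊢
    simp only [width]
    obtain ⟨m₁, r₁, v₁, f₁⟩ := ih₁ ρ b mem hP.1 hρ hm (by omega)
    have h₂ := ih₂ (ρ ++ [e₁.eval inp ρ]) (b + (e₁.compile ρ.length b).length) m₁
    simp only [List.length_append, List.length_singleton] at h₂
    obtain ⟨m₂, r₂, v₂, f₂⟩ := h₂ hP.2.1 ((hρ.congr fun a ha => f₁ a (.inl ha)).append v₁)
      r₁.le_right (by omega)
    have hw := add_two_le_width e₁ ρ.length
    have hw' := add_two_le_width e₂ (ρ.length + 1)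
    have v₁' : m₂ (ρ.length + 1) = e₁.eval inp ρ := by rw [f₂ _ (.inl le_rfl), v₁]
    have s₃ := Runs.write (inp := inp) (ρ.length + 1) ((op o e₁ e₂).eval inp ρ) hP.2.2.1
      (by rw [Op.exec_instr]; simp only [v₁', v₂, eval]) r₂.le_right
      (o.apply_le (v₁' ▸ r₂.le_right _) (by omega))
    refine ⟨_, Runs.mono (by
        simpa only [add_assoc, List.length_singleton] using (r₁.trans r₂).trans s₃) (by omega),
      Function.update_self .., ?_⟩
    · intro a ha
      rw [Function.update_of_ne (by omega), f₂ a (by omega), f₁ a (by omega)]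
  | read e ih =>
    simp only [compile, codeAt_append, List.length_append] at hP ⊢
    simp only [cost] at hV ⊢
    simp only [width]
    obtain ⟨m₁, r₁, v₁, f₁⟩ := ih ρ b mem hP.1 hρ hm (by omega)
    have hw := add_two_le_width e ρ.length
    have s₂ := Runs.write (inp := inp) (ρ.length + 1) ((read e).eval inp ρ) hP.2.1
      (by simp only [Instr.exec, Config.set, v₁, eval]) r₁.le_right (getD_le hinp _)
    refine ⟨_, by simpa only [add_assoc, List.length_singleton] using r₁.trans s₂,
      Function.update_self .., ?_⟩
    · intro a ha
      rw [Function.update_of_ne (by omega), f₁ a (by omega)]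
  | bind e₁ e₂ ih₁ ih₂ =>
    simp only [compile, codeAt_append, List.length_append] at hP ⊢
    simp only [cost] at hV ⊢
    simp only [width]
    obtain ⟨m₁, r₁, v₁, f₁⟩ := ih₁ ρ b mem hP.1 hρ hm (by omega)
    have h₂ := ih₂ (ρ ++ [e₁.eval inp ρ]) (b + (e₁.compile ρ.length b).length) m₁
    simp only [List.length_append, List.length_singleton] at h₂
    obtain ⟨m₂, r₂, v₂, f₂⟩ := h₂ hP.2.1 ((hρ.congr fun a ha => f₁ a (.inl ha)).append v₁)
      r₁.le_right (by omega)
    have hw := add_two_le_width e₁ ρ.length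
    have hw' := add_two_le_width e₂ (ρ.length + 1)
    have s₃ := Runs.write (inp := inp) (ρ.length + 1) ((bind e₁ e₂).eval inp ρ) hP.2.2.1
      (by simp only [Instr.exec, Config.set, v₂, eval]) r₂.le_right (by
        rw [eval, ← v₂]
        exact r₂.le_right _)
    refine ⟨_, by simpa only [add_assoc, List.length_singleton] using (r₁.trans r₂).trans s₃,
      Function.update_self .., ?_⟩
    · intro a ha
      rw [Function.update_of_ne (by omega), f₂ a (by omega), f₁ a (by omega)]
  | iter count start body ih₁ ih₂ ih₃ =>
    simp only [compile, codeAt_append, List.length_append] at hP ⊢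
    simp only [cost] at hV ⊢
    simp only [width]
    have hw := add_two_le_width count ρ.length
    have hw' := add_two_le_width start (ρ.length + 1)
    have hw'' := add_two_le_width body (ρ.length + 3)
    obtain ⟨m₁, r₁, v₁, f₁⟩ := ih₁ ρ b mem hP.1 hρ hm (by omega)
    obtain ⟨-, hP₂, hP₃, hP₄, hP₅⟩ := hP
    set k := count.eval inp ρ with hk
    set b₁ := b + (count.compile ρ.length b).length with hb₁
    have h₂ := ih₂ (ρ ++ [k]) b₁ m₁
    simp only [List.length_append, List.length_singleton] at h₂
    have hρ₁ := hρ.congr fun a ha => f₁ a (.inl ha)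
    obtain ⟨m₂, r₂, v₂, f₂⟩ := h₂ hP₂ (hρ₁.append v₁) r₁.le_right (by omega)
    set b₂ := b₁ + (start.compile (ρ.length + 1) b₁).length with hb₂
    set z := start.eval inp (ρ ++ [k]) with hz
    set f : ℕ → ℕ → ℕ := fun acc i => body.eval inp (ρ ++ [k, acc, i]) with hf
    set l := (body.compile (ρ.length + 3) (b₂ + 3)).length with hl
    simp only [CodeAt, List.length_cons, List.length_nil, and_true, zero_add, add_assoc,
      Nat.reduceAdd] at hP₃ hP₄ hP₅
    -- Induction on the number `r` of remaining rounds; the run starts at the test.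
    have loop : ∀ r i, i + r = k → ∀ m : ℕ → ℕ, (∀ a, m a ≤ V) → Holds ρ m →
        m (ρ.length + 1) = k → m (ρ.length + 2) = iterate f z i → m (ρ.length + 3) = i →
        ∃ m', Runs P inp V (∑ j ∈ Finset.Ico i k,
            (body.cost inp (ρ ++ [k, iterate f z j, j]) + 6) + 2)
            ⟨b₂ + 1, m⟩ ⟨b₂ + (3 + (l + 4)), m'⟩ ∧
          m' (ρ.length + 2) = iterate f z k ∧
          ∀ a, a ≤ ρ.length ∨ body.width (ρ.length + 3) ≤ a → m' a = m a := by
      intro r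
      induction r with
      | zero =>
        intro i hi m hmV hm₀ hm₁ hm₂ hm₃
        obtain rfl : i = k := by omega
        have s₁ := Runs.write (inp := inp) (ρ.length + 4) 0 hP₃.2.1
          (by simp [Instr.exec, Config.set, hm₁, hm₃]) hmV (Nat.zero_le _)
        have s₂ := Runs.goto (inp := inp) (b₂ + (3 + (l + 4))) hP₃.2.2
          (by simp [Instr.exec]) s₁.le_right
        refine ⟨_, (s₁.trans s₂).mono (by omega), ?_, ?_⟩
        · rw [Function.update_of_ne (by omega), hm₂]
        · intro a ha
          rw [Function.update_of_ne (by omega)]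
      | succ r ih =>
        intro i hi m hmV hm₀ hm₁ hm₂ hm₃
        have hik : i < k := by omega
        have hkV : k ≤ V := hm₁ ▸ hmV _
        -- The cost of a round is one summand of the total cost.
        have hc : body.cost inp (ρ ++ [k, iterate f z i, i]) + 6 ≤ V := by
          refine le_trans ?_ (le_trans (Nat.le_add_left _ _) hV)
          exact Finset.single_le_sum
            (f := fun j => body.cost inp (ρ ++ [k, iterate f z j, j]) + 6)
            (fun _ _ => Nat.zero_le _) (Finset.mem_range.2 hik)
        have s₁ := Runs.write (inp := inp) (ρ.length + 4) (k - i) hP₃.2.1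
          (by simp [Instr.exec, Config.set, hm₁, hm₃]) hmV (by omega)
        have s₂ := Runs.goto (inp := inp) (b₂ + 3) hP₃.2.2
          (by simp [Instr.exec, Nat.sub_eq_zero_iff_le, hik, add_assoc]) s₁.le_right
        have h₃ := ih₃ (ρ ++ [k, iterate f z i, i]) (b₂ + 3)
          (Function.update m (ρ.length + 4) (k - i))
        simp only [List.length_append, List.length_cons, List.length_nil, zero_add,
          Nat.reduceAdd] at h₃
        obtain ⟨m₃, r₃, v₃, f₃⟩ := h₃ hP₄ (by
            have e : ρ ++ [k, iterate f z i, i] = ρ ++ [k] ++ [iterate f z i] ++ [i] := by simp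
            rw [e]
            refine Holds.append (Holds.append (Holds.append (hm₀.congr fun a ha => ?_) ?_) ?_) ?_
            · rw [Function.update_of_ne (by omega)]
            · rw [Function.update_of_ne (by omega), hm₁]
            · simp only [List.length_append, List.length_singleton]
              rw [Function.update_of_ne (by omega), hm₂]
            · simp only [List.length_append, List.length_singleton]
              rw [Function.update_of_ne (by omega), hm₃]) s₂.le_right (by omega)
        rw [← hl, add_assoc b₂] at r₃
        have s₄ := Runs.write (inp := inp) (ρ.length + 2) (iterate f z (i + 1)) hP₅.1
          (by simp [Instr.exec, Config.set, v₃, iterate, hf, add_assoc]) r₃.le_right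
          (by
            refine le_trans (le_of_eq ?_) (r₃.le_right (ρ.length + 3 + 1))
            rw [v₃, iterate])
        have s₅ := Runs.write (inp := inp) (ρ.length + 4) 1 hP₅.2.1 rfl s₄.le_right (by omega)
        have s₆ := Runs.write (inp := inp) (ρ.length + 3) (i + 1) hP₅.2.2.1 (by
          simp only [Instr.exec, Config.set]
          rw [Function.update_of_ne (by omega), Function.update_of_ne (by omega),
            f₃ _ (by omega), Function.update_of_ne (by omega), hm₃]
          simp) s₅.le_right (by omega)
        have s₇ := Runs.goto (inp := inp) (b₂ + 1) hP₅.2.2.2.1 rfl s₆.le_right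
        obtain ⟨m', r', v', f'⟩ := ih (i + 1) (by omega) _ s₆.le_right
          (hm₀.congr fun a ha => by
            rw [Function.update_of_ne (by omega), Function.update_of_ne (by omega),
              Function.update_of_ne (by omega), f₃ _ (by omega), Function.update_of_ne (by omega)])
          (by
            rw [Function.update_of_ne (by omega), Function.update_of_ne (by omega),
              Function.update_of_ne (by omega), f₃ _ (by omega), Function.update_of_ne (by omega),
              hm₁])
          (by
            rw [Function.update_of_ne (by omega), Function.update_of_ne (by omega)]
            simp) (by simp)
        refine ⟨m', ?_, v', ?_⟩
        · have := (s₁.trans s₂).trans (r₃.trans (s₄.trans (s₅.trans (s₆.trans (s₇.trans r')))))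
          refine this.mono ?_
          rw [Finset.sum_eq_sum_Ico_succ_bot hik]
          omega
        · intro a ha
          rw [f' a ha, Function.update_of_ne (by omega), Function.update_of_ne (by omega),
            Function.update_of_ne (by omega), f₃ _ (by omega), Function.update_of_ne (by omega)]
    have s₃ := Runs.write (inp := inp) (ρ.length + 3) 0 hP₃.1 rfl r₂.le_right (Nat.zero_le _)
    obtain ⟨m₄, r₄, v₄, f₄⟩ := loop k 0 (by omega) _ s₃.le_right
      (hρ₁.congr fun a ha => by rw [Function.update_of_ne (by omega), f₂ a (by omega)])
      (by rw [Function.update_of_ne (by omega), f₂ _ (by omega), v₁])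
      (by rw [Function.update_of_ne (by omega), v₂, iterate]) (by simp)
    have s₅ := Runs.write (inp := inp) (ρ.length + 1) (iterate f z k) hP₅.2.2.2.2
      (by simp [Instr.exec, Config.set, v₄]) r₄.le_right (by
        rw [← v₄]
        exact r₄.le_right _)
    refine ⟨Function.update m₄ (ρ.length + 1) (iterate f z k), ?_, Function.update_self .., ?_⟩
    · have := (((r₁.trans r₂).trans s₃).trans r₄).trans s₅
      rw [← Finset.range_eq_Ico] at this
      refine (this.of_pc_eq ?_).mono (by omega)
      simp only [List.length_cons, List.length_nil]
      omega
    · intro a ha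
      rw [Function.update_of_ne (by omega), f₄ a (by omega), Function.update_of_ne (by omega),
        f₂ a (by omega), f₁ a (by omega)]

end RAM


namespace RAM

/-! ### Generators of lists -/

/-- Programs that write a list of numbers. The environment is as for expressions. -/
inductive Gen where
  | emit (e : NatExpr)
  | seq (g₁ g₂ : Gen)
  | bind (e : NatExpr) (g : Gen)
  /-- Repeats `body`; it sees the number of rounds and the current round. -/
  | loop (count : NatExpr) (body : Gen)

namespace Gen

variable (inp : List ℕ)

def out : Gen → List ℕ → List ℕ
  | emit e, ρ => [e.eval inp ρ]
  | seq g₁ g₂, ρ => g₁.out ρ ++ g₂.out ρ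
  | bind e g, ρ => g.out (ρ ++ [e.eval inp ρ])
  | loop count body, ρ =>
    (List.range (count.eval inp ρ)).flatMap fun i => body.out (ρ ++ [count.eval inp ρ, i])

/-- The three extra units of `emit` are the store and the two instructions that advance the output
pointer. -/
def cost : Gen → List ℕ → ℕ
  | emit e, ρ => e.cost inp ρ + 3
  | seq g₁ g₂, ρ => g₁.cost ρ + g₂.cost ρ
  | bind e g, ρ => e.cost inp ρ + g.cost (ρ ++ [e.eval inp ρ])
  | loop count body, ρ => count.cost inp ρ + 3 +
      ∑ i ∈ Finset.range (count.eval inp ρ), (body.cost (ρ ++ [count.eval inp ρ, i]) + 5)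

/-- The cell `0` holds the address to which the next number is written; the numbers are written to
every second cell. -/
def compile : Gen → ℕ → ℕ → List Instr
  | emit e, n, b => e.compile n b ++ [.store 0 (n + 1), .const (n + 1) 2, .add 0 0 (n + 1)]
  | seq g₁ g₂, n, b => g₁.compile n b ++ g₂.compile n (b + (g₁.compile n b).length)
  | bind e g, n, b => e.compile n b ++ g.compile (n + 1) (b + (e.compile n b).length)
  | loop count body, n, b =>
    let b₁ := b + (count.compile n b).length
    let l := (body.compile (n + 2) (b₁ + 3)).length
    count.compile n b ++
      ([.const (n + 2) 0, .sub (n + 3) (n + 1) (n + 2), .jumpZero (n + 3) (b₁ + 3 + l + 3)] ++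
      (body.compile (n + 2) (b₁ + 3) ++
      [.const (n + 3) 1, .add (n + 2) (n + 2) (n + 3), .jump (b₁ + 1)]))

/-- The cells from `width` on are not used, except for the output. -/
def width : Gen → ℕ → ℕ
  | emit e, n => e.width n
  | seq g₁ g₂, n => max (g₁.width n) (g₂.width n)
  | bind e g, n => max (e.width n) (g.width (n + 1))
  | loop count body, n => max (max (count.width n) (n + 4)) (body.width (n + 2))

theorem add_two_le_width (g : Gen) (n : ℕ) : n + 2 ≤ g.width n := by
  induction g generalizing n with
  | emit e => exact e.add_two_le_width n
  | seq g₁ g₂ ih₁ ih₂ => exact (ih₁ n).trans (le_max_left _ _)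
  | bind e g ih => exact (e.add_two_le_width n).trans (le_max_left _ _)
  | loop count body ih =>
    exact (count.add_two_le_width n).trans ((le_max_left _ _).trans (le_max_left _ _))

/-- Every number written moves the pointer by 2 and costs at least 3. Hence the pointer stays within
the memory bound. -/
theorem length_out_le (g : Gen) (ρ : List ℕ) : 2 * (g.out inp ρ).length ≤ g.cost inp ρ := by
  induction g generalizing ρ with
  | emit e => simp [out, cost]
  | seq g₁ g₂ ih₁ ih₂ =>
    have := ih₁ ρ
    have := ih₂ ρ
    simp only [out, cost, List.length_append]
    omega
  | bind e g ih => exact (ih _).trans (Nat.le_add_left _ _)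
  | loop count body ih =>
    simp only [out, cost, List.length_flatMap]
    refine le_trans ?_ (Nat.le_add_left _ _)
    rw [Finset.sum_range, ← List.sum_ofFn, List.ofFn_eq_map, ← List.map_coe_finRange_eq_range,
      List.map_map, ← List.sum_map_mul_left]
    refine List.sum_le_sum fun i _ => (ih _).trans (Nat.le_add_right _ _)

end Gen

/-- The memory after the list has been written to every second cell from `p` on. -/
def writeOut (mem : ℕ → ℕ) (p : ℕ) : List ℕ → ℕ → ℕ
  | [] => mem
  | x :: l => writeOut (Function.update mem p x) (p + 2) l

theorem writeOut_append (mem : ℕ → ℕ) (p : ℕ) (l l' : List ℕ) :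
    writeOut mem p (l ++ l') = writeOut (writeOut mem p l) (p + 2 * l.length) l' := by
  induction l generalizing mem p with
  | nil => simp [writeOut]
  | cons x l ih => simp [writeOut, ih, mul_add, add_assoc, add_comm 2]

/-- The result in a cell depends only on the old content of the same cell, so changes of scratch
cells are irrelevant for the output region. -/
theorem writeOut_congr {mem mem' : ℕ → ℕ} (p : ℕ) (l : List ℕ) {a : ℕ} (h : mem a = mem' a) :
    writeOut mem p l a = writeOut mem' p l a := by
  induction l generalizing mem mem' p with
  | nil => exact h
  | cons x l ih =>
    refine ih _ ?_
    by_cases ha : a = p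
    · subst ha
      simp
    · simp [ha, h]

theorem writeOut_of_ne (mem : ℕ → ℕ) (p : ℕ) (l : List ℕ) {a : ℕ}
    (h : ∀ i < l.length, a ≠ p + 2 * i) : writeOut mem p l a = mem a := by
  induction l generalizing mem p with
  | nil => rfl
  | cons x l ih =>
    rw [writeOut, ih, Function.update_of_ne]
    · exact h 0 (by simp)
    · intro i hi
      have := h (i + 1) (by simpa using hi)
      omega

theorem writeOut_apply (mem : ℕ → ℕ) (p : ℕ) (l : List ℕ) (i : ℕ) (hi : i < l.length) :
    writeOut mem p l (p + 2 * i) = l[i] := by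
  induction l generalizing mem p i with
  | nil => simp at hi
  | cons x l ih =>
    rw [writeOut]
    cases i with
    | zero =>
      rw [writeOut_of_ne _ _ _ (by intro i _; omega)]
      simp
    | succ i =>
      have := ih (Function.update mem p x) (p + 2) i (by simpa using hi)
      rw [show p + 2 * (i + 1) = p + 2 + 2 * i by ring, this]
      simp

open Gen in
-- `W` separates the scratch cells from the output. From `W` on the memory is described completely,
-- including the cells between the written ones, which later serve as the fresh memory of the
-- simulated program.
theorem Gen.compile_runs {P : Program} {inp : List ℕ} {V W : ℕ} (hinp : ∀ x ∈ inp, x ≤ V)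
    (g : Gen) (ρ : List ℕ) (b : ℕ) (mem : ℕ → ℕ)
    (hP : CodeAt P b (g.compile ρ.length b)) (hρ : Holds ρ mem) (hm : ∀ a, mem a ≤ V)
    (hW : g.width ρ.length ≤ W) (hW' : W ≤ mem 0) (hV : mem 0 + g.cost inp ρ ≤ V) :
    ∃ mem', Runs P inp V (g.cost inp ρ) ⟨b, mem⟩ ⟨b + (g.compile ρ.length b).length, mem'⟩ ∧
      mem' 0 = mem 0 + 2 * (g.out inp ρ).length ∧
      (∀ a, 0 < a → a ≤ ρ.length → mem' a = mem a) ∧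
      ∀ a, W ≤ a → mem' a = writeOut mem (mem 0) (g.out inp ρ) a := by
  induction g generalizing ρ b mem with
  | emit e =>
    simp only [compile, codeAt_append, List.length_append, CodeAt] at hP ⊢
    simp only [cost] at hV ⊢
    simp only [width] at hW
    have hw := e.add_two_le_width ρ.length
    obtain ⟨m₁, r₁, v₁, f₁⟩ := e.compile_runs hinp ρ b mem hP.1 hρ hm (by omega)
    have s₂ := Runs.write (inp := inp) (mem 0) (e.eval inp ρ) hP.2.1
      (by simp only [Instr.exec, Config.set, v₁, f₁ 0 (by omega)]) r₁.le_right (by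
        rw [← v₁]
        exact r₁.le_right _)
    have s₃ := Runs.write (inp := inp) (ρ.length + 1) 2 hP.2.2.1 rfl s₂.le_right (by omega)
    have s₄ := Runs.write (inp := inp) 0 (mem 0 + 2) hP.2.2.2.1 (by
      simp only [Instr.exec, Config.set]
      rw [Function.update_of_ne (by omega), Function.update_of_ne (by omega),
        f₁ 0 (by omega), Function.update_self]) s₃.le_right (by omega)
    refine ⟨_, ((((r₁.trans s₂).trans s₃).trans s₄).of_pc_eq (by simp [add_assoc])).mono le_rfl,
      by simp [out], ?_, ?_⟩
    · intro a h0 ha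
      rw [Function.update_of_ne (by omega), Function.update_of_ne (by omega),
        Function.update_of_ne (by omega), f₁ a (by omega)]
    · intro a ha
      rw [Function.update_of_ne (by omega), Function.update_of_ne (by omega)]
      exact writeOut_congr (mem 0) [e.eval inp ρ] (f₁ a (by omega))
  | seq g₁ g₂ ih₁ ih₂ =>
    simp only [compile, codeAt_append, List.length_append] at hP ⊢
    simp only [cost] at hV ⊢
    simp only [width] at hW
    have hl := length_out_le inp g₁ ρ
    have hw := g₁.add_two_le_width ρ.length
    obtain ⟨m₁, r₁, p₁, e₁, f₁⟩ := ih₁ ρ b mem hP.1 hρ hm (by omega) hW' (by omega)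
    obtain ⟨m₂, r₂, p₂, e₂, f₂⟩ := ih₂ ρ _ m₁ hP.2 (fun i hi => by rw [e₁ _ (by omega) hi, hρ i hi])
      r₁.le_right (by omega) (by omega) (by omega)
    refine ⟨m₂, by simpa only [add_assoc] using r₁.trans r₂, ?_, ?_, ?_⟩
    · rw [p₂, p₁, out, List.length_append]
      ring
    · intro a h0 ha
      rw [e₂ a h0 ha, e₁ a h0 ha]
    · intro a ha
      rw [f₂ a ha, out, writeOut_append, ← p₁]
      exact writeOut_congr _ _ (f₁ a ha)
  | bind e g ih =>
    simp only [compile, codeAt_append, List.length_append] at hP ⊢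
    simp only [cost] at hV ⊢
    simp only [width] at hW
    have hw := e.add_two_le_width ρ.length
    obtain ⟨m₁, r₁, v₁, f₁⟩ := e.compile_runs hinp ρ b mem hP.1 hρ hm (by omega)
    have h₂ := ih (ρ ++ [e.eval inp ρ]) (b + (e.compile ρ.length b).length) m₁
    simp only [List.length_append, List.length_singleton] at h₂
    have h0 := f₁ 0 (by omega)
    obtain ⟨m₂, r₂, p₂, e₂, f₂⟩ := h₂ hP.2 ((hρ.congr fun a ha => f₁ a (.inl ha)).append v₁)
      r₁.le_right (by omega) (by omega) (by omega)
    refine ⟨m₂, by simpa only [add_assoc] using r₁.trans r₂, ?_, ?_, ?_⟩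
    · rw [p₂, h0, out]
    · intro a h0 ha
      rw [e₂ a h0 (by omega), f₁ a (by omega)]
    · intro a ha
      rw [f₂ a ha, out, h0]
      exact writeOut_congr _ _ (f₁ a (by omega))
  | loop count body ih =>
    simp only [compile, codeAt_append, List.length_append] at hP ⊢
    simp only [cost] at hV ⊢
    simp only [width] at hW
    have hw := count.add_two_le_width ρ.length
    have hw' := body.add_two_le_width (ρ.length + 2)
    obtain ⟨m₁, r₁, v₁, f₁⟩ := count.compile_runs hinp ρ b mem hP.1 hρ hm (by omega)
    obtain ⟨-, hP₂, hP₃, hP₄⟩ := hP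
    set k := count.eval inp ρ with hk
    set b₁ := b + (count.compile ρ.length b).length with hb₁
    set l := (body.compile (ρ.length + 2) (b₁ + 3)).length with hl
    simp only [CodeAt, List.length_cons, List.length_nil, and_true, zero_add, add_assoc,
      Nat.reduceAdd] at hP₂ hP₃ hP₄
    have hρ₁ := hρ.congr fun a ha => f₁ a (.inl ha)
    -- The invariant contains the budget: output pointer plus remaining cost is at most `V`.
    have loop : ∀ r i, i + r = k → ∀ m : ℕ → ℕ, (∀ a, m a ≤ V) → Holds ρ m →
        m (ρ.length + 1) = k → m (ρ.length + 2) = i → W ≤ m 0 →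
        m 0 + ∑ j ∈ Finset.Ico i k, (body.cost inp (ρ ++ [k, j]) + 5) + 2 ≤ V →
        ∃ m', Runs P inp V (∑ j ∈ Finset.Ico i k, (body.cost inp (ρ ++ [k, j]) + 5) + 2)
            ⟨b₁ + 1, m⟩ ⟨b₁ + (3 + (l + 3)), m'⟩ ∧
          m' 0 = m 0 + 2 * ((List.range' i r).flatMap fun j => body.out inp (ρ ++ [k, j])).length ∧
          (∀ a, 0 < a → a ≤ ρ.length → m' a = m a) ∧
          ∀ a, W ≤ a → m' a = writeOut m (m 0)
            ((List.range' i r).flatMap fun j => body.out inp (ρ ++ [k, j])) a := by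
      intro r
      induction r with
      | zero =>
        intro i hi m hmV hm₀ hm₁ hm₂ hmW hmV'
        obtain rfl : i = k := by omega
        have s₁ := Runs.write (inp := inp) (ρ.length + 3) 0 hP₂.2.1
          (by simp [Instr.exec, Config.set, hm₁, hm₂]) hmV (Nat.zero_le _)
        have s₂ := Runs.goto (inp := inp) (b₁ + (3 + (l + 3))) hP₂.2.2
          (by simp [Instr.exec]) s₁.le_right
        refine ⟨_, (s₁.trans s₂).mono (by omega), ?_, ?_, ?_⟩
        · simp
        · intro a h0 ha
          rw [Function.update_of_ne (by omega)]
        · intro a ha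
          rw [Function.update_of_ne (by omega)]
          rfl
      | succ r ihr =>
        intro i hi m hmV hm₀ hm₁ hm₂ hmW hmV'
        have hik : i < k := by omega
        have hkV : k ≤ V := hm₁ ▸ hmV _
        rw [Finset.sum_eq_sum_Ico_succ_bot hik] at hmV' ⊢
        have hlen := length_out_le inp body (ρ ++ [k, i])
        have s₁ := Runs.write (inp := inp) (ρ.length + 3) (k - i) hP₂.2.1
          (by simp [Instr.exec, Config.set, hm₁, hm₂]) hmV (by omega)
        have s₂ := Runs.goto (inp := inp) (b₁ + 3) hP₂.2.2
          (by simp [Instr.exec, Nat.sub_eq_zero_iff_le, hik, add_assoc]) s₁.le_right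
        have h₃ := ih (ρ ++ [k, i]) (b₁ + 3) (Function.update m (ρ.length + 3) (k - i))
        simp only [List.length_append, List.length_cons, List.length_nil, zero_add,
          Nat.reduceAdd, Function.update_of_ne (show 0 ≠ ρ.length + 3 by omega)] at h₃
        obtain ⟨m₃, r₃, p₃, e₃, f₃⟩ := h₃ hP₃ (by
            have e : ρ ++ [k, i] = ρ ++ [k] ++ [i] := by simp
            rw [e]
            refine Holds.append (Holds.append (hm₀.congr fun a ha => ?_) ?_) ?_
            · rw [Function.update_of_ne (by omega)]
            · rw [Function.update_of_ne (by omega), hm₁]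
            · simp only [List.length_append, List.length_singleton]
              rw [Function.update_of_ne (by omega), hm₂]) s₂.le_right (by omega) hmW (by omega)
        rw [← hl, add_assoc b₁] at r₃
        have s₅ := Runs.write (inp := inp) (ρ.length + 3) 1 hP₄.1 rfl r₃.le_right (by omega)
        have s₆ := Runs.write (inp := inp) (ρ.length + 2) (i + 1) hP₄.2.1 (by
          simp only [Instr.exec, Config.set]
          rw [Function.update_of_ne (by omega), e₃ _ (by omega) (by omega),
            Function.update_of_ne (by omega), hm₂]
          simp) s₅.le_right (by omega)
        have s₇ := Runs.goto (inp := inp) (b₁ + 1) hP₄.2.2 rfl s₆.le_right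
        have h0 : Function.update (Function.update m₃ (ρ.length + 3) 1) (ρ.length + 2) (i + 1) 0 =
            m 0 + 2 * (body.out inp (ρ ++ [k, i])).length := by
          rw [Function.update_of_ne (by omega), Function.update_of_ne (by omega), p₃]
        obtain ⟨m', r', p', e', f'⟩ := ihr (i + 1) (by omega) _ s₆.le_right
          (fun a ha => by
            rw [Function.update_of_ne (by omega), Function.update_of_ne (by omega),
              e₃ _ (by omega) (by omega), Function.update_of_ne (by omega), hm₀ a ha])
          (by
            rw [Function.update_of_ne (by omega), Function.update_of_ne (by omega),
              e₃ _ (by omega) (by omega), Function.update_of_ne (by omega), hm₁])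
          (by simp) (by omega) (by omega)
        refine ⟨m', ?_, ?_, ?_, ?_⟩
        · have := (s₁.trans s₂).trans (r₃.trans (s₅.trans (s₆.trans (s₇.trans r'))))
          exact this.mono (by omega)
        · rw [p', h0, List.range'_succ, List.flatMap_cons, List.length_append]
          ring
        · intro a ha0 ha
          rw [e' a ha0 ha, Function.update_of_ne (by omega), Function.update_of_ne (by omega),
            e₃ _ ha0 (by omega), Function.update_of_ne (by omega)]
        · intro a ha
          rw [f' a ha, h0, List.range'_succ, List.flatMap_cons, writeOut_append]
          refine writeOut_congr _ _ ?_
          rw [Function.update_of_ne (by omega), Function.update_of_ne (by omega), f₃ a ha]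
          exact writeOut_congr _ _ (Function.update_of_ne (by omega) _ _)
    have s₂ := Runs.write (inp := inp) (ρ.length + 2) 0 hP₂.1 rfl r₁.le_right (Nat.zero_le _)
    have h0 : Function.update m₁ (ρ.length + 2) 0 0 = mem 0 := by
      rw [Function.update_of_ne (by omega), f₁ 0 (by omega)]
    rw [Finset.range_eq_Ico] at hV ⊢
    obtain ⟨m₄, r₄, p₄, e₄, f₄⟩ := loop k 0 (by omega) _ s₂.le_right
      (hρ₁.congr fun a ha => by rw [Function.update_of_ne (by omega)])
      (by rw [Function.update_of_ne (by omega), v₁]) (by simp) (by omega) (by omega)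
    rw [← List.range_eq_range'] at p₄ f₄
    refine ⟨m₄, ?_, ?_, ?_, ?_⟩
    · have := (r₁.trans s₂).trans r₄
      refine (this.of_pc_eq ?_).mono (by omega)
      simp only [List.length_cons, List.length_nil]
      omega
    · rw [p₄, h0, out]
    · intro a ha0 ha
      rw [e₄ a ha0 ha, Function.update_of_ne (by omega), f₁ a (by omega)]
    · intro a ha
      rw [f₄ a ha, h0, out]
      refine writeOut_congr _ _ ?_
      rw [Function.update_of_ne (by omega), f₁ a (by omega)]

end RAM


namespace RAM

/-! ### Running a program on a computed input -/

/-- Four instructions that have the effect of the given one, where the memory of the simulated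
program is in the cells `R + 1, R + 3, …` and its input in the cells `R, R + 2, …`. -/
def simInstr (R base pc : ℕ) : Instr → List Instr
  | .const d v => [.const (R + 2 * d + 1) v, .jump (base + 4 * (pc + 1)), .halt false, .halt false]
  | .copy d a => [.copy (R + 2 * d + 1) (R + 2 * a + 1), .jump (base + 4 * (pc + 1)), .halt false,
      .halt false]
  | .add d a b => [.add (R + 2 * d + 1) (R + 2 * a + 1) (R + 2 * b + 1),
      .jump (base + 4 * (pc + 1)), .halt false, .halt false]
  | .sub d a b => [.sub (R + 2 * d + 1) (R + 2 * a + 1) (R + 2 * b + 1),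
      .jump (base + 4 * (pc + 1)), .halt false, .halt false]
  | .mul d a b => [.mul (R + 2 * d + 1) (R + 2 * a + 1) (R + 2 * b + 1),
      .jump (base + 4 * (pc + 1)), .halt false, .halt false]
  | .div d a b => [.div (R + 2 * d + 1) (R + 2 * a + 1) (R + 2 * b + 1),
      .jump (base + 4 * (pc + 1)), .halt false, .halt false]
  | .mod d a b => [.mod (R + 2 * d + 1) (R + 2 * a + 1) (R + 2 * b + 1),
      .jump (base + 4 * (pc + 1)), .halt false, .halt false]
  | .load d a => [.add 0 (R + 2 * a + 1) (R + 2 * a + 1), .const 1 (R + 1), .add 0 0 1,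
      .load (R + 2 * d + 1) 0]
  | .store d a => [.add 0 (R + 2 * d + 1) (R + 2 * d + 1), .const 1 (R + 1), .add 0 0 1,
      .store 0 (R + 2 * a + 1)]
  | .read d a => [.add 0 (R + 2 * a + 1) (R + 2 * a + 1), .const 1 R, .add 0 0 1,
      .load (R + 2 * d + 1) 0]
  | .jump l => [.jump (base + 4 * l), .halt false, .halt false, .halt false]
  | .jumpZero a l => [.jumpZero (R + 2 * a + 1) (base + 4 * l), .jump (base + 4 * (pc + 1)),
      .halt false, .halt false]
  | .halt b => [.halt b, .halt false, .halt false, .halt false]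

theorem length_simInstr (R base pc : ℕ) (i : Instr) : (simInstr R base pc i).length = 4 := by
  cases i <;> rfl

/-- The simulation of a whole program, whose first instruction has the number `pc`. -/
def simulate (R base : ℕ) : ℕ → Program → Program
  | _, [] => []
  | pc, i :: P => simInstr R base pc i ++ simulate R base (pc + 1) P

/-- All simulated instructions have length four, so jump targets are scaled by 4 and shifted by
`base`. -/
theorem codeAt_simInstr {Q P : Program} {R base k j : ℕ} {i : Instr}
    (h : CodeAt Q (base + 4 * k) (simulate R base k P)) (hi : P[j]? = some i) :
    CodeAt Q (base + 4 * (k + j)) (simInstr R base (k + j) i) := by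
  induction P generalizing k j with
  | nil => simp at hi
  | cons i' P ih =>
    rw [simulate, codeAt_append, length_simInstr] at h
    cases j with
    | zero =>
      obtain rfl : i' = i := by simpa using hi
      exact h.1
    | succ j =>
      have := ih (k := k + 1) (j := j) h.2 (by simpa using hi)
      rwa [add_right_comm, add_assoc k j 1] at this

/-- The memory `mem` contains the memory `m` and the input `inp` of the simulated program. -/
structure Simulates (R : ℕ) (inp : List ℕ) (m mem : ℕ → ℕ) : Prop where
  memory : ∀ a, mem (R + 2 * a + 1) = m a
  input : ∀ j, mem (R + 2 * j) = inp.getD j 0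

section Simulates

variable {R : ℕ} {inp : List ℕ} {m mem : ℕ → ℕ}

theorem Simulates.update (h : Simulates R inp m mem) (d v : ℕ) :
    Simulates R inp (Function.update m d v) (Function.update mem (R + 2 * d + 1) v) where
  memory a := by
    by_cases ha : a = d
    · subst ha
      simp
    · rw [Function.update_of_ne (by omega), Function.update_of_ne ha, h.memory]
  input j := by rw [Function.update_of_ne (by omega), h.input]

theorem Simulates.scratch (h : Simulates R inp m mem) {d : ℕ} (hd : d < R) (v : ℕ) :
    Simulates R inp m (Function.update mem d v) where
  memory a := by rw [Function.update_of_ne (by omega), h.memory]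
  input j := by rw [Function.update_of_ne (by omega), h.input]

end Simulates

/-- The cells 0 and 1 lie below `R` and are free for address computations; with contents at most
`U`, computed addresses are at most `2 * U + R + 1`. -/
theorem simulate_step {Q P : Program} {inp₀ inp : List ℕ} {R base V U : ℕ} (hR : 2 ≤ R)
    (hQ : CodeAt Q base (simulate R base 0 P)) (hV : 2 * U + R + 1 ≤ V) {c : Config}
    {mem : ℕ → ℕ} (hs : Simulates R inp c.mem mem) (hmem : ∀ a, mem a ≤ V)
    (hc : ∀ a, c.mem a ≤ U) (hc' : ∀ a, (step P inp c).mem a ≤ U) :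
    ∃ mem', Runs Q inp₀ V 4 ⟨base + 4 * c.pc, mem⟩ ⟨base + 4 * (step P inp c).pc, mem'⟩ ∧
      Simulates R inp (step P inp c).mem mem' := by
  cases hi : P[c.pc]? with
  | none =>
    have : step P inp c = c := by simp [step, hi]
    rw [this]
    exact ⟨mem, (Runs.refl hmem).mono (by omega), hs⟩
  | some i =>
    have hstep : step P inp c = i.exec inp c := by simp [step, hi]
    have code := codeAt_simInstr (k := 0) (by simpa using hQ) hi
    rw [zero_add] at code
    rw [hstep] at hc' ⊢
    have write : ∀ (j : Instr) (d v : ℕ), Q[base + 4 * c.pc]? = some j →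
        Q[base + 4 * c.pc + 1]? = some (.jump (base + 4 * (c.pc + 1))) →
        j.exec inp₀ ⟨base + 4 * c.pc, mem⟩ =
          ⟨base + 4 * c.pc + 1, Function.update mem (R + 2 * d + 1) v⟩ →
        i.exec inp c = c.set d v →
        ∃ mem', Runs Q inp₀ V 4 ⟨base + 4 * c.pc, mem⟩ ⟨base + 4 * (i.exec inp c).pc, mem'⟩ ∧
          Simulates R inp (i.exec inp c).mem mem' := by
      intro j d v h₁ h₂ h₃ h₄
      have hv : v ≤ U := by
        have := hc' d
        rw [h₄] at this
        simpa [Config.set] using this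
      rw [h₄]
      have s₁ := Runs.write (V := V) (R + 2 * d + 1) v h₁ h₃ hmem (by omega)
      have s₂ := Runs.goto (inp := inp₀) (base + 4 * (c.pc + 1)) h₂ rfl s₁.le_right
      exact ⟨_, (s₁.trans s₂).mono (by omega), hs.update d v⟩
    -- Indirect access: `r = R + 1` addresses the simulated memory, `r = R` the simulated input.
    have address : ∀ x r : ℕ, r ≤ R + 1 →
        Q[base + 4 * c.pc]? = some (.add 0 (R + 2 * x + 1) (R + 2 * x + 1)) →
        Q[base + 4 * c.pc + 1]? = some (.const 1 r) →
        Q[base + 4 * c.pc + 1 + 1]? = some (.add 0 0 1) →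
        ∃ mem', Runs Q inp₀ V 3 ⟨base + 4 * c.pc, mem⟩ ⟨base + 4 * c.pc + 3, mem'⟩ ∧
          Simulates R inp c.mem mem' ∧ mem' 0 = 2 * c.mem x + r := by
      intro x r hr h₁ h₂ h₃
      have hx := hc x
      have s₁ := Runs.write (inp := inp₀) (V := V) 0 (2 * c.mem x) h₁
        (by simp [Instr.exec, Config.set, hs.memory, two_mul (c.mem x)]) hmem (by omega)
      have s₂ := Runs.write (inp := inp₀) 1 r h₂ rfl s₁.le_right (by omega)
      have s₃ := Runs.write (inp := inp₀) 0 (2 * c.mem x + r) h₃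
        (by simp [Instr.exec, Config.set]) s₂.le_right (by omega)
      exact ⟨_, (s₁.trans s₂).trans s₃,
        ((hs.scratch (by omega) _).scratch (by omega) _).scratch (by omega) _, by simp⟩
    cases i with
    | const d v => exact write _ d v code.1 code.2.1 rfl rfl
    | copy d a =>
      exact write _ d _ code.1 code.2.1 (by simp [Instr.exec, Config.set, hs.memory]) rfl
    | add d a b =>
      exact write _ d _ code.1 code.2.1 (by simp [Instr.exec, Config.set, hs.memory]) rfl
    | sub d a b =>
      exact write _ d _ code.1 code.2.1 (by simp [Instr.exec, Config.set, hs.memory]) rfl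
    | mul d a b =>
      exact write _ d _ code.1 code.2.1 (by simp [Instr.exec, Config.set, hs.memory]) rfl
    | div d a b =>
      exact write _ d _ code.1 code.2.1 (by simp [Instr.exec, Config.set, hs.memory]) rfl
    | mod d a b =>
      exact write _ d _ code.1 code.2.1 (by simp [Instr.exec, Config.set, hs.memory]) rfl
    | load d a =>
      obtain ⟨mem', r, hs', h0⟩ := address a (R + 1) le_rfl code.1 code.2.1 code.2.2.1
      have hv := hc (c.mem a)
      have s := Runs.write (inp := inp₀) (R + 2 * d + 1) (c.mem (c.mem a)) code.2.2.2.1 (by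
        simp only [Instr.exec, Config.set, h0]
        rw [show 2 * c.mem a + (R + 1) = R + 2 * c.mem a + 1 by ring, hs'.memory]) r.le_right
        (by omega)
      exact ⟨_, r.trans s, hs'.update d _⟩
    | store d a =>
      obtain ⟨mem', r, hs', h0⟩ := address d (R + 1) le_rfl code.1 code.2.1 code.2.2.1
      have hv := hc a
      have s := Runs.write (inp := inp₀) (R + 2 * c.mem d + 1) (c.mem a) code.2.2.2.1 (by
        simp only [Instr.exec, Config.set, h0, hs'.memory]
        rw [show 2 * c.mem d + (R + 1) = R + 2 * c.mem d + 1 by ring]) r.le_right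
        (by omega)
      exact ⟨_, r.trans s, hs'.update _ _⟩
    | read d a =>
      obtain ⟨mem', r, hs', h0⟩ := address a R (by omega) code.1 code.2.1 code.2.2.1
      have s := Runs.write (inp := inp₀) (R + 2 * d + 1) (inp.getD (c.mem a) 0) code.2.2.2.1 (by
        simp only [Instr.exec, Config.set, h0]
        rw [show 2 * c.mem a + R = R + 2 * c.mem a by ring, hs'.input]) r.le_right (by
        rw [← hs'.input]
        exact r.le_right _)
      exact ⟨_, r.trans s, hs'.update _ _⟩
    | jump l =>
      exact ⟨mem, (Runs.goto _ code.1 rfl hmem).mono (by omega), hs⟩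
    | jumpZero a l =>
      by_cases ha : c.mem a = 0
      · refine ⟨mem, (Runs.goto _ code.1 ?_ hmem).mono (by omega), ?_⟩
        · simp [Instr.exec, ha, hs.memory]
        · simpa [Instr.exec, ha] using hs
      · have s₁ := Runs.goto (inp := inp₀) (base + 4 * c.pc + 1) code.1
          (by simp [Instr.exec, ha, hs.memory]) hmem
        have s₂ := Runs.goto (inp := inp₀) (base + 4 * (c.pc + 1)) code.2.1 rfl hmem
        refine ⟨mem, ?_, ?_⟩
        · simpa [Instr.exec, ha] using (s₁.trans s₂).mono (show 1 + 1 ≤ 4 by omega)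
        · simpa [Instr.exec, ha] using hs
    | halt b => exact ⟨mem, (Runs.refl hmem).mono (by omega), hs⟩

theorem simulate_runs {Q P : Program} {inp₀ inp : List ℕ} {R base V U : ℕ} (hR : 2 ≤ R)
    (hQ : CodeAt Q base (simulate R base 0 P)) (hV : 2 * U + R + 1 ≤ V) {mem : ℕ → ℕ}
    (hs : Simulates R inp init.mem mem) (hmem : ∀ a, mem a ≤ V) (T : ℕ)
    (hU : ∀ i ≤ T, ∀ a, (configAt P inp i).mem a ≤ U) :
    ∃ mem', Runs Q inp₀ V (4 * T) ⟨base, mem⟩ ⟨base + 4 * (configAt P inp T).pc, mem'⟩ ∧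
      Simulates R inp (configAt P inp T).mem mem' := by
  induction T with
  | zero => exact ⟨mem, Runs.refl hmem, hs⟩
  | succ T ih =>
    obtain ⟨m₁, r₁, hs₁⟩ := ih fun i hi => hU i (by omega)
    have e : configAt P inp (T + 1) = step P inp (configAt P inp T) := by
      rw [configAt, Function.iterate_succ_apply', configAt]
    obtain ⟨m₂, r₂, hs₂⟩ := simulate_step (inp₀ := inp₀) hR hQ hV hs₁ r₁.le_right (hU T (by omega))
      (e ▸ hU (T + 1) le_rfl)
    rw [← e] at r₂ hs₂
    exact ⟨m₂, (r₁.trans r₂).mono (by omega), hs₂⟩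

theorem le_foldr_max {l : List ℕ} {x : ℕ} (h : x ∈ l) : x ≤ l.foldr max 0 := by
  induction l with
  | nil => simp at h
  | cons y l ih =>
    rcases List.mem_cons.1 h with rfl | h
    · exact le_max_left _ _
    · exact (ih h).trans (le_max_right _ _)

theorem foldr_max_le {l : List ℕ} {V : ℕ} (h : ∀ x ∈ l, x ≤ V) : l.foldr max 0 ≤ V := by
  induction l with
  | nil => exact Nat.zero_le _
  | cons y l ih =>
    exact max_le (h y (by simp)) (ih fun x hx => h x (by simp [hx]))

/-- Polynomial bounds in `Y` become words of `O(log Y)` bits. -/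
theorem mul_pow_lt_two_pow_log (A e Y : ℕ) (hY : 2 ≤ Y) :
    A * Y ^ e < 2 ^ (2 * (A + e) * Nat.log 2 Y) := by
  have h₁ : A < Y ^ A := A.lt_two_pow_self.trans_le (Nat.pow_le_pow_left hY A)
  have hlog : 1 ≤ Nat.log 2 Y := Nat.log_pos (by norm_num) hY
  have h₂ : Y ≤ 2 ^ (2 * Nat.log 2 Y) :=
    (Nat.lt_pow_succ_log_self (by norm_num) Y).le.trans
      (Nat.pow_le_pow_right (by norm_num) (by omega))
  calc A * Y ^ e < Y ^ A * Y ^ e := by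
        exact Nat.mul_lt_mul_of_pos_right h₁ (by positivity)
    _ = Y ^ (A + e) := (pow_add _ _ _).symm
    _ ≤ (2 ^ (2 * Nat.log 2 Y)) ^ (A + e) := Nat.pow_le_pow_left h₂ _
    _ = 2 ^ (2 * (A + e) * Nat.log 2 Y) := by rw [← pow_mul]; congr 1; ring

/-- A decision problem can be solved by computing an equivalent instance of a solvable problem. -/
theorem SolvableInTime.of_reduction {α β : Type} {encα : α → List ℕ} {instα yesα : α → Prop}
    {tα : α → ℝ} {encβ : β → List ℕ} {instβ yesβ : β → Prop} {tβ : β → ℝ}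
    (h : SolvableInTime encβ instβ yesβ tβ) (g : Gen) (f : α → β) (K : ℕ)
    (hone : ∀ x, instα x → 1 ≤ tα x) (hinst : ∀ x, instα x → instβ (f x))
    (hyes : ∀ x, instα x → (yesβ (f x) ↔ yesα x))
    (hout : ∀ x, instα x → g.out (encα x) [] = encβ (f x))
    (hcost : ∀ x, instα x → (g.cost (encα x) [] : ℝ) ≤ K * tα x)
    (htime : ∀ x, instα x → tβ (f x) ≤ K * tα x) :
    SolvableInTime encα instα yesα tα := by
  obtain ⟨P, K', c, hP⟩ := h
  set R := g.width 0 with hR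
  have hR2 : 2 ≤ R := g.add_two_le_width 0
  set base := 1 + (g.compile 0 1).length with hbase
  set Q : Program := [.const 0 R] ++ g.compile 0 1 ++ simulate R base 0 P with hQ
  set A₁ := 3 * K + R + 3 with hA₁
  set A := 2 * R + K + 2 + 2 * A₁ ^ c with hA
  refine ⟨Q, 1 + K + 4 * (K' * K), 2 * (A + (c + 1)), fun x hx => ?_⟩
  obtain ⟨T, hT, ⟨b, hb, hbyes⟩, hw⟩ := hP (f x) (hinst x hx)
  have ht := hone x hx
  set inp := encα x with hinp
  set Y := inp.length + inp.foldr max 0 + ⌈tα x⌉₊ + 2 with hY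
  have hcostY : g.cost inp [] ≤ K * Y := by
    have : (g.cost inp [] : ℝ) ≤ (K * Y : ℕ) := by
      refine (hcost x hx).trans ?_
      push_cast
      refine mul_le_mul_of_nonneg_left ((Nat.le_ceil _).trans ?_) (Nat.cast_nonneg _)
      exact_mod_cast (by omega : ⌈tα x⌉₊ ≤ Y)
    exact_mod_cast this
  have htY : ⌈tβ (f x)⌉₊ ≤ K * Y := by
    refine Nat.ceil_le.2 ((htime x hx).trans ?_)
    push_cast
    refine mul_le_mul_of_nonneg_left ((Nat.le_ceil _).trans ?_) (Nat.cast_nonneg _)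
    exact_mod_cast (by omega : ⌈tα x⌉₊ ≤ Y)
  set U := 2 ^ wordLength c (encβ (f x)) (tβ (f x)) with hU
  set V₁ := inp.foldr max 0 + R + g.cost inp [] with hV₁
  set V := V₁ + (2 * U + R + 1) with hV
  -- Used twice: with the sharp bound `V₁` to estimate the generated numbers, and with the larger
  -- `V` as the prefix of the whole run.
  have run : ∀ W, V₁ ≤ W → ∃ mem', Runs Q inp W (1 + g.cost inp []) init ⟨base, mem'⟩ ∧
      ∀ a, R ≤ a → mem' a = writeOut (fun _ => 0) R (encβ (f x)) a := by
    intro W hW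
    have s₁ := Runs.write (P := Q) (inp := inp) (V := W) (b := 0) (mem := fun _ => 0) 0 R
      (by simp [hQ]; rfl) rfl (fun _ => Nat.zero_le _) (by omega)
    obtain ⟨mem', r, -, -, hm⟩ := g.compile_runs (P := Q) (inp := inp) (V := W) (W := R)
      (fun y hy => (le_foldr_max hy).trans (by omega)) [] 1 _
      (codeAt_of_eq_append [.const 0 R] _ _) (fun i hi => by simp at hi) s₁.le_right le_rfl
      (by simp) (by simp; omega)
    refine ⟨mem', s₁.trans r, fun a ha => ?_⟩
    rw [hm a ha, hout x hx, Function.update_self]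
    exact writeOut_congr _ _ (by rw [Function.update_of_ne (by omega)])
  -- Every entry of the computed instance is a memory content at the end of a run bounded by `V₁`.
  have henc : ∀ y ∈ encβ (f x), y ≤ V₁ := by
    intro y hy
    obtain ⟨mem', r, hm⟩ := run V₁ le_rfl
    obtain ⟨i, hi, rfl⟩ := List.getElem_of_mem hy
    have := r.le_right (R + 2 * i)
    rwa [hm _ (by omega), writeOut_apply _ _ _ _ hi] at this
  have hlen : (encβ (f x)).length ≤ g.cost inp [] := by
    have := g.length_out_le inp []
    rw [hout x hx] at this
    omega
  -- Length, entries and time bound of the computed instance are all linear in `Y`, so its words are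
  -- longer than those of `x` only by a constant factor.
  have hUle : U ≤ A₁ ^ c * Y ^ c := by
    rw [hU, wordLength, mul_comm c, pow_mul, ← mul_pow]
    refine Nat.pow_le_pow_left ((Nat.pow_log_le_self 2 (by omega)).trans ?_) c
    have h₁ := foldr_max_le henc
    have h₂ : A₁ * Y = K * Y + K * Y + K * Y + R * Y + 3 * Y := by rw [hA₁]; ring
    have h₃ : R ≤ R * Y := Nat.le_mul_of_pos_right _ (by omega)
    omega
  have hVlt : V < 2 ^ wordLength (2 * (A + (c + 1))) inp (tα x) := by
    refine lt_of_le_of_lt ?_ (mul_pow_lt_two_pow_log A (c + 1) Y (by omega))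
    have h₁ : Y ≤ Y ^ (c + 1) := Nat.le_self_pow (by omega) Y
    have h₂ : Y ^ c ≤ Y ^ (c + 1) := Nat.pow_le_pow_right (by omega) (by omega)
    have h₃ : U ≤ A₁ ^ c * Y ^ (c + 1) := hUle.trans (Nat.mul_le_mul_left _ h₂)
    have h₄ : A * Y ^ (c + 1) = 2 * (R * Y ^ (c + 1)) + K * Y ^ (c + 1) + 2 * Y ^ (c + 1) +
      2 * (A₁ ^ c * Y ^ (c + 1)) := by rw [hA]; ring
    have h₅ : R ≤ R * Y ^ (c + 1) := Nat.le_mul_of_pos_right _ (by positivity)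
    have h₆ : K * Y ≤ K * Y ^ (c + 1) := Nat.mul_le_mul_left _ h₁
    omega
  obtain ⟨mem₁, r₁, hm₁⟩ := run V (by omega)
  obtain ⟨mem₂, r₂, -⟩ := simulate_runs (Q := Q) (P := P) (inp₀ := inp) (inp := encβ (f x))
    (V := V) (U := U) hR2 (base := base)
    (by
      have := codeAt_of_eq_append ([.const 0 R] ++ g.compile 0 1) (simulate R base 0 P) []
      simpa [hQ, hbase, add_comm] using this)
    (by omega) (mem := mem₁)
    -- The odd cells above `R` were never written and are still 0, as the initial memory requires;
    -- unwritten even cells agree with the value 0 read beyond the end of the input.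
    { memory := fun a => by
        rw [hm₁ _ (by omega), writeOut_of_ne _ _ _ (by intro i _; omega)]
        rfl
      input := fun j => by
        rw [hm₁ _ (by omega)]
        by_cases hj : j < (encβ (f x)).length
        · rw [writeOut_apply _ _ _ _ hj]
          simp [hj]
        · rw [writeOut_of_ne _ _ _ (by intro i _; omega)]
          simp [hj] }
    r₁.le_right T (fun i hi a => (hw i hi a).le)
  obtain ⟨T', hT', e, hmem⟩ := r₁.trans r₂
  refine ⟨T', ?_, ⟨b, ?_, hbyes.trans (hyes x hx)⟩, fun i hi a => (hmem i hi a).trans_lt hVlt⟩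
  · have h₁ : (T : ℝ) ≤ K' * K * tα x := by
      refine hT.trans ?_
      rw [mul_assoc]
      exact mul_le_mul_of_nonneg_left (htime x hx) (Nat.cast_nonneg _)
    have h₂ : (T' : ℝ) ≤ 1 + g.cost inp [] + 4 * T := by exact_mod_cast hT'
    have h₃ := hcost x hx
    push_cast
    nlinarith
  · rw [configAt, e]
    rw [answer] at hb ⊢
    simp only
    cases hi : P[(configAt P (encβ (f x)) T).pc]? with
    | none => simp [hi] at hb
    | some i =>
      have code := codeAt_simInstr (Q := Q) (R := R) (base := base) (k := 0) (by
        have := codeAt_of_eq_append ([.const 0 R] ++ g.compile 0 1) (simulate R base 0 P) []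
        simpa [hQ, hbase, add_comm] using this) hi
      rw [zero_add] at code
      rw [hi] at hb
      cases i <;> simp at hb
      subst hb
      rw [code.1]

end RAM


/-! ### Encoding orthogonality of three families of vectors in the matching problem -/

namespace TripleMatch

/-- The number of positions in one half of the pattern. -/
def patHalf (N m : ℕ) : ℕ := N * (m + 1)

/-- The number of cells in one half of the text. -/
def textHalf (N m : ℕ) : ℕ := (3 * N - 2) * (m + 1)

/-- The half in which a position lies, for two halves of length `X`. -/
def side (X c : ℕ) : ℕ := if c < X then 0 else 1

/-- The distance of a position from its end, for two halves of length `X`. -/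
def fold (X c : ℕ) : ℕ := if c < X then c else 2 * X - 1 - c

/-- `N` blocks that stand for vectors lie between two groups of `N - 1` blocks without a meaning. -/
def stage (N b : ℕ) : ℕ := if b < N - 1 then 0 else if b < 2 * N - 1 then 1 else 2

/-- The bit that is represented by the cell `q` of the half `s` of the text. -/
def bit (N m : ℕ) (F : ℕ → ℕ → ℕ → ℕ) (s q : ℕ) : ℕ :=
  if stage N (q / (m + 1)) = 1 ∧ q % (m + 1) ≠ 0 then
    F s (q / (m + 1) - (N - 1)) (q % (m + 1) - 1) else 0

/-- The position of the only nonzero letter in the cell `q` of the half `s` of the text. -/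
def offset (N m : ℕ) (F : ℕ → ℕ → ℕ → ℕ) (s q : ℕ) : ℕ :=
  -- The bit is complemented on the right, so the offsets of two mirror partners in equal stages
  -- differ by 1 minus the sum of their bits.
  4 * stage N (q / (m + 1)) + if s = 0 then bit N m F s q else 1 - bit N m F s q

/-- The letter for the half `s`; the first cell of a block has its own letter. -/
def symbol (m s q : ℕ) : ℕ := 1 + 2 * s + if q % (m + 1) = 0 then 0 else 1

/-- The text consists of cells of width `20`. -/
def textLetter (N m : ℕ) (F : ℕ → ℕ → ℕ → ℕ) (p : ℕ) : ℕ :=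
  let s := side (textHalf N m) (p / 20)
  let q := fold (textHalf N m) (p / 20)
  if p % 20 = offset N m F s q then symbol m s q else 0

def patLetter (N m i : ℕ) : ℕ := symbol m (side (patHalf N m) i) (fold (patHalf N m) i)

/-- The gap lengths that are allowed by the constraints of kind `τ`. -/
def Allowed (τ x : ℕ) : Prop :=
  -- The distance of the matched positions is `x + 1`. Offsets are at most 9, so a distance from 19
  -- to 21 means neighbouring cells.
  if τ = 0 then 18 ≤ x ∧ x ≤ 20
  -- Staying in a stage gives the residues 19, 0, 1, and advancing by one stage gives 3, 4, 5; a
  -- jump over the middle stage would give 7, 8 or 9.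
  else if τ = 1 then (x + 1) % 20 = 19 ∨ (x + 1) % 20 ≤ 5
  -- For mirror partners, different stages give residues from 3 to 17, and equal stages give 19, 0
  -- or 1. The residue 19 arises exactly when both bits are 1, which kind 3 excludes.
  else if τ = 2 then (x + 1) % 20 = 19 ∨ (x + 1) % 20 ≤ 1
  else if τ = 3 then (x + 1) % 20 ≤ 1
  else True

/-- The kind of the constraint between a position of the pattern and its mirror image. -/
def pairKind (m : ℕ) (F : ℕ → ℕ → ℕ → ℕ) (i : ℕ) : ℕ :=
  2 + if i % (m + 1) = 0 then 0 else F 2 (i / (m + 1)) (i % (m + 1) - 1)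

/-- The kind of the constraint between two neighbours in the left half of the pattern. -/
def leftKind (m i : ℕ) : ℕ := if i % (m + 1) = m then 1 else 0

/-- The kind of the constraint between the images of `i` and `i + 1` in the right half. -/
def rightKind (m i : ℕ) : ℕ := if i % (m + 1) = m then 4 else 0

/-- The constraints: left position, right position, kind. -/
def data (N m : ℕ) (F : ℕ → ℕ → ℕ → ℕ) : List (ℕ × ℕ × ℕ) :=
  (List.range (patHalf N m)).map (fun i => (i, 2 * patHalf N m - 1 - i, pairKind m F i)) ++
  (List.range (patHalf N m - 1)).map (fun i => (i, i + 1, leftKind m i)) ++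
  (List.range (patHalf N m - 1)).map (fun i =>
    (2 * patHalf N m - 2 - i, 2 * patHalf N m - 1 - i, rightKind m i))

/-- A match as a function on the natural numbers, suited to linear arithmetic; values beyond the
pattern are irrelevant. -/
structure IsEmbedding (N m : ℕ) (F : ℕ → ℕ → ℕ → ℕ) (e : ℕ → ℕ) : Prop where
  strictMono : ∀ i j, i < j → j < 2 * patHalf N m → e i < e j
  lt : ∀ i < 2 * patHalf N m, e i < 40 * textHalf N m
  letter : ∀ i < 2 * patHalf N m, textLetter N m F (e i) = patLetter N m i
  allowed : ∀ d ∈ data N m F, Allowed d.2.2 (e d.2.1 - e d.1 - 1)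

variable {N m : ℕ} {F : ℕ → ℕ → ℕ → ℕ}

theorem stage_le (N b : ℕ) : stage N b ≤ 2 := by
  unfold stage
  split_ifs <;> omega

theorem bit_le (hF : ∀ g i k, F g i k ≤ 1) (s q : ℕ) : bit N m F s q ≤ 1 := by
  unfold bit
  split_ifs
  · exact hF _ _ _
  · omega

theorem offset_zero (q : ℕ) :
    offset N m F 0 q = 4 * stage N (q / (m + 1)) + bit N m F 0 q := by
  simp [offset]

theorem offset_one (q : ℕ) :
    offset N m F 1 q = 4 * stage N (q / (m + 1)) + (1 - bit N m F 1 q) := by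
  simp [offset]

theorem offset_lt (hF : ∀ g i k, F g i k ≤ 1) (s q : ℕ) : offset N m F s q < 20 := by
  have h₁ := stage_le N (q / (m + 1))
  have h₂ := bit_le (N := N) (m := m) hF s q
  unfold offset
  split_ifs <;> omega

theorem bit_block (b k : ℕ) (hk : k < m) (s : ℕ) (hb : stage N b = 1) :
    bit N m F s (b * (m + 1) + (k + 1)) = F s (b - (N - 1)) k := by
  have h₁ : (b * (m + 1) + (k + 1)) / (m + 1) = b := by
    rw [mul_comm, Nat.mul_add_div (by omega), Nat.div_eq_of_lt (by omega), add_zero]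
  have h₂ : (b * (m + 1) + (k + 1)) % (m + 1) = k + 1 := by
    rw [mul_comm, Nat.mul_add_mod, Nat.mod_eq_of_lt (by omega)]
  unfold bit
  rw [h₁, h₂]
  simp [hb]

theorem mem_data {d : ℕ × ℕ × ℕ} : d ∈ data N m F ↔
    (∃ i < patHalf N m, d = (i, 2 * patHalf N m - 1 - i, pairKind m F i)) ∨
    (∃ i < patHalf N m - 1, d = (i, i + 1, leftKind m i)) ∨
    (∃ i < patHalf N m - 1,
      d = (2 * patHalf N m - 2 - i, 2 * patHalf N m - 1 - i, rightKind m i)) := by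
  simp only [data, List.mem_append, List.mem_map, List.mem_range, or_assoc, eq_comm]

theorem symbol_eq {s s' q q' : ℕ} (h : symbol m s q = symbol m s' q') :
    s = s' ∧ (q % (m + 1) = 0 ↔ q' % (m + 1) = 0) := by
  unfold symbol at h
  split_ifs at h <;> constructor <;> omega

/-- A strictly increasing sequence of blocks that never advances by two stages has a member in the
middle stage. -/
theorem exists_stage_eq_one (hN : 2 ≤ N) {B : ℕ → ℕ} (hB : ∀ j, j + 1 < N → B j < B (j + 1))
    (hlt : ∀ j < N, B j < 3 * N - 2)
    (hst : ∀ j, j + 1 < N → stage N (B (j + 1)) ≤ stage N (B j) + 1) :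
    ∃ j < N, stage N (B j) = 1 := by
  have hge : ∀ j < N, j ≤ B j := by
    intro j
    induction j with
    | zero => simp
    | succ j ih =>
      intro hj
      have := ih (by omega)
      have := hB j hj
      omega
  have hle : ∀ r < N, B (N - 1 - r) + r < 3 * N - 2 := by
    intro r
    induction r with
    | zero => intro _; simpa using hlt (N - 1) (by omega)
    | succ r ih =>
      intro hr
      have := ih (by omega)
      have h := hB (N - 1 - (r + 1)) (by omega)
      rw [show N - 1 - (r + 1) + 1 = N - 1 - r by omega] at h
      omega
  -- `N - 1` smaller blocks precede the last one, and stage 0 has only `N - 1` blocks.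
  have hlast : stage N (B (N - 1)) ≠ 0 := by
    have := hge (N - 1) (by omega)
    unfold stage
    split_ifs <;> omega
  -- `N - 1` larger blocks follow the first one, and stage 2 has only `N - 1` blocks.
  have hfirst : stage N (B 0) ≤ 1 := by
    have := hle (N - 1) (by omega)
    rw [Nat.sub_self] at this
    unfold stage
    split_ifs <;> omega
  -- The first block outside stage 0 is the initial one or has a predecessor in stage 0; in both
  -- cases its stage is 1.
  have hex : ∃ j, stage N (B j) ≠ 0 := ⟨_, hlast⟩
  have hspec := Nat.find_spec hex
  have hmin : ∀ {j}, j < Nat.find hex → ¬ stage N (B j) ≠ 0 := fun h => Nat.find_min hex h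
  have hfind : Nat.find hex ≤ N - 1 := Nat.find_min' hex hlast
  revert hspec hmin hfind
  generalize Nat.find hex = j
  intro hspec hmin hj
  refine ⟨j, by omega, ?_⟩
  cases j with
  | zero => omega
  | succ j =>
    have h₁ := hst j (by omega)
    have h₂ := hmin (Nat.lt_succ_self j)
    omega

/-- Soundness: the embedding carries pattern blocks to whole text blocks on both sides. The one that
meets the middle stage selects a vector of each family, and its mirror constraints certify
orthogonality. -/
theorem exists_triple_of_isEmbedding (hN : 2 ≤ N) (hF : ∀ g i k, F g i k ≤ 1) {e : ℕ → ℕ}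
    (he : IsEmbedding N m F e) :
    ∃ a < N, ∃ b < N, ∃ c < N, ∀ k < m, ¬ (F 0 a k = 1 ∧ F 1 b k = 1 ∧ F 2 c k = 1) := by
  set D := patHalf N m with hD
  set Q := textHalf N m with hQ
  -- Pattern letters are nonzero, so they meet the unique nonzero letter of a cell; equality of
  -- letters then fixes the half and whether the cell starts a block.
  have hsym : ∀ i < 2 * D, e i % 20 = offset N m F (side Q (e i / 20)) (fold Q (e i / 20)) ∧
      side Q (e i / 20) = side D i ∧
      (fold Q (e i / 20) % (m + 1) = 0 ↔ fold D i % (m + 1) = 0) := by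
    intro i hi
    have h := he.letter i hi
    simp only [textLetter, patLetter, ← hD, ← hQ] at h
    split_ifs at h with h'
    · exact ⟨h', symbol_eq h⟩
    · unfold symbol at h
      omega
  obtain ⟨L, hL⟩ : ∃ L : ℕ → ℕ, ∀ i, L i = e i / 20 := ⟨_, fun _ => rfl⟩
  -- Counted from the far end of the text, the cells of the mirror images obey the same rules as the
  -- cells `L i`.
  obtain ⟨R, hR⟩ : ∃ R : ℕ → ℕ, ∀ i, R i = 2 * Q - 1 - e (2 * D - 1 - i) / 20 := ⟨_, fun _ => rfl⟩
  have hleft : ∀ i < D, L i < Q ∧ e i = 20 * L i + offset N m F 0 (L i) ∧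
      (L i % (m + 1) = 0 ↔ i % (m + 1) = 0) := by
    intro i hi
    obtain ⟨h₁, h₂, h₃⟩ := hsym i (by omega)
    have hs : side D i = 0 := by simp [side, hi]
    have hlt : e i / 20 < Q := by
      by_contra hc
      rw [hs] at h₂
      simp [side, hc] at h₂
    have hs' : side Q (e i / 20) = 0 := by simp [side, hlt]
    simp only [fold, hlt, hi, if_true] at h₁ h₃
    rw [hs', ← hL] at h₁
    rw [← hL] at hlt h₃
    exact ⟨hlt, by rw [hL] at h₁ ⊢; omega, h₃⟩
  have hright : ∀ i < D, R i < Q ∧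
      e (2 * D - 1 - i) = 20 * (2 * Q - 1 - R i) + offset N m F 1 (R i) ∧
      (R i % (m + 1) = 0 ↔ i % (m + 1) = 0) := by
    intro i hi
    obtain ⟨h₁, h₂, h₃⟩ := hsym (2 * D - 1 - i) (by omega)
    have hlt' := he.lt (2 * D - 1 - i) (by omega)
    rw [← hQ] at hlt'
    have hc : ¬ 2 * D - 1 - i < D := by omega
    have hs : side D (2 * D - 1 - i) = 1 := by simp [side, hc]
    have hlt : ¬ e (2 * D - 1 - i) / 20 < Q := by
      intro hc
      rw [hs] at h₂
      simp [side, hc] at h₂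
    have hs' : side Q (e (2 * D - 1 - i) / 20) = 1 := by simp [side, hlt]
    simp only [fold, hlt, hc, if_false] at h₁ h₃
    rw [hs', ← hR] at h₁
    rw [← hR, show 2 * D - 1 - (2 * D - 1 - i) = i by omega] at h₃
    have hRi := hR i
    exact ⟨by omega, by omega, h₃⟩
  -- Modulo 20 the distance is four times the difference of the stages, plus 1 minus both bits.
  have hpair : ∀ i < D, stage N (R i / (m + 1)) = stage N (L i / (m + 1)) ∧
      (pairKind m F i = 3 → ¬ (bit N m F 0 (L i) = 1 ∧ bit N m F 1 (R i) = 1)) := by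
    intro i hi
    have h := he.allowed _ (mem_data.2 (.inl ⟨i, hi, rfl⟩))
    have hlt := he.strictMono i (2 * D - 1 - i) (by omega) (by omega)
    simp only [← hD] at h
    obtain ⟨l₁, l₂, -⟩ := hleft i hi
    obtain ⟨r₁, r₂, -⟩ := hright i hi
    rw [offset_zero] at l₂
    rw [offset_one] at r₂
    have b₁ := bit_le (N := N) (m := m) hF 0 (L i)
    have b₂ := bit_le (N := N) (m := m) hF 1 (R i)
    have s₁ := stage_le N (L i / (m + 1))
    have s₂ := stage_le N (R i / (m + 1))
    have hk : pairKind m F i = 2 ∨ pairKind m F i = 3 := by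
      have := hF 2 (i / (m + 1)) (i % (m + 1) - 1)
      unfold pairKind
      split_ifs <;> omega
    rcases hk with hk | hk
    · rw [hk] at h ⊢
      simp only [Allowed] at h
      norm_num at h
      refine ⟨?_, by omega⟩
      omega
    · rw [hk] at h ⊢
      simp only [Allowed] at h
      norm_num at h
      refine ⟨?_, ?_⟩ <;> omega
  have hadjL : ∀ i, i + 1 < D → i % (m + 1) ≠ m → L (i + 1) = L i + 1 := by
    intro i hi hm
    have h := he.allowed _ (mem_data.2 (.inr (.inl ⟨i, by omega, rfl⟩)))
    have hlt := he.strictMono i (i + 1) (by omega) (by omega)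
    simp only [leftKind, hm, Allowed, if_true, if_false] at h
    obtain ⟨-, l₂, -⟩ := hleft i (by omega)
    obtain ⟨-, l₂', -⟩ := hleft (i + 1) (by omega)
    have o₁ := bit_le (N := N) (m := m) hF 0 (L i)
    have o₂ := bit_le (N := N) (m := m) hF 0 (L (i + 1))
    have s₁ := stage_le N (L i / (m + 1))
    have s₂ := stage_le N (L (i + 1) / (m + 1))
    rw [offset_zero] at l₂ l₂'
    omega
  have hadjR : ∀ i, i + 1 < D → i % (m + 1) ≠ m → R (i + 1) = R i + 1 := by
    intro i hi hm
    have h := he.allowed _ (mem_data.2 (.inr (.inr ⟨i, by omega, rfl⟩)))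
    have hlt := he.strictMono (2 * D - 2 - i) (2 * D - 1 - i) (by omega) (by omega)
    simp only [rightKind, hm, Allowed, if_true, if_false, ← hD] at h
    obtain ⟨r₁, r₂, -⟩ := hright i (by omega)
    obtain ⟨r₁', r₂', -⟩ := hright (i + 1) (by omega)
    rw [show 2 * D - 1 - (i + 1) = 2 * D - 2 - i by omega] at r₂'
    have o₁ := bit_le (N := N) (m := m) hF 1 (R i)
    have o₂ := bit_le (N := N) (m := m) hF 1 (R (i + 1))
    have s₁ := stage_le N (R i / (m + 1))
    have s₂ := stage_le N (R (i + 1) / (m + 1))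
    rw [offset_one] at r₂ r₂'
    omega
  have hpos : ∀ j < N, ∀ k ≤ m, j * (m + 1) + k < D := by
    intro j hj k hk
    have : (j + 1) * (m + 1) ≤ D := Nat.mul_le_mul_right _ hj
    rw [add_mul] at this
    omega
  have hmod : ∀ j k, k ≤ m → (j * (m + 1) + k) % (m + 1) = k := by
    intro j k hk
    rw [mul_comm, Nat.mul_add_mod, Nat.mod_eq_of_lt (by omega)]
  have hdiv : ∀ j k, k ≤ m → (j * (m + 1) + k) / (m + 1) = j := by
    intro j k hk
    rw [mul_comm, Nat.mul_add_div (by omega), Nat.div_eq_of_lt (by omega), add_zero]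
  -- The letter for block starts aligns the first cell, and adjacency propagates the alignment. The
  -- same argument serves `L` and `R`.
  have blocks : ∀ X : ℕ → ℕ, (∀ i, i + 1 < D → i % (m + 1) ≠ m → X (i + 1) = X i + 1) →
      (∀ i < D, X i % (m + 1) = 0 ↔ i % (m + 1) = 0) →
      ∀ j < N, ∀ k ≤ m, X (j * (m + 1) + k) = X (j * (m + 1)) / (m + 1) * (m + 1) + k := by
    intro X hX hX0 j hj k
    induction k with
    | zero =>
      intro _
      have h := (hX0 (j * (m + 1)) (hpos j hj 0 (by omega))).2 (by simp)
      rw [add_zero, add_zero, Nat.div_mul_cancel (Nat.dvd_of_mod_eq_zero h)]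
    | succ k ih =>
      intro hk
      rw [← add_assoc, hX (j * (m + 1) + k) (hpos j hj (k + 1) hk)
        (by rw [hmod j k (by omega)]; omega),
        ih (by omega), add_assoc]
  obtain ⟨A, hA⟩ : ∃ A : ℕ → ℕ, ∀ j, A j = L (j * (m + 1)) / (m + 1) := ⟨_, fun _ => rfl⟩
  obtain ⟨B, hB⟩ : ∃ B : ℕ → ℕ, ∀ j, B j = R (j * (m + 1)) / (m + 1) := ⟨_, fun _ => rfl⟩
  have hLA : ∀ j < N, ∀ k ≤ m, L (j * (m + 1) + k) = A j * (m + 1) + k := by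
    intro j hj k hk
    rw [hA]
    exact blocks L hadjL (fun i hi => (hleft i hi).2.2) j hj k hk
  have hRB : ∀ j < N, ∀ k ≤ m, R (j * (m + 1) + k) = B j * (m + 1) + k := by
    intro j hj k hk
    rw [hB]
    exact blocks R hadjR (fun i hi => (hright i hi).2.2) j hj k hk
  have hstage : ∀ j < N, stage N (B j) = stage N (A j) := by
    intro j hj
    have := (hpair _ (hpos j hj 0 (by omega))).1
    rwa [hLA j hj 0 (by omega), hRB j hj 0 (by omega), hdiv _ _ (by omega),
      hdiv _ _ (by omega)] at this
  have hAlt : ∀ j < N, A j < 3 * N - 2 := by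
    intro j hj
    have h := (hleft _ (hpos j hj 0 (by omega))).1
    rw [hLA j hj 0 (by omega), add_zero] at h
    exact lt_of_mul_lt_mul_right h (Nat.zero_le _)
  have hAmono : ∀ j, j + 1 < N → A j < A (j + 1) := by
    intro j hj
    have h := he.strictMono (j * (m + 1) + 0) ((j + 1) * (m + 1) + 0) (by rw [add_mul]; omega)
      (by have := hpos (j + 1) hj 0 (by omega); omega)
    have h' : L (j * (m + 1) + 0) ≤ L ((j + 1) * (m + 1) + 0) := by
      rw [hL, hL]
      exact Nat.div_le_div_right h.le
    have hne : L (j * (m + 1) + 0) ≠ L ((j + 1) * (m + 1) + 0) := by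
      intro hc
      have e₁ := (hleft _ (hpos j (by omega) 0 (by omega))).2.1
      have e₂ := (hleft _ (hpos (j + 1) hj 0 (by omega))).2.1
      rw [hc] at e₁
      omega
    have h'' := lt_of_le_of_ne h' hne
    rw [hLA j (by omega) 0 (by omega), hLA (j + 1) hj 0 (by omega), add_zero, add_zero] at h''
    exact lt_of_mul_lt_mul_right h'' (Nat.zero_le _)
  -- This uses the constraint between the last position of block `j` and the first one of the next
  -- block.
  have hAstep : ∀ j, j + 1 < N → stage N (A (j + 1)) ≤ stage N (A j) + 1 := by
    intro j hj
    have hi := hpos (j + 1) hj 0 (by omega)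
    rw [show (j + 1) * (m + 1) + 0 = j * (m + 1) + m + 1 by ring] at hi
    have h := he.allowed _ (mem_data.2 (.inr (.inl ⟨j * (m + 1) + m, by omega, rfl⟩)))
    have hlt := he.strictMono (j * (m + 1) + m) (j * (m + 1) + m + 1) (by omega) (by omega)
    simp only [leftKind, hmod j m le_rfl, Allowed, if_true] at h
    norm_num at h
    obtain ⟨-, l₂, -⟩ := hleft (j * (m + 1) + m) (by omega)
    obtain ⟨-, l₂', -⟩ := hleft (j * (m + 1) + m + 1) (by omega)
    have e₁ : L (j * (m + 1) + m) / (m + 1) = A j := by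
      rw [hLA j (by omega) m le_rfl, hdiv _ _ le_rfl]
    have e₂ : L (j * (m + 1) + m + 1) / (m + 1) = A (j + 1) := by
      rw [show j * (m + 1) + m + 1 = (j + 1) * (m + 1) + 0 by ring, hLA (j + 1) hj 0 (by omega),
        hdiv _ _ (by omega)]
    have o₁ := bit_le (N := N) (m := m) hF 0 (L (j * (m + 1) + m))
    have o₂ := bit_le (N := N) (m := m) hF 0 (L (j * (m + 1) + m + 1))
    have s₁ := stage_le N (A j)
    have s₂ := stage_le N (A (j + 1))
    rw [offset_zero, e₁] at l₂
    rw [offset_zero, e₂] at l₂'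
    omega
  obtain ⟨j, hj, hst⟩ := exists_stage_eq_one hN hAmono hAlt hAstep
  have hst' := hst
  have hst'' : stage N (B j) = 1 := (hstage j hj).trans hst
  have hlt : ∀ b, stage N b = 1 → b - (N - 1) < N := by
    intro b hb
    unfold stage at hb
    split_ifs at hb <;> omega
  -- The middle stage starts at block `N - 1`; the third vector is the pattern block itself.
  refine ⟨A j - (N - 1), hlt _ hst, B j - (N - 1), hlt _ hst'', j, hj, ?_⟩
  rintro k hk ⟨h₁, h₂, h₃⟩
  refine (hpair _ (hpos j hj (k + 1) (by omega))).2 ?_ ⟨?_, ?_⟩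
  · simp [pairKind, hmod j (k + 1) (by omega), hdiv j (k + 1) (by omega), h₃]
  · rw [hLA j hj _ (by omega), bit_block _ _ hk _ hst, h₁]
  · rw [hRB j hj _ (by omega), bit_block _ _ hk _ hst'', h₂]

/-! ### Embeddings from orthogonal triples -/

/-- The block of the text in which the block `j` of the pattern is placed, if the block `c` of the
pattern goes to the block with number `x` of the middle stage. -/
def blockOf (N c x j : ℕ) : ℕ :=
  if j < c then j else if j = c then N - 1 + x else 2 * N - 2 + (j - c)

theorem stage_blockOf {c x j : ℕ} (hc : c < N) (hx : x < N) :
    stage N (blockOf N c x j) = if j < c then 0 else if j = c then 1 else 2 := by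
  unfold stage blockOf
  split_ifs <;> omega

theorem blockOf_lt {c x j : ℕ} (hx : x < N) (hj : j < N) : blockOf N c x j < 3 * N - 2 := by
  unfold blockOf
  split_ifs <;> omega

theorem blockOf_lt_blockOf {c x j j' : ℕ} (hc : c < N) (hx : x < N) (h : j < j') :
    blockOf N c x j < blockOf N c x j' := by
  unfold blockOf
  split_ifs <;> omega

/-- The cell of the text in which the position `i` of the pattern is placed. -/
def cellOf (N m c x i : ℕ) : ℕ := blockOf N c x (i / (m + 1)) * (m + 1) + i % (m + 1)

theorem cellOf_div (N m c x i : ℕ) : cellOf N m c x i / (m + 1) = blockOf N c x (i / (m + 1)) := by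
  rw [cellOf, mul_comm, Nat.mul_add_div (by omega),
    Nat.div_eq_of_lt (Nat.mod_lt _ (by omega)), add_zero]

theorem cellOf_mod (N m c x i : ℕ) : cellOf N m c x i % (m + 1) = i % (m + 1) := by
  rw [cellOf, mul_comm, Nat.mul_add_mod, Nat.mod_mod]

theorem cellOf_lt {c x i : ℕ} (hx : x < N) (hi : i < patHalf N m) :
    cellOf N m c x i < textHalf N m := by
  have h₁ : i / (m + 1) < N := Nat.div_lt_of_lt_mul (by rwa [patHalf, mul_comm] at hi)
  have h₂ : (blockOf N c x (i / (m + 1)) + 1) * (m + 1) ≤ textHalf N m :=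
    Nat.mul_le_mul_right _ (blockOf_lt hx h₁)
  have h₃ := Nat.mod_lt i (show 0 < m + 1 by omega)
  rw [add_mul] at h₂
  unfold cellOf
  omega

theorem cellOf_lt_cellOf {c x i i' : ℕ} (hc : c < N) (hx : x < N) (h : i < i') :
    cellOf N m c x i < cellOf N m c x i' := by
  have e := Nat.div_add_mod i (m + 1)
  have e' := Nat.div_add_mod i' (m + 1)
  have l := Nat.mod_lt i (show 0 < m + 1 by omega)
  unfold cellOf
  rcases (Nat.div_le_div_right (c := m + 1) h.le).eq_or_lt with hd | hd
  · rw [hd] at e ⊢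
    omega
  · have h₂ := Nat.mul_le_mul_right (m + 1) (blockOf_lt_blockOf hc hx hd)
    rw [Nat.succ_eq_add_one, add_mul] at h₂
    omega

theorem bit_cellOf {c x i s : ℕ} (hc : c < N) (hx : x < N) :
    bit N m F s (cellOf N m c x i) =
      if i / (m + 1) = c ∧ i % (m + 1) ≠ 0 then F s x (i % (m + 1) - 1) else 0 := by
  have h : stage N (blockOf N c x (i / (m + 1))) = 1 ↔ i / (m + 1) = c := by
    rw [stage_blockOf hc hx]
    grind
  unfold bit
  rw [cellOf_div, cellOf_mod]
  simp only [h]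
  split_ifs with h'
  · simp [blockOf, h'.1]
  · rfl

/-- Completeness: block `c` goes to the vector `a` on the left and to `b` on the right, earlier
blocks to stage 0 and later ones to stage 2. The stages agree on both sides since they depend only
on `c`. -/
theorem exists_isEmbedding_of_triple (hF : ∀ g i k, F g i k ≤ 1) {a b c : ℕ} (ha : a < N)
    (hb : b < N) (hc : c < N) (h : ∀ k < m, ¬ (F 0 a k = 1 ∧ F 1 b k = 1 ∧ F 2 c k = 1)) :
    ∃ e, IsEmbedding N m F e := by
  set D := patHalf N m with hD
  set Q := textHalf N m with hQ
  obtain ⟨L, hL⟩ : ∃ L : ℕ → ℕ, ∀ i, L i = cellOf N m c a i := ⟨_, fun _ => rfl⟩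
  obtain ⟨R, hR⟩ : ∃ R : ℕ → ℕ, ∀ i, R i = cellOf N m c b i := ⟨_, fun _ => rfl⟩
  have hLlt : ∀ i < D, L i < Q := fun i hi => hL i ▸ cellOf_lt ha hi
  have hRlt : ∀ i < D, R i < Q := fun i hi => hR i ▸ cellOf_lt hb hi
  have hLmono : ∀ i i', i < i' → L i < L i' := fun i i' h => by
    rw [hL, hL]
    exact cellOf_lt_cellOf hc ha h
  have hRmono : ∀ i i', i < i' → R i < R i' := fun i i' h => by
    rw [hR, hR]
    exact cellOf_lt_cellOf hc hb h
  obtain ⟨e, he⟩ : ∃ e : ℕ → ℕ, ∀ i, e i = if i < D then 20 * L i + offset N m F 0 (L i) else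
      20 * (2 * Q - 1 - R (2 * D - 1 - i)) + offset N m F 1 (R (2 * D - 1 - i)) :=
    ⟨_, fun _ => rfl⟩
  have hleft : ∀ i < D, e i = 20 * L i + offset N m F 0 (L i) := fun i hi => by
    rw [he, if_pos hi]
  have hright : ∀ i < D, e (2 * D - 1 - i) = 20 * (2 * Q - 1 - R i) + offset N m F 1 (R i) :=
    fun i hi => by
      rw [he, if_neg (by omega), show 2 * D - 1 - (2 * D - 1 - i) = i by omega]
  have hoff : ∀ s q, offset N m F s q < 20 := offset_lt hF
  have hsL : ∀ i, stage N (L i / (m + 1)) =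
      if i / (m + 1) < c then 0 else if i / (m + 1) = c then 1 else 2 := fun i => by
    rw [hL, cellOf_div, stage_blockOf hc ha]
  have hsR : ∀ i, stage N (R i / (m + 1)) =
      if i / (m + 1) < c then 0 else if i / (m + 1) = c then 1 else 2 := fun i => by
    rw [hR, cellOf_div, stage_blockOf hc hb]
  have hnext : ∀ i, i % (m + 1) ≠ m →
      (i + 1) / (m + 1) = i / (m + 1) ∧ (i + 1) % (m + 1) = i % (m + 1) + 1 := by
    intro i hi
    have l := Nat.mod_lt i (show 0 < m + 1 by omega)
    have e := Nat.div_add_mod i (m + 1)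
    have e' : i + 1 = (m + 1) * (i / (m + 1)) + (i % (m + 1) + 1) := by omega
    constructor
    · rw [e', Nat.mul_add_div (by omega),
        Nat.div_eq_of_lt (show i % (m + 1) + 1 < m + 1 by omega), add_zero]
    · conv_lhs => rw [e', Nat.mul_add_mod]
      exact Nat.mod_eq_of_lt (by omega)
  refine ⟨e, ⟨?_, ?_, ?_, ?_⟩⟩
  · intro i j hij hj
    have hjD : ∀ i, ¬ i < D → i < 2 * D → 2 * D - 1 - i < D := by omega
    rw [← hD] at hj
    rw [he, he]
    have o₁ := hoff 0 (L i)
    have o₂ := hoff 0 (L j)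
    have o₃ := hoff 1 (R (2 * D - 1 - i))
    have o₄ := hoff 1 (R (2 * D - 1 - j))
    split_ifs with h₁ h₂ h₂
    · have := hLmono i j hij
      omega
    · have := hLlt i h₁
      have := hRlt _ (hjD j h₂ hj)
      omega
    · omega
    · have := hRmono (2 * D - 1 - j) (2 * D - 1 - i) (by omega)
      have := hRlt _ (hjD i h₁ (by omega))
      omega
  · intro i hi
    rw [← hD] at hi
    rw [he, ← hQ]
    have o₁ := hoff 0 (L i)
    have o₃ := hoff 1 (R (2 * D - 1 - i))
    split_ifs with h₁
    · have := hLlt i h₁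
      omega
    · have := hRlt (2 * D - 1 - i) (by omega)
      omega
  · intro i hi
    rw [← hD] at hi
    simp only [textLetter, patLetter, ← hD, ← hQ]
    by_cases h₁ : i < D
    · have o := hoff 0 (L i)
      have hq := hLlt i h₁
      rw [hleft i h₁, show (20 * L i + offset N m F 0 (L i)) / 20 = L i by omega,
        show (20 * L i + offset N m F 0 (L i)) % 20 = offset N m F 0 (L i) by omega]
      simp only [side, fold, hq, h₁, if_true, symbol]
      rw [hL, cellOf_mod]
    · obtain ⟨j, hj, rfl⟩ : ∃ j < D, i = 2 * D - 1 - j := ⟨2 * D - 1 - i, by omega, by omega⟩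
      have o := hoff 1 (R j)
      have hq := hRlt j hj
      rw [hright j hj, show (20 * (2 * Q - 1 - R j) + offset N m F 1 (R j)) / 20 =
          2 * Q - 1 - R j by omega,
        show (20 * (2 * Q - 1 - R j) + offset N m F 1 (R j)) % 20 = offset N m F 1 (R j) by omega]
      have hn : ¬ 2 * Q - 1 - R j < Q := by omega
      simp only [side, fold, hn, h₁, if_false, symbol]
      rw [show 2 * Q - 1 - (2 * Q - 1 - R j) = R j by omega,
        show 2 * D - 1 - (2 * D - 1 - j) = j by omega, if_pos rfl, hR, cellOf_mod]
  · intro d hd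
    rcases mem_data.1 hd with ⟨i, hi, rfl⟩ | ⟨i, hi, rfl⟩ | ⟨i, hi, rfl⟩
    · simp only [← hD] at hi ⊢
      rw [hright i hi, hleft i hi, offset_zero, offset_one, hsL, hsR]
      have hq := hLlt i hi
      have hq' := hRlt i hi
      have b₁ := bit_le (N := N) (m := m) hF 0 (L i)
      have b₂ := bit_le (N := N) (m := m) hF 1 (R i)
      -- Outside block `c`, and at block starts, both bits are 0; elsewhere this is orthogonality at
      -- one coordinate.
      have hbits : pairKind m F i = 3 → ¬ (bit N m F 0 (L i) = 1 ∧ bit N m F 1 (R i) = 1) := by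
        rw [hL, hR, bit_cellOf hc ha, bit_cellOf hc hb]
        intro hk
        split_ifs with h'
        · have hk' : F 2 c (i % (m + 1) - 1) = 1 := by
            rw [pairKind, if_neg h'.2, h'.1] at hk
            omega
          have l := Nat.mod_lt i (show 0 < m + 1 by omega)
          rintro ⟨h₁, h₂⟩
          exact h (i % (m + 1) - 1) (by omega) ⟨h₁, h₂, hk'⟩
        · simp
      have hk : pairKind m F i = 2 ∨ pairKind m F i = 3 := by
        have := hF 2 (i / (m + 1)) (i % (m + 1) - 1)
        unfold pairKind
        split_ifs <;> omega
      -- The common stage cancels in the distance, so its value is not needed.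
      generalize (if i / (m + 1) < c then 0 else if i / (m + 1) = c then 1 else 2) = s
      rcases hk with hk | hk
      · rw [hk]
        simp only [Allowed]
        norm_num
        omega
      · have hbits := hbits hk
        rw [hk]
        simp only [Allowed]
        norm_num
        omega
    · simp only [← hD] at hi ⊢
      rw [hleft i (by omega), hleft (i + 1) (by omega), offset_zero, offset_zero]
      have hlt := hLmono i (i + 1) (by omega)
      have b₁ := bit_le (N := N) (m := m) hF 0 (L i)
      have b₂ := bit_le (N := N) (m := m) hF 0 (L (i + 1))
      by_cases hk : i % (m + 1) = m
      · have hs : stage N (L i / (m + 1)) ≤ stage N (L (i + 1) / (m + 1)) ∧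
            stage N (L (i + 1) / (m + 1)) ≤ stage N (L i / (m + 1)) + 1 := by
          have e₁ : (i + 1) / (m + 1) = i / (m + 1) + 1 := by
            have e := Nat.div_add_mod i (m + 1)
            rw [show i + 1 = (m + 1) * (i / (m + 1)) + (m + 1) by omega,
              Nat.mul_add_div (by omega), Nat.div_self (by omega)]
          rw [hsL, hsL, e₁]
          generalize i / (m + 1) = j
          split_ifs <;> omega
        simp only [leftKind, hk, if_true, Allowed]
        norm_num
        omega
      · have e₁ := hnext i hk
        have hs : stage N (L (i + 1) / (m + 1)) = stage N (L i / (m + 1)) := by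
          rw [hsL, hsL, e₁.1]
        have hL' : L (i + 1) = L i + 1 := by
          rw [hL, hL, cellOf, cellOf, e₁.1, e₁.2, add_assoc]
        simp only [leftKind, hk, if_false, Allowed, if_true]
        omega
    · simp only [← hD] at hi ⊢
      have hr := hright (i + 1) (by omega)
      rw [show 2 * D - 1 - (i + 1) = 2 * D - 2 - i by omega] at hr
      rw [hright i (by omega), hr, offset_one, offset_one]
      have hlt := hRmono i (i + 1) (by omega)
      have hq := hRlt (i + 1) (by omega)
      have b₁ := bit_le (N := N) (m := m) hF 1 (R i)
      have b₂ := bit_le (N := N) (m := m) hF 1 (R (i + 1))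
      by_cases hk : i % (m + 1) = m
      · simp [rightKind, hk, Allowed]
      · have e₁ := hnext i hk
        have hs : stage N (R (i + 1) / (m + 1)) = stage N (R i / (m + 1)) := by
          rw [hsR, hsR, e₁.1]
        have hR' : R (i + 1) = R i + 1 := by
          rw [hR, hR, cellOf, cellOf, e₁.1, e₁.2, add_assoc]
        simp only [rightKind, hk, if_false, Allowed, if_true]
        omega

end TripleMatch


/-! ### Representations of the sets of gap lengths -/

namespace PartialDFA

theorem size_le {σ : ℕ} (A : PartialDFA σ) : A.size ≤ A.numStates + A.numStates * σ := by
  unfold size transitions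
  refine Nat.add_le_add_left ?_ _
  rw [List.length_flatMap]
  refine (List.sum_le_card_nsmul _ σ ?_).trans (by simp)
  intro x hx
  obtain ⟨q, -, rfl⟩ := List.mem_map.1 hx
  exact (List.length_filterMap_le _ _).trans (by simp)

/-- An automaton that counts the letters modulo `n + 1`. -/
def cyclic (σ n : ℕ) (p : ℕ → Bool) : PartialDFA σ where
  numStates := n + 1
  start := 0
  step q _ := some (q + 1)
  accept q := p q

/-- An automaton that counts up to `n` letters. -/
def bounded (σ n : ℕ) (p : ℕ → Bool) : PartialDFA σ where
  numStates := n + 1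
  start := 0
  step q _ := if h : (q : ℕ) + 1 < n + 1 then some ⟨q + 1, h⟩ else none
  accept q := p q

theorem mem_language_iff {σ : ℕ} (A : PartialDFA σ) (v : List (Fin σ)) :
    v ∈ A.language ↔ ∃ s, A.toDFA.eval v = some s ∧ A.accept s = true := Iff.rfl

theorem eval_cyclic (σ n : ℕ) (p : ℕ → Bool) (v : List (Fin σ)) :
    (cyclic σ n p).toDFA.eval v = some (Fin.ofNat (n + 1) v.length) := by
  induction v using List.reverseRecOn with
  | nil => rfl
  | append_singleton v a ih =>
    rw [DFA.eval_append_singleton, ih]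
    simp only [toDFA, cyclic, Option.bind_some, List.length_append, List.length_singleton]
    congr 1
    ext
    simp [Fin.val_add]

theorem language_cyclic (σ n : ℕ) (p : ℕ → Bool) :
    (cyclic σ n p).language = {v | p (v.length % (n + 1)) = true} := by
  ext v
  rw [mem_language_iff, eval_cyclic]
  simp [cyclic]

theorem eval_bounded (σ n : ℕ) (p : ℕ → Bool) (v : List (Fin σ)) :
    (bounded σ n p).toDFA.eval v =
      if h : v.length < n + 1 then some (⟨v.length, h⟩ : Fin (n + 1)) else none := by
  induction v using List.reverseRecOn with
  | nil => rfl
  | append_singleton v a ih =>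
    rw [DFA.eval_append_singleton, ih]
    simp only [toDFA, bounded, List.length_append, List.length_singleton]
    by_cases h : v.length < n + 1
    · rw [dif_pos h]
      rfl
    · rw [dif_neg h, dif_neg (by omega)]
      rfl

theorem language_bounded (σ n : ℕ) (p : ℕ → Bool) :
    (bounded σ n p).language = {v | v.length ≤ n ∧ p v.length = true} := by
  ext v
  rw [mem_language_iff, eval_bounded]
  by_cases h : v.length < n + 1
  · simp [h, bounded, Nat.lt_succ_iff.1 h]
  · simp [h, bounded]
    omega

end PartialDFA

namespace SemilinearRep

/-- The numbers with residue modulo `n + 1` in a given set. -/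
def cyclic (n : ℕ) (p : ℕ → Bool) : SemilinearRep :=
  ((List.range (n + 1)).filter p).map fun r => ⟨r, [n + 1], by simp⟩

/-- The numbers up to `n` in a given set. -/
def bounded (n : ℕ) (p : ℕ → Bool) : SemilinearRep :=
  ((List.range (n + 1)).filter p).map fun r => ⟨r, [], by simp⟩

theorem toSet_cyclic (n : ℕ) (p : ℕ → Bool) :
    (cyclic n p).toSet = {x | p (x % (n + 1)) = true} := by
  ext x
  simp only [toSet, cyclic, LinearRep.toSet, List.mem_map, List.mem_filter, List.mem_range,
    Set.mem_ofPred_eq]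
  constructor
  · rintro ⟨_, ⟨r, ⟨hr, hp⟩, rfl⟩, k, rfl⟩
    have : (r + ∑ i, k i * [n + 1].get i) % (n + 1) = r := by
      simp [Nat.mod_eq_of_lt hr]
    rwa [this]
  · intro hp
    refine ⟨_, ⟨x % (n + 1), ⟨Nat.mod_lt _ (by omega), hp⟩, rfl⟩, fun _ => x / (n + 1), ?_⟩
    have := Nat.mod_add_div x (n + 1)
    simp
    rw [mul_comm]
    exact this.symm

theorem toSet_bounded (n : ℕ) (p : ℕ → Bool) :
    (bounded n p).toSet = {x | x ≤ n ∧ p x = true} := by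
  ext x
  simp only [toSet, bounded, LinearRep.toSet, List.mem_map, List.mem_filter, List.mem_range,
    Set.mem_ofPred_eq]
  constructor
  · rintro ⟨_, ⟨r, ⟨hr, hp⟩, rfl⟩, k, rfl⟩
    simp [hp]
    omega
  · intro hp
    exact ⟨_, ⟨x, ⟨by omega, hp.2⟩, rfl⟩, fun _ => 0, by simp⟩

theorem size_cyclic_le (n : ℕ) (p : ℕ → Bool) : (cyclic n p).size ≤ (n + 1) * 2 := by
  rw [size, cyclic, List.map_map]
  refine (List.sum_le_card_nsmul _ 2 ?_).trans ?_
  · intro x hx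
    obtain ⟨r, -, rfl⟩ := List.mem_map.1 hx
    simp [LinearRep.size]
  · simpa using List.length_filter_le p (List.range (n + 1))

theorem size_bounded_le (n : ℕ) (p : ℕ → Bool) : (bounded n p).size ≤ (n + 1) * 2 := by
  rw [size, bounded, List.map_map]
  refine (List.sum_le_card_nsmul _ 2 ?_).trans ?_
  · intro x hx
    obtain ⟨r, -, rfl⟩ := List.mem_map.1 hx
    simp [LinearRep.size]
  · simpa using List.length_filter_le p (List.range (n + 1))

end SemilinearRep

/-! ### Periodic and bounded sets of lengths for both kinds of constraints -/

namespace ConstraintKind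

theorem exists_rep_cyclic (𝓛 : ConstraintKind) (σ n : ℕ) (hσ : 1 ≤ σ) (p : ℕ → Bool) :
    ∃ r : 𝓛.Rep σ, 𝓛.language r = {v | p (v.length % (n + 1)) = true} ∧
      𝓛.size r ≤ (n + 1) * (σ + 1) := by
  cases 𝓛 with
  | reg =>
    refine ⟨PartialDFA.cyclic σ n p, PartialDFA.language_cyclic σ n p, ?_⟩
    exact (PartialDFA.size_le _).trans (by simp [PartialDFA.cyclic]; ring_nf; rfl)
  | semi =>
    refine ⟨SemilinearRep.cyclic n p, ?_, (SemilinearRep.size_cyclic_le n p).trans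
      (Nat.mul_le_mul_left _ (by omega))⟩
    ext v
    simp only [language, SemilinearRep.toSet_cyclic]
    rfl

theorem exists_rep_bounded (𝓛 : ConstraintKind) (σ n : ℕ) (hσ : 1 ≤ σ) (p : ℕ → Bool) :
    ∃ r : 𝓛.Rep σ, 𝓛.language r = {v | v.length ≤ n ∧ p v.length = true} ∧
      𝓛.size r ≤ (n + 1) * (σ + 1) := by
  cases 𝓛 with
  | reg =>
    refine ⟨PartialDFA.bounded σ n p, PartialDFA.language_bounded σ n p, ?_⟩
    exact (PartialDFA.size_le _).trans (by simp [PartialDFA.bounded]; ring_nf; rfl)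
  | semi =>
    refine ⟨SemilinearRep.bounded n p, ?_, (SemilinearRep.size_bounded_le n p).trans
      (Nat.mul_le_mul_left _ (by omega))⟩
    ext v
    simp only [language, SemilinearRep.toSet_bounded]
    rfl

end ConstraintKind

namespace TripleMatch

/-- The bound is `21 * 6`, from the lengths 0 to 20 over five letters; the periodic kinds need only
`20 * 6`. -/
theorem exists_rep (𝓛 : ConstraintKind) (τ : ℕ) :
    ∃ r : 𝓛.Rep 5, 𝓛.language r = {v | Allowed τ v.length} ∧ 𝓛.size r ≤ 126 := by
  by_cases h0 : τ = 0
  · obtain ⟨r, hr, hs⟩ := 𝓛.exists_rep_bounded 5 20 (by norm_num) fun x => decide (18 ≤ x)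
    refine ⟨r, ?_, hs⟩
    rw [hr]
    ext v
    simp [Allowed, h0, and_comm]
  · obtain ⟨r, hr, hs⟩ := 𝓛.exists_rep_cyclic 5 19 (by norm_num) fun x =>
      if τ = 1 then decide ((x + 1) % 20 = 19 ∨ (x + 1) % 20 ≤ 5)
      else if τ = 2 then decide ((x + 1) % 20 = 19 ∨ (x + 1) % 20 ≤ 1)
      else if τ = 3 then decide ((x + 1) % 20 ≤ 1)
      else true
    refine ⟨r, ?_, hs.trans (by norm_num)⟩
    rw [hr]
    ext v
    simp only [Allowed, h0, if_false, Set.mem_ofPred_eq, Nat.reduceAdd]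
    split_ifs <;> simp

/-- A representation of the constraint language of kind `τ`. -/
noncomputable def rep (𝓛 : ConstraintKind) (τ : ℕ) : 𝓛.Rep 5 := (exists_rep 𝓛 τ).choose

theorem language_rep (𝓛 : ConstraintKind) (τ : ℕ) :
    𝓛.language (rep 𝓛 τ) = {v | Allowed τ v.length} := (exists_rep 𝓛 τ).choose_spec.1

theorem size_rep_le (𝓛 : ConstraintKind) (τ : ℕ) : 𝓛.size (rep 𝓛 τ) ≤ 126 :=
  (exists_rep 𝓛 τ).choose_spec.2

/-! ### The instance -/

variable (N m : ℕ) (F : ℕ → ℕ → ℕ → ℕ)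

def text : List (Fin 5) :=
  (List.range (40 * textHalf N m)).map fun p => Fin.ofNat 5 (textLetter N m F p)

def pattern : List (Fin 5) :=
  (List.range (2 * patHalf N m)).map fun i => Fin.ofNat 5 (patLetter N m i)

theorem length_text : (text N m F).length = 40 * textHalf N m := by simp [text]

theorem length_pattern : (pattern N m).length = 2 * patHalf N m := by simp [pattern]

theorem data_lt : ∀ d ∈ data N m F, d.1 < d.2.1 ∧ d.2.1 < (pattern N m).length := by
  intro d hd
  rw [length_pattern]
  rcases mem_data.1 hd with ⟨i, hi, rfl⟩ | ⟨i, hi, rfl⟩ | ⟨i, hi, rfl⟩ <;> simp only <;> omega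

/-- The constraint between the given positions, of the given kind. -/
noncomputable def constraint (𝓛 : ConstraintKind) (M : ℕ) (d : ℕ × ℕ × ℕ)
    (h : d.1 < d.2.1 ∧ d.2.1 < M) : GapConstraint 𝓛 5 M where
  left := ⟨d.1, h.1.trans h.2⟩
  right := ⟨d.2.1, h.2⟩
  lt := h.1
  rep := rep 𝓛 d.2.2

theorem mem_language_constraint {𝓛 : ConstraintKind} {M : ℕ} {d : ℕ × ℕ × ℕ}
    (h : d.1 < d.2.1 ∧ d.2.1 < M) (v : List (Fin 5)) :
    v ∈ (constraint 𝓛 M d h).language ↔ Allowed d.2.2 v.length := by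
  change v ∈ 𝓛.language (rep 𝓛 d.2.2) ↔ _
  rw [language_rep, Set.mem_ofPred_eq]

theorem mem_interval_constraint {𝓛 : ConstraintKind} {M : ℕ} {d : ℕ × ℕ × ℕ}
    (h : d.1 < d.2.1 ∧ d.2.1 < M) (x : Fin M) :
    x ∈ (constraint 𝓛 M d h).interval ↔ d.1 ≤ x ∧ x < d.2.1 := by
  simp [GapConstraint.interval, constraint, Fin.le_def, Fin.lt_def]

theorem interval_constraint_inter {𝓛 : ConstraintKind} {M : ℕ} {d d' : ℕ × ℕ × ℕ}
    (h : d.1 < d.2.1 ∧ d.2.1 < M) (h' : d'.1 < d'.2.1 ∧ d'.2.1 < M)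
    (key : (d'.1 ≤ d.1 ∧ d.2.1 ≤ d'.2.1) ∨ (d.1 ≤ d'.1 ∧ d'.2.1 ≤ d.2.1) ∨ d.2.1 ≤ d'.1 ∨
      d'.2.1 ≤ d.1) :
    (constraint 𝓛 M d h).interval ∩ (constraint 𝓛 M d' h').interval =
        (constraint 𝓛 M d h).interval ∨
      (constraint 𝓛 M d h).interval ∩ (constraint 𝓛 M d' h').interval =
        (constraint 𝓛 M d' h').interval ∨
      (constraint 𝓛 M d h).interval ∩ (constraint 𝓛 M d' h').interval = ∅ := by
  simp only [Finset.ext_iff, Finset.mem_inter, mem_interval_constraint, Finset.notMem_empty,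
    iff_false]
  rcases key with key | key | key
  · exact .inl fun x => by omega
  · exact .inr (.inl fun x => by omega)
  · exact .inr (.inr fun x => by omega)

noncomputable def constraints (𝓛 : ConstraintKind) :
    List (GapConstraint 𝓛 5 (pattern N m).length) :=
  (data N m F).pmap (constraint 𝓛 _) (data_lt N m F)

variable {N m F}

theorem mem_constraints {𝓛 : ConstraintKind} {C : GapConstraint 𝓛 5 (pattern N m).length} :
    C ∈ constraints N m F 𝓛 ↔
      ∃ d, ∃ h : d ∈ data N m F, C = constraint 𝓛 _ d (data_lt N m F d h) := by
  simp only [constraints, List.mem_pmap, eq_comm]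

theorem two_le_patHalf (hN : 2 ≤ N) : 2 ≤ patHalf N m :=
  hN.trans (Nat.le_mul_of_pos_right _ (by omega))

theorem four_le_textHalf (hN : 2 ≤ N) : 4 ≤ textHalf N m :=
  (show 4 ≤ 3 * N - 2 by omega).trans (Nat.le_mul_of_pos_right _ (by omega))

theorem patHalf_le_textHalf (hN : 2 ≤ N) : patHalf N m ≤ textHalf N m :=
  Nat.mul_le_mul_right _ (by omega)

theorem length_data : (data N m F).length = patHalf N m + 2 * (patHalf N m - 1) := by
  simp [data]
  omega

theorem length_constraints (𝓛 : ConstraintKind) :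
    (constraints N m F 𝓛).length = patHalf N m + 2 * (patHalf N m - 1) := by
  rw [constraints, List.length_pmap, length_data]

theorem nodup_data : ((data N m F).map fun d => (d.1, d.2.1)).Nodup := by
  simp only [data, List.map_append, List.map_map, List.append_assoc]
  refine List.Nodup.append ?_ (List.Nodup.append ?_ ?_ ?_) ?_
  · refine List.Nodup.map_on ?_ List.nodup_range
    intro x _ y _ h
    simp only [Function.comp_apply, Prod.mk.injEq] at h
    exact h.1
  · refine List.Nodup.map_on ?_ List.nodup_range
    intro x _ y _ h
    simp only [Function.comp_apply, Prod.mk.injEq] at h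
    exact h.1
  · refine List.Nodup.map_on ?_ List.nodup_range
    intro x hx y hy h
    simp only [Function.comp_apply, Prod.mk.injEq, List.mem_range] at h hx hy
    omega
  · intro d h₁ h₂
    simp only [List.mem_map, List.mem_range, Function.comp_apply] at h₁ h₂
    obtain ⟨i, hi, rfl⟩ := h₁
    obtain ⟨j, hj, h⟩ := h₂
    simp only [Prod.mk.injEq] at h
    omega
  · intro d h₁ h₂
    simp only [List.mem_map, List.mem_range, Function.comp_apply, List.mem_append] at h₁ h₂
    obtain ⟨i, hi, rfl⟩ := h₁
    rcases h₂ with ⟨j, hj, h⟩ | ⟨j, hj, h⟩ <;> simp only [Prod.mk.injEq] at h <;> omega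

theorem nodup_constraints (𝓛 : ConstraintKind) :
    ((constraints N m F 𝓛).map fun C => (C.left, C.right)).Nodup := by
  refine List.Nodup.of_map (fun p : Fin _ × Fin _ => ((p.1 : ℕ), (p.2 : ℕ))) ?_
  have : ((constraints N m F 𝓛).map fun C => (C.left, C.right)).map
      (fun p : Fin _ × Fin _ => ((p.1 : ℕ), (p.2 : ℕ))) =
      (data N m F).map fun d => (d.1, d.2.1) := by
    rw [constraints, List.map_pmap, List.map_pmap]
    simp only [constraint]
    rw [List.pmap_eq_map]
  rw [this]
  exact nodup_data

/-- The instance of the matching problem for the vectors given by `F`. -/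
noncomputable def inst (𝓛 : ConstraintKind) (N m : ℕ) (F : ℕ → ℕ → ℕ → ℕ) (hN : 2 ≤ N) :
    MatchInstance 𝓛 where
  σ := 5
  text := text N m F
  pattern := pattern N m
  constraints := constraints N m F 𝓛
  alphabet_le := by
    have := four_le_textHalf (m := m) hN
    rw [length_text]
    omega
  pattern_le := by
    have := patHalf_le_textHalf (m := m) hN
    rw [length_text, length_pattern]
    omega
  nonempty := by
    have := two_le_patHalf (m := m) hN
    rw [← List.length_pos_iff, length_constraints]
    omega
  nodup := nodup_constraints 𝓛
  size_le := by
    intro C hC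
    obtain ⟨d, h, rfl⟩ := mem_constraints.1 hC
    -- The text has at least 160 letters, so the standing size bound admits 126.
    have h₁ := four_le_textHalf (m := m) hN
    refine (size_rep_le 𝓛 d.2.2).trans ?_
    rw [length_text]
    cases 𝓛 with
    | reg => exact (show 126 ≤ 40 * textHalf N m by omega).trans (Nat.le_self_pow (by norm_num) _)
    | semi => exact (show 126 ≤ 40 * textHalf N m by omega)

theorem inst_size_le (𝓛 : ConstraintKind) (hN : 2 ≤ N) :
    ∀ C ∈ (inst 𝓛 N m F hN).constraints, C.size ≤ 126 := by
  intro C hC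
  obtain ⟨d, h, rfl⟩ := mem_constraints.1 hC
  exact size_rep_le 𝓛 d.2.2

/-- Mirror pairs have nested intervals. Neighbours have one-element intervals, which are contained
in or disjoint from any other. -/
theorem inst_nonIntersecting (𝓛 : ConstraintKind) (hN : 2 ≤ N) :
    (inst 𝓛 N m F hN).NonIntersecting := by
  intro C hC C' hC'
  obtain ⟨d, h, rfl⟩ := mem_constraints.1 hC
  obtain ⟨d', h', rfl⟩ := mem_constraints.1 hC'
  have key : (d'.1 ≤ d.1 ∧ d.2.1 ≤ d'.2.1) ∨ (d.1 ≤ d'.1 ∧ d'.2.1 ≤ d.2.1) ∨ d.2.1 ≤ d'.1 ∨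
      d'.2.1 ≤ d.1 := by
    rcases mem_data.1 h with ⟨i, hi, rfl⟩ | ⟨i, hi, rfl⟩ | ⟨i, hi, rfl⟩ <;>
    rcases mem_data.1 h' with ⟨j, hj, rfl⟩ | ⟨j, hj, rfl⟩ | ⟨j, hj, rfl⟩ <;>
    simp only <;> omega
  exact interval_constraint_inter _ _ key

theorem textLetter_lt (p : ℕ) : textLetter N m F p < 5 := by
  have h : ∀ X c, side X c ≤ 1 := fun X c => by
    unfold side
    split_ifs <;> omega
  have := h (textHalf N m) (p / 20)
  simp only [textLetter, symbol]
  split_ifs <;> omega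

theorem patLetter_lt (i : ℕ) : patLetter N m i < 5 := by
  have h : ∀ X c, side X c ≤ 1 := fun X c => by
    unfold side
    split_ifs <;> omega
  have := h (patHalf N m) i
  simp only [patLetter, symbol]
  split_ifs <;> omega

theorem text_get (p : Fin (text N m F).length) :
    (((text N m F).get p : Fin 5) : ℕ) = textLetter N m F p := by
  change (((text N m F)[(p : ℕ)] : Fin 5) : ℕ) = _
  simp only [text, List.getElem_map, List.getElem_range]
  exact Nat.mod_eq_of_lt (textLetter_lt _)

theorem pattern_get (i : Fin (pattern N m).length) :
    (((pattern N m).get i : Fin 5) : ℕ) = patLetter N m i := by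
  change (((pattern N m)[(i : ℕ)] : Fin 5) : ℕ) = _
  simp only [pattern, List.getElem_map, List.getElem_range]
  exact Nat.mod_eq_of_lt (patLetter_lt _)

theorem length_gap {α : Type} (v : List α) {M : ℕ} (e : Fin M → Fin v.length) (i j : Fin M) :
    (gap v e i j).length = (e j : ℕ) - e i - 1 := by
  have := (e j).2
  simp only [gap, List.length_take, List.length_drop]
  omega

theorem isMatch_inst_iff (𝓛 : ConstraintKind) (hN : 2 ≤ N) :
    (inst 𝓛 N m F hN).IsMatch ↔ ∃ e, IsEmbedding N m F e := by
  have hlen : ∀ i < 2 * patHalf N m, i < (pattern N m).length := fun i hi => by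
    rwa [length_pattern]
  constructor
  · rintro ⟨e, he, hl, hC⟩
    change Fin (pattern N m).length → Fin (text N m F).length at e
    -- The default 0 is never inspected.
    refine ⟨fun i => if h : i < (pattern N m).length then (e ⟨i, h⟩ : ℕ) else 0, ?_, ?_, ?_, ?_⟩
    · intro i j hij hj
      simp only [dif_pos (hlen j hj), dif_pos (hlen i (hij.trans hj))]
      exact he hij
    · intro i hi
      simp only [dif_pos (hlen i hi)]
      exact (e _).2.trans_eq (length_text N m F)
    · intro i hi
      simp only [dif_pos (hlen i hi)]
      rw [← text_get, ← pattern_get ⟨i, hlen i hi⟩]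
      exact congrArg Fin.val (hl ⟨i, hlen i hi⟩)
    · intro d hd
      have h := hC _ (mem_constraints.2 ⟨d, hd, rfl⟩)
      have hlt := data_lt N m F d hd
      simp only [dif_pos hlt.2, dif_pos (hlt.1.trans hlt.2)]
      have h' := (mem_language_constraint _ _).1 h
      exact (congrArg (Allowed d.2.2) (length_gap (text N m F) e _ _)).mp h'
  · rintro ⟨e, he⟩
    refine ⟨fun i => ⟨e i, ?_⟩, ?_, ?_, ?_⟩
    · exact (he.lt _ (i.2.trans_eq (length_pattern N m))).trans_eq (length_text N m F).symm
    · intro i j hij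
      exact he.strictMono i j hij (j.2.trans_eq (length_pattern N m))
    · intro i
      ext
      refine (text_get _).trans (.trans ?_ (pattern_get i).symm)
      exact he.letter i (i.2.trans_eq (length_pattern N m))
    · intro C hC
      obtain ⟨d, hd, rfl⟩ := mem_constraints.1 hC
      refine (mem_language_constraint _ _).2 ?_
      exact (congrArg (Allowed d.2.2) (length_gap (text N m F) _ _ _)).mpr (he.allowed d hd)

end TripleMatch


namespace RAM

/-! ### Upper bounds for values and costs -/

/-- `β` bounds the environment `ρ` entrywise. -/
def Below (ρ β : List ℕ) : Prop := ρ.length = β.length ∧ ∀ x, ρ.getD x 0 ≤ β.getD x 0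

theorem Below.nil : Below [] [] := ⟨rfl, fun _ => le_rfl⟩

theorem Below.append {ρ β : List ℕ} (h : Below ρ β) {v w : ℕ} (hv : v ≤ w) :
    Below (ρ ++ [v]) (β ++ [w]) := by
  refine ⟨by simp [h.1], fun x => ?_⟩
  rcases lt_trichotomy x ρ.length with hx | hx | hx
  · have := h.2 x
    have hx' : x < β.length := h.1 ▸ hx
    simp only [List.getD_eq_getElem?_getD] at this ⊢
    rwa [List.getElem?_append_left hx, List.getElem?_append_left hx']
  · have h₁ : (ρ ++ [v]).getD x 0 = v := by simp [hx]
    have h₂ : (β ++ [w]).getD x 0 = w := by simp [hx, h.1]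
    rw [h₁, h₂]
    exact hv
  · have h₁ : (ρ ++ [v]).getD x 0 = 0 := by
      rw [List.getD_eq_getElem?_getD, List.getElem?_eq_none (by simp; omega)]
      rfl
    rw [h₁]
    exact Nat.zero_le _

namespace NatExpr

/-- A bound for the values of an expression, where `B` bounds the entries of the input. -/
def bound (B : ℕ) : NatExpr → List ℕ → ℕ
  | const v, _ => v
  | var x, β => β.getD x 0
  | op .add e₁ e₂, β => e₁.bound B β + e₂.bound B (β ++ [e₁.bound B β])
  | op .mul e₁ e₂, β => e₁.bound B β * e₂.bound B (β ++ [e₁.bound B β])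
  -- Truncated subtraction, division and remainder do not exceed the first operand.
  | op _ e₁ _, β => e₁.bound B β
  | read _, _ => B
  | bind e₁ e₂, β => e₂.bound B (β ++ [e₁.bound B β])
  | iter count start body, β =>
    -- The maximum makes the bound increase with the rounds, so its final value bounds every
    -- intermediate accumulator.
    iterate (fun acc _ => max acc
        (body.bound B (β ++ [count.bound B β, acc, count.bound B β])))
      (start.bound B (β ++ [count.bound B β])) (count.bound B β)

/-- A bound for the cost of an expression. -/
def costBound (B : ℕ) : NatExpr → List ℕ → ℕ
  | const v, _ => v + 1
  | var _, _ => 1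
  | op o e₁ e₂, β => e₁.costBound B β + e₂.costBound B (β ++ [e₁.bound B β]) +
      o.charge (e₁.bound B β) (e₂.bound B (β ++ [e₁.bound B β])) + 1
  | read e, β => e.costBound B β + 1
  | bind e₁ e₂, β => e₁.costBound B β + e₂.costBound B (β ++ [e₁.bound B β]) + 1
  | iter count start body, β =>
    count.costBound B β + start.costBound B (β ++ [count.bound B β]) + 4 + count.bound B β *
      (body.costBound B (β ++ [count.bound B β, (iter count start body).bound B β,
        count.bound B β]) + 6)

/-- Additional rounds of `g` do no harm, as `g` never decreases the accumulator. -/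
theorem iterate_le_iterate {f g : ℕ → ℕ → ℕ} {z w n N : ℕ} (hn : n ≤ N) (hz : z ≤ w)
    (h : ∀ acc acc' i, i < N → acc ≤ acc' → f acc i ≤ g acc' i) (hg : ∀ acc i, acc ≤ g acc i) :
    iterate f z n ≤ iterate g w N := by
  induction N generalizing n with
  | zero =>
    obtain rfl : n = 0 := by omega
    exact hz
  | succ N ih =>
    have ih := fun n hn => ih (n := n) hn fun acc acc' i hi => h acc acc' i (by omega)
    cases n with
    | zero => exact (ih 0 (Nat.zero_le _)).trans (hg _ _)
    | succ n =>
      by_cases hnN : n = N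
      · subst hnN
        exact h _ _ _ (by omega) (ih n le_rfl)
      · exact (ih (n + 1) (by omega)).trans (hg _ _)

variable {inp : List ℕ} {B : ℕ}

theorem eval_le_bound (hB : ∀ x ∈ inp, x ≤ B) (e : NatExpr) {ρ β : List ℕ} (h : Below ρ β) :
    e.eval inp ρ ≤ e.bound B β := by
  induction e generalizing ρ β with
  | const v => exact le_rfl
  | var x => exact h.2 x
  | op o e₁ e₂ ih₁ ih₂ =>
    have h₁ := ih₁ h
    have h₂ := ih₂ (h.append h₁)
    cases o with
    | add => exact Nat.add_le_add h₁ h₂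
    | sub => exact (Nat.sub_le _ _).trans h₁
    | mul => exact Nat.mul_le_mul h₁ h₂
    | div => exact (Nat.div_le_self _ _).trans h₁
    | mod => exact (Nat.mod_le _ _).trans h₁
  | read e ih => exact getD_le hB _
  | bind e₁ e₂ ih₁ ih₂ => exact ih₂ (h.append (ih₁ h))
  | iter count start body ih₁ ih₂ ih₃ =>
    refine iterate_le_iterate (ih₁ h) (ih₂ (h.append (ih₁ h))) ?_ fun _ _ => le_max_left _ _
    intro acc acc' i hi ha
    refine le_trans (ih₃ ?_) (le_max_right _ _)
    simpa using ((h.append (ih₁ h)).append ha).append hi.le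

theorem cost_le_costBound (hB : ∀ x ∈ inp, x ≤ B) (e : NatExpr) {ρ β : List ℕ} (h : Below ρ β) :
    e.cost inp ρ ≤ e.costBound B β := by
  induction e generalizing ρ β with
  | const v => exact le_rfl
  | var x => exact le_rfl
  | op o e₁ e₂ ih₁ ih₂ =>
    have v₁ := eval_le_bound hB e₁ h
    have h₁ := ih₁ h
    have h₂ := ih₂ (h.append v₁)
    have v₂ := eval_le_bound hB e₂ (h.append v₁)
    refine Nat.add_le_add_right (Nat.add_le_add (Nat.add_le_add h₁ h₂) ?_) 1
    cases o with
    | add => exact Nat.add_le_add v₁ v₂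
    | mul => exact Nat.mul_le_mul v₁ v₂
    | sub => exact le_rfl
    | div => exact le_rfl
    | mod => exact le_rfl
  | read e ih => exact Nat.add_le_add_right (ih h) 1
  | bind e₁ e₂ ih₁ ih₂ =>
    exact Nat.add_le_add_right (Nat.add_le_add (ih₁ h) (ih₂ (h.append (eval_le_bound hB e₁ h)))) 1
  | iter count start body ih₁ ih₂ ih₃ =>
    have v₁ := eval_le_bound hB count h
    refine Nat.add_le_add (Nat.add_le_add_right (Nat.add_le_add (ih₁ h) (ih₂ (h.append v₁))) 4) ?_
    refine (Finset.sum_le_card_nsmul _ _ (body.costBound B (β ++ [count.bound B β,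
      (iter count start body).bound B β, count.bound B β]) + 6) ?_).trans ?_
    · intro i hi
      have hi : i < count.eval inp ρ := Finset.mem_range.1 hi
      refine Nat.add_le_add_right (ih₃ ?_) 6
      have hacc : iterate (fun acc i => body.eval inp (ρ ++ [count.eval inp ρ, acc, i]))
          (start.eval inp (ρ ++ [count.eval inp ρ])) i ≤ (iter count start body).bound B β := by
        refine iterate_le_iterate (hi.le.trans v₁) (eval_le_bound hB start (h.append v₁)) ?_
          fun _ _ => le_max_left _ _
        intro acc acc' j hj ha
        refine le_trans (eval_le_bound hB body ?_) (le_max_right _ _)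
        simpa using ((h.append v₁).append ha).append hj.le
      simpa using ((h.append v₁).append hacc).append (hi.le.trans v₁)
    · rw [Finset.card_range, smul_eq_mul]
      exact Nat.mul_le_mul_right _ v₁

end NatExpr

namespace Gen

/-- A bound for the cost of a generator. -/
def costBound (B : ℕ) : Gen → List ℕ → ℕ
  | emit e, β => e.costBound B β + 3
  | seq g₁ g₂, β => g₁.costBound B β + g₂.costBound B β
  | bind e g, β => e.costBound B β + g.costBound B (β ++ [e.bound B β])
  | loop count body, β => count.costBound B β + 3 + count.bound B β *
      (body.costBound B (β ++ [count.bound B β, count.bound B β]) + 5)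

variable {inp : List ℕ} {B : ℕ}

theorem cost_le_costBound (hB : ∀ x ∈ inp, x ≤ B) (g : Gen) {ρ β : List ℕ} (h : Below ρ β) :
    g.cost inp ρ ≤ g.costBound B β := by
  induction g generalizing ρ β with
  | emit e => exact Nat.add_le_add_right (e.cost_le_costBound hB h) 3
  | seq g₁ g₂ ih₁ ih₂ => exact Nat.add_le_add (ih₁ h) (ih₂ h)
  | bind e g ih =>
    exact Nat.add_le_add (e.cost_le_costBound hB h) (ih (h.append (e.eval_le_bound hB h)))
  | loop count body ih =>
    have v := count.eval_le_bound hB h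
    refine Nat.add_le_add (Nat.add_le_add_right (count.cost_le_costBound hB h) 3) ?_
    refine (Finset.sum_le_card_nsmul _ _ (body.costBound B (β ++ [count.bound B β,
      count.bound B β]) + 5) ?_).trans ?_
    · intro i hi
      refine Nat.add_le_add_right (ih ?_) 5
      simpa using (h.append v).append ((Finset.mem_range.1 hi).le.trans v)
    · rw [Finset.card_range, smul_eq_mul]
      exact Nat.mul_le_mul_right _ v

/-- Writes the given numbers. -/
def emitList : List ℕ → Gen
  -- A loop without rounds plays the role of the empty program.
  | [] => loop (.const 0) (emit (.const 0))
  | v :: l => seq (emit (.const v)) (emitList l)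

theorem out_emitList (inp l ρ : List ℕ) : (emitList l).out inp ρ = l := by
  induction l with
  | nil => rfl
  | cons v l ih => simp [emitList, out, ih, NatExpr.eval]

/-- Only constants are written; hence the representations of the constraints contribute absolute
constants to the cost. -/
theorem costBound_emitList (B : ℕ) (l β : List ℕ) :
    (emitList l).costBound B β = (emitList l).costBound 0 [] := by
  induction l with
  | nil => rfl
  | cons v l ih => simp [emitList, costBound, NatExpr.costBound, ih]

end Gen

end RAM


/-! ### Satisfiability as orthogonality -/

namespace SatReduction

open RAM.NatExpr (iterate)

/-- `1` if the numbers are equal, `0` otherwise, in truncated arithmetic. -/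
def eqNat (a b : ℕ) : ℕ := 1 - ((a - b) + (b - a))

theorem eqNat_eq (a b : ℕ) : eqNat a b = if a = b then 1 else 0 := by
  unfold eqNat
  split_ifs <;> omega

/-- The position of the clause `k` in the encoding of a formula. -/
def clauseStart (inp : List ℕ) (k : ℕ) : ℕ := iterate (fun acc _ => acc + 1 + inp.getD acc 0) 2 k

/-- `0` if the literal with code `c` belongs to the group `g` of variables and is satisfied by the
assignment with number `i` of this group, `1` otherwise. Groups have `r` variables. -/
def literalFails (r g i c : ℕ) : ℕ :=
  1 - eqNat (c / 2 / r) g * eqNat (iterate (fun a _ => a / 2) i (c / 2 % r) % 2) (c % 2)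

/-- `1` if no literal of the clause `k` is satisfied by the assignment `i` of the group `g`. -/
def clauseFails (inp : List ℕ) (r g i k : ℕ) : ℕ :=
  iterate (fun acc t => acc * literalFails r g i (inp.getD (clauseStart inp k + 1 + t) 0)) 1
    (inp.getD (clauseStart inp k) 0)

theorem iterate_mul (f : ℕ → ℕ) (n : ℕ) :
    iterate (fun acc t => acc * f t) 1 n = ∏ t ∈ Finset.range n, f t := by
  induction n with
  | zero => rfl
  | succ n ih => rw [iterate, ih, Finset.prod_range_succ]

theorem iterate_half (i n : ℕ) : iterate (fun a _ => a / 2) i n = i / 2 ^ n := by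
  induction n with
  | zero => simp [iterate]
  | succ n ih => rw [iterate, ih, Nat.div_div_eq_div_mul, pow_succ]

theorem literalFails_le (r g i c : ℕ) : literalFails r g i c ≤ 1 := Nat.sub_le _ _

theorem clauseFails_le (inp : List ℕ) (r g i k : ℕ) : clauseFails inp r g i k ≤ 1 := by
  rw [clauseFails, iterate_mul]
  exact Finset.prod_le_one' fun t _ => literalFails_le _ _ _ _

theorem clauseFails_eq_one_iff (inp : List ℕ) (r g i k : ℕ) : clauseFails inp r g i k = 1 ↔
    ∀ t < inp.getD (clauseStart inp k) 0,
      literalFails r g i (inp.getD (clauseStart inp k + 1 + t) 0) = 1 := by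
  rw [clauseFails, iterate_mul]
  simp [Finset.prod_eq_one_iff]

theorem literalFails_eq_one_iff (r g i v : ℕ) (b : Bool) :
    literalFails r g i (2 * v + b.toNat) = 1 ↔ ¬ (v / r = g ∧ i.testBit (v % r) = b) := by
  have h₁ : (2 * v + b.toNat) / 2 = v := by
    have := b.toNat_le
    omega
  have h₂ : (2 * v + b.toNat) % 2 = b.toNat := by
    have := b.toNat_le
    omega
  rw [literalFails, h₁, h₂, iterate_half, eqNat_eq, eqNat_eq, Nat.testBit_eq_decide_div_mod_eq]
  rcases Nat.mod_two_eq_zero_or_one (i / 2 ^ (v % r)) with h | h <;>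
  cases b <;> by_cases hg : v / r = g <;> simp [h, hg]

def encodeClause {n : ℕ} (c : List (Fin n × Bool)) : List ℕ :=
  c.length :: c.map fun l => 2 * (l.1 : ℕ) + l.2.toNat

theorem encode_eq (φ : CNF) :
    φ.encode = [φ.numVars, φ.clauses.length] ++ φ.clauses.flatMap encodeClause := rfl

theorem encode_split (φ : CNF) (k : ℕ) (hk : k < φ.clauses.length) :
    ∃ rest, φ.encode = ([φ.numVars, φ.clauses.length] ++
      (φ.clauses.take k).flatMap encodeClause) ++ (encodeClause φ.clauses[k] ++ rest) := by
  refine ⟨(φ.clauses.drop (k + 1)).flatMap encodeClause, ?_⟩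
  rw [encode_eq, List.append_assoc, ← List.flatMap_cons, ← List.flatMap_append,
    List.cons_getElem_drop_succ, List.take_append_drop]

theorem clauseStart_encode (φ : CNF) (k : ℕ) (hk : k ≤ φ.clauses.length) :
    clauseStart φ.encode k = ([φ.numVars, φ.clauses.length] ++
      (φ.clauses.take k).flatMap encodeClause).length := by
  induction k with
  | zero => rfl
  | succ k ih =>
    have ih := ih (by omega)
    obtain ⟨rest, hrest⟩ := encode_split φ k hk
    rw [clauseStart] at ih ⊢
    rw [iterate, ih, List.take_add_one, List.getElem?_eq_getElem hk]
    have hget : φ.encode.getD ([φ.numVars, φ.clauses.length] ++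
        (φ.clauses.take k).flatMap encodeClause).length 0 = φ.clauses[k].length := by
      conv_lhs => rw [hrest]
      simp [encodeClause]
    rw [hget]
    simp only [Option.toList_some, List.flatMap_append, List.flatMap_singleton, List.length_append,
      encodeClause, List.length_cons, List.length_map]
    omega

theorem getD_clauseStart (φ : CNF) (k : ℕ) (hk : k < φ.clauses.length) :
    φ.encode.getD (clauseStart φ.encode k) 0 = φ.clauses[k].length := by
  obtain ⟨rest, hrest⟩ := encode_split φ k hk
  rw [clauseStart_encode φ k hk.le]
  conv_lhs => rw [hrest]
  simp [encodeClause]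

theorem getD_clauseStart_add (φ : CNF) (k : ℕ) (hk : k < φ.clauses.length) (t : ℕ)
    (ht : t < φ.clauses[k].length) :
    φ.encode.getD (clauseStart φ.encode k + 1 + t) 0 =
      2 * (φ.clauses[k][t].1 : ℕ) + φ.clauses[k][t].2.toNat := by
  obtain ⟨rest, hrest⟩ := encode_split φ k hk
  rw [clauseStart_encode φ k hk.le]
  conv_lhs => rw [hrest]
  rw [List.getD_eq_getElem?_getD, add_assoc, List.getElem?_append_right (by omega),
    Nat.add_sub_cancel_left, add_comm 1 t, encodeClause, List.cons_append,
    List.getElem?_cons_succ, List.getElem?_append_left (by simpa using ht)]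
  simp [ht]

theorem clauseFails_encode_iff (φ : CNF) (r g i k : ℕ) (hk : k < φ.clauses.length) :
    clauseFails φ.encode r g i k = 1 ↔
      ∀ l ∈ φ.clauses[k], ¬ ((l.1 : ℕ) / r = g ∧ i.testBit (l.1 % r) = l.2) := by
  rw [clauseFails_eq_one_iff, getD_clauseStart φ k hk, List.forall_mem_iff_getElem]
  refine forall₂_congr fun t ht => ?_
  rw [getD_clauseStart_add φ k hk t ht, literalFails_eq_one_iff]

/-- The number of variables in a group. -/
def groupSize (n : ℕ) : ℕ := n / 3 + 1

/-- A clause is violated exactly when it fails in all three groups, because each literal belongs to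
one of them. -/
theorem satisfiable_iff (φ : CNF) :
    φ.Satisfiable ↔ ∃ a < 2 ^ groupSize φ.numVars, ∃ b < 2 ^ groupSize φ.numVars,
      ∃ c < 2 ^ groupSize φ.numVars, ∀ k < φ.clauses.length,
        ¬ (clauseFails φ.encode (groupSize φ.numVars) 0 a k = 1 ∧
          clauseFails φ.encode (groupSize φ.numVars) 1 b k = 1 ∧
          clauseFails φ.encode (groupSize φ.numVars) 2 c k = 1) := by
  set r := groupSize φ.numVars with hr
  have hr0 : 0 < r := Nat.succ_pos _
  -- The added 1 in `groupSize` makes three groups large enough for all variables.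
  have hgroup : ∀ v : Fin φ.numVars, (v : ℕ) / r = 0 ∨ (v : ℕ) / r = 1 ∨ (v : ℕ) / r = 2 := by
    intro v
    have h₁ : (v : ℕ) < r * 3 := by
      have := v.2
      rw [hr, groupSize]
      omega
    have h₂ := Nat.div_lt_of_lt_mul h₁
    revert h₂
    generalize (v : ℕ) / r = x
    omega
  constructor
  · rintro ⟨A, hA⟩
    -- Places beyond the last variable are padded with `false`.
    let f : ℕ → Fin r → Bool := fun g j =>
      if h : g * r + j < φ.numVars then A ⟨g * r + j, h⟩ else false
    have hf : ∀ v : Fin φ.numVars, ∀ g, (v : ℕ) / r = g →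
        (Nat.ofBits (f g)).testBit (v % r) = A v := by
      rintro v g rfl
      have e : (v : ℕ) / r * r + v % r = v := Nat.div_add_mod' _ _
      rw [Nat.testBit_ofBits_lt _ _ (Nat.mod_lt _ hr0)]
      simp only [f]
      rw [dif_pos (by rw [e]; exact v.2)]
      congr 1
      ext
      exact e
    refine ⟨_, Nat.ofBits_lt_two_pow (f 0), _, Nat.ofBits_lt_two_pow (f 1), _,
      Nat.ofBits_lt_two_pow (f 2), fun k hk => ?_⟩
    rw [clauseFails_encode_iff _ _ _ _ _ hk, clauseFails_encode_iff _ _ _ _ _ hk,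
      clauseFails_encode_iff _ _ _ _ _ hk]
    rintro ⟨h0, h1, h2⟩
    obtain ⟨l, hl, hAl⟩ := hA _ (List.getElem_mem hk)
    rcases hgroup l.1 with h | h | h
    · exact h0 l hl ⟨h, (hf _ _ h).trans hAl⟩
    · exact h1 l hl ⟨h, (hf _ _ h).trans hAl⟩
    · exact h2 l hl ⟨h, (hf _ _ h).trans hAl⟩
  · rintro ⟨a, -, b, -, c, -, h⟩
    refine ⟨fun v => (if (v : ℕ) / r = 0 then a else if (v : ℕ) / r = 1 then b else c).testBit
      (v % r), fun cl hcl => ?_⟩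
    obtain ⟨k, hk, rfl⟩ := List.getElem_of_mem hcl
    by_contra! hne
    refine h k hk ⟨?_, ?_, ?_⟩ <;> rw [clauseFails_encode_iff _ _ _ _ _ hk] <;>
    rintro l hl ⟨hg, hb⟩ <;> exact hne l hl (by simp [hg, hb])

end SatReduction


namespace RAM.NatExpr

instance : Add NatExpr := ⟨op .add⟩
instance : Sub NatExpr := ⟨op .sub⟩
instance : Mul NatExpr := ⟨op .mul⟩
instance : Div NatExpr := ⟨op .div⟩
instance : Mod NatExpr := ⟨op .mod⟩
instance (n : ℕ) : OfNat NatExpr n := ⟨const n⟩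

section

variable (a b : NatExpr)

theorem add_eq : a + b = op .add a b := rfl
theorem sub_eq : a - b = op .sub a b := rfl
theorem mul_eq : a * b = op .mul a b := rfl
theorem div_eq : a / b = op .div a b := rfl
theorem mod_eq : a % b = op .mod a b := rfl
theorem zero_eq : (0 : NatExpr) = const 0 := rfl
theorem one_eq : (1 : NatExpr) = const 1 := rfl
theorem two_eq : (2 : NatExpr) = const 2 := rfl
theorem three_eq : (3 : NatExpr) = const 3 := rfl
theorem four_eq : (4 : NatExpr) = const 4 := rfl
theorem five_eq : (5 : NatExpr) = const 5 := rfl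
theorem twenty_eq : (20 : NatExpr) = const 20 := rfl
theorem forty_eq : (40 : NatExpr) = const 40 := rfl

end

end RAM.NatExpr

/-! ### The program for the reduction -/

namespace SatReduction

open RAM RAM.NatExpr TripleMatch

/-- `1` if the values are equal, `0` otherwise. -/
def eqE (a b : NatExpr) : NatExpr := 1 - ((a - b) + (b - a))

/-- In an environment of length `11` that has the size of a group, the group, the assignment and
the clause at the positions `2`, `8`, `9`, `10`: does the clause fail? -/
def clauseFailsE : NatExpr :=
  bind (iter (var 10) 2 (var 12 + 1 + read (var 12)))
    (iter (read (var 11)) 1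
      (bind (read (var 11 + 1 + var 14))
        (bind (iter (var 15 / 2 % var 2) (var 9) (var 17 / 2))
          (var 13 * (1 - eqE (var 15 / 2 / var 2) (var 8) * eqE (var 16 % 2) (var 15 % 2))))))

/-- Definitional, since the arithmetic functions were written with the same `iterate` and truncated
operations. -/
theorem eval_clauseFailsE (inp : List ℕ) (n m r N D Q x y g i k : ℕ) :
    clauseFailsE.eval inp [n, m, r, N, D, Q, x, y, g, i, k] = clauseFails inp r g i k := rfl

/-- The distance from the end, for the position `c` in the half `s` of a string with halves of
length `X`. -/
def foldE (X s c : NatExpr) : NatExpr := (1 - s) * c + s * (2 * X - 1 - c)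

/-- The cell of the text at the position `7` of the environment, after the half `8`. -/
def textCellE : NatExpr := foldE (var 5) (var 8) (var 7 / 20)

/-- A letter of the text, whose position is at the position `7` of the environment. -/
def textLetterE : NatExpr :=
  bind (1 - (var 5 - var 7 / 20)) <|
  bind (textCellE / (var 1 + 1) - (var 3 - 1)) <|
  -- The double subtraction is a minimum with `m` that leaves the value unchanged. It keeps the cost
  -- estimate small: the bound for a remainder is that of its dividend, here a cell number, whereas
  -- the clause index should be bounded by `m`.
  bind (var 1 - (var 1 - (textCellE % (var 1 + 1) - 1))) <|
  bind clauseFailsE <|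
  -- The stage is the number of the thresholds `N - 1` and `2 * N - 1` that the block has reached.
  bind ((1 - (var 3 - 1 - textCellE / (var 1 + 1))) +
    (1 - (2 * var 3 - 1 - textCellE / (var 1 + 1)))) <|
  bind (1 - (1 - textCellE % (var 1 + 1))) <|
  bind (eqE (var 12) 1 * var 13 * var 11) <|
  eqE (var 7 % 20) (4 * var 12 + ((1 - var 8) * var 14 + var 8 * (1 - var 14))) *
    (1 + 2 * var 8 + var 13)

theorem side_eq (X c : ℕ) : side X c = 1 - (X - c) := by
  unfold side
  split_ifs <;> omega

theorem fold_eq (X c : ℕ) :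
    fold X c = (1 - (1 - (X - c))) * c + (1 - (X - c)) * (2 * X - 1 - c) := by
  unfold fold
  split_ifs with h
  · simp [show 1 - (X - c) = 0 by omega]
  · simp [show 1 - (X - c) = 1 by omega]

theorem stage_eq (N b : ℕ) (hN : 1 ≤ N) :
    stage N b = (1 - (N - 1 - b)) + (1 - (2 * N - 1 - b)) := by
  unfold stage
  split_ifs <;> omega

theorem eval_textCellE (inp ρ : List ℕ) (n m r N D Q x p s : ℕ) :
    textCellE.eval inp (n :: m :: r :: N :: D :: Q :: x :: p :: s :: ρ) =
      (1 - s) * (p / 20) + s * (2 * Q - 1 - p / 20) := rfl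

theorem eval_textLetterE (inp : List ℕ) (n m r N x p : ℕ) (hN : 1 ≤ N) :
    textLetterE.eval inp [n, m, r, N, patHalf N m, textHalf N m, x, p] =
      textLetter N m (clauseFails inp r) p := by
  obtain ⟨D, hD⟩ : ∃ D, D = patHalf N m := ⟨_, rfl⟩
  obtain ⟨Q, hQ⟩ : ∃ Q, Q = textHalf N m := ⟨_, rfl⟩
  obtain ⟨s, hs⟩ : ∃ s, s = side Q (p / 20) := ⟨_, rfl⟩
  obtain ⟨q, hq⟩ : ∃ q, q = fold Q (p / 20) := ⟨_, rfl⟩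
  obtain ⟨b, hb⟩ : ∃ b, b = bit N m (clauseFails inp r) s q := ⟨_, rfl⟩
  have hcell : ∀ ρ, textCellE.eval inp (n :: m :: r :: N :: D :: Q :: x :: p :: s :: ρ) = q := by
    intro ρ
    rw [eval_textCellE, hq, fold_eq, hs, side_eq]
  have hs' : (1 - (var 5 - var 7 / 20) : NatExpr).eval inp [n, m, r, N, D, Q, x, p] = s := by
    rw [hs, side_eq]
    rfl
  obtain ⟨z, hz⟩ : ∃ z, z = if q % (m + 1) = 0 then 0 else 1 := ⟨_, rfl⟩
  have hz' : 1 - (1 - q % (m + 1)) = z := by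
    rw [hz]
    split_ifs <;> omega
  have hb' : eqNat (stage N (q / (m + 1))) 1 * z *
      clauseFails inp r s (q / (m + 1) - (N - 1)) (q % (m + 1) - 1) = b := by
    rw [eqNat_eq, hz, hb]
    unfold bit
    by_cases h₁ : stage N (q / (m + 1)) = 1 <;> by_cases h₂ : q % (m + 1) = 0 <;> simp [h₁, h₂]
  have hs01 : s = 0 ∨ s = 1 := by
    rw [hs, side]
    split_ifs <;> simp
  have ho : 4 * stage N (q / (m + 1)) + ((1 - s) * b + s * (1 - b)) =
      offset N m (clauseFails inp r) s q := by
    rw [hb]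
    rcases hs01 with h | h <;> simp [h, offset]
  rw [← hD, ← hQ, textLetterE, eval, hs']
  have hmin : m - (m - (q % (m + 1) - 1)) = q % (m + 1) - 1 := by
    have : q % (m + 1) < m + 1 := Nat.mod_lt q (Nat.succ_pos m)
    omega
  simp only [add_eq, sub_eq, mul_eq, div_eq, mod_eq, one_eq, two_eq, four_eq, twenty_eq, hcell,
    List.cons_append, List.nil_append, eval_clauseFailsE, eqE, eval, Op.apply, List.getD_cons_succ,
    List.getD_cons_zero, hmin]
  rw [← stage_eq N _ hN, hz']
  have heq : ∀ a b : ℕ, 1 - ((a - b) + (b - a)) = eqNat a b := fun _ _ => rfl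
  simp only [heq]
  rw [hb', ho, eqNat_eq]
  simp only [textLetter, ← hQ, ← hs, ← hq, symbol, ← hz]
  split_ifs <;> simp

/-- A letter of the pattern, whose position is at the position `7` of the environment. -/
def patLetterE : NatExpr :=
  bind (1 - (var 4 - var 7)) <|
    1 + 2 * var 8 + (1 - (1 - foldE (var 4) (var 8) (var 7) % (var 1 + 1)))

theorem eval_patLetterE (inp : List ℕ) (n m r N x Q i : ℕ) :
    patLetterE.eval inp [n, m, r, N, patHalf N m, Q, x, i] = patLetter N m i := by
  simp only [patLetterE, foldE, add_eq, sub_eq, mul_eq, mod_eq, one_eq, two_eq,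
    List.cons_append, List.nil_append, eval, Op.apply, List.getD_cons_succ, List.getD_cons_zero]
  rw [← fold_eq, ← side_eq, patLetter, symbol]
  congr 1
  split_ifs <;> omega

/-- The kind of the constraint between the position of the pattern that is at the position `7` of
the environment, and its mirror image. -/
def pairKindE : NatExpr :=
  -- The first value is the number of the third group, the second one its assignment.
  bind 2 <| bind (var 7 / (var 1 + 1)) <| bind (var 1 - (var 1 - (var 7 % (var 1 + 1) - 1))) <|
  bind clauseFailsE <|
    2 + (1 - (1 - var 7 % (var 1 + 1))) * var 11

theorem eval_pairKindE (inp : List ℕ) (n m r N x D Q i : ℕ) :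
    pairKindE.eval inp [n, m, r, N, D, Q, x, i] = pairKind m (clauseFails inp r) i := by
  have hmin : m - (m - (i % (m + 1) - 1)) = i % (m + 1) - 1 := by
    have : i % (m + 1) < m + 1 := Nat.mod_lt i (Nat.succ_pos m)
    omega
  simp only [pairKindE, add_eq, sub_eq, mul_eq, div_eq, mod_eq, one_eq, two_eq,
    List.cons_append, List.nil_append, eval_clauseFailsE, eval, Op.apply, List.getD_cons_succ,
    List.getD_cons_zero, hmin]
  rw [pairKind]
  congr 1
  split_ifs with h
  · simp [h]
  · simp [show 1 - (1 - i % (m + 1)) = 1 by omega]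

/-- Writes the encoding of the constraint language whose kind is at the position `8` of the
environment. -/
noncomputable def emitKind (𝓛 : ConstraintKind) : Gen :=
  -- A loop with 0 or 1 rounds acts as a conditional.
  .seq (.loop (eqE (var 8) 0) (.emitList (𝓛.encode (rep 𝓛 0)))) <|
  .seq (.loop (eqE (var 8) 1) (.emitList (𝓛.encode (rep 𝓛 1)))) <|
  .seq (.loop (eqE (var 8) 2) (.emitList (𝓛.encode (rep 𝓛 2)))) <|
  .seq (.loop (eqE (var 8) 3) (.emitList (𝓛.encode (rep 𝓛 3)))) <|
  .loop (eqE (var 8) 4) (.emitList (𝓛.encode (rep 𝓛 4)))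

theorem out_emitKind (𝓛 : ConstraintKind) (inp : List ℕ) (n m r N D Q x i τ : ℕ) (hτ : τ ≤ 4) :
    (emitKind 𝓛).out inp [n, m, r, N, D, Q, x, i, τ] = 𝓛.encode (rep 𝓛 τ) := by
  have e : ∀ t : ℕ, (Gen.loop (eqE (var 8) (const t)) (.emitList (𝓛.encode (rep 𝓛 t)))).out inp
      [n, m, r, N, D, Q, x, i, τ] = if τ = t then 𝓛.encode (rep 𝓛 t) else [] := by
    intro t
    have h : (eqE (var 8) (const t)).eval inp [n, m, r, N, D, Q, x, i, τ] = eqNat τ t := rfl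
    rw [Gen.out, h, eqNat_eq]
    simp only [Gen.out_emitList]
    split_ifs <;> simp
  have e' : (emitKind 𝓛).out inp [n, m, r, N, D, Q, x, i, τ] =
      (if τ = 0 then 𝓛.encode (rep 𝓛 0) else []) ++ ((if τ = 1 then 𝓛.encode (rep 𝓛 1) else []) ++
      ((if τ = 2 then 𝓛.encode (rep 𝓛 2) else []) ++ ((if τ = 3 then 𝓛.encode (rep 𝓛 3) else []) ++
      (if τ = 4 then 𝓛.encode (rep 𝓛 4) else [])))) := by
    rw [← e, ← e, ← e, ← e, ← e]
    rfl
  rw [e']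
  interval_cases τ <;> simp

/-- Writes one constraint, with the given positions and kind. -/
noncomputable def emitConstraint (𝓛 : ConstraintKind) (l r τ : NatExpr) : Gen :=
  .seq (.emit l) (.seq (.emit r) (.bind τ (emitKind 𝓛)))

/-- Writes the instance of the matching problem, in an environment with the numbers of variables and
clauses, the size of a group, the number of its assignments, and the numbers of cells in one half
of the pattern and of the text. -/
noncomputable def emitInstance (𝓛 : ConstraintKind) : Gen :=
  .seq (.emit 5) <|
  .seq (.emit (40 * var 5)) <|
  .seq (.loop (40 * var 5) (.emit textLetterE)) <|
  .seq (.emit (2 * var 4)) <|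
  .seq (.loop (2 * var 4) (.emit patLetterE)) <|
  .seq (.emit (var 4 + 2 * (var 4 - 1))) <|
  .seq (.loop (var 4) (emitConstraint 𝓛 (var 7) (2 * var 4 - 1 - var 7) pairKindE)) <|
  .seq (.loop (var 4 - 1) (emitConstraint 𝓛 (var 7) (var 7 + 1)
    (eqE (var 7 % (var 1 + 1)) (var 1)))) <|
  .loop (var 4 - 1) (emitConstraint 𝓛 (2 * var 4 - 2 - var 7) (2 * var 4 - 1 - var 7)
    (4 * eqE (var 7 % (var 1 + 1)) (var 1)))

/-- Computes the number of assignments of a group. -/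
def powE : NatExpr := iter (var 2) 1 (var 4 * 2)

/-- Computes the instance of the matching problem for a formula. -/
noncomputable def program (𝓛 : ConstraintKind) : Gen :=
  .bind (read 0) <|
  .bind (read 1) <|
  .bind (var 0 / 3 + 1) <|
  .bind powE <|
  .bind (var 3 * (var 1 + 1)) <|
  .bind ((3 * var 3 - 2) * (var 1 + 1)) <|
  emitInstance 𝓛

/-! ### Correctness of the generated list -/

theorem encode_inst (𝓛 : ConstraintKind) (N m : ℕ) (F : ℕ → ℕ → ℕ → ℕ) (hN : 2 ≤ N) :
    (inst 𝓛 N m F hN).encode = [5, 40 * textHalf N m] ++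
      (List.range (40 * textHalf N m)).map (textLetter N m F) ++ [2 * patHalf N m] ++
      (List.range (2 * patHalf N m)).map (patLetter N m) ++
      [patHalf N m + 2 * (patHalf N m - 1)] ++
      (data N m F).flatMap fun d => d.1 :: d.2.1 :: 𝓛.encode (rep 𝓛 d.2.2) := by
  have h₁ : (text N m F).map Fin.val =
      (List.range (40 * textHalf N m)).map (textLetter N m F) := by
    rw [text, List.map_map]
    refine List.map_congr_left fun p _ => ?_
    exact Nat.mod_eq_of_lt (textLetter_lt _)
  have h₂ : (pattern N m).map Fin.val =
      (List.range (2 * patHalf N m)).map (patLetter N m) := by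
    rw [pattern, List.map_map]
    refine List.map_congr_left fun p _ => ?_
    exact Nat.mod_eq_of_lt (patLetter_lt _)
  have h₃ : (constraints N m F 𝓛).flatMap GapConstraint.encode =
      (data N m F).flatMap fun d => d.1 :: d.2.1 :: 𝓛.encode (rep 𝓛 d.2.2) := by
    rw [List.flatMap_def, List.flatMap_def, constraints, List.map_pmap]
    simp only [GapConstraint.encode, constraint]
    rw [List.pmap_eq_map]
    rfl
  -- In `MatchInstance.encode` the coercion is elaborated on the whole list, through the list monad.
  have hval : ∀ l : List (Fin 5),
      List.map (fun x => x) (do let a ← l; pure (a : ℕ)) = l.map Fin.val := by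
    intro l
    simp [← List.map_eq_flatMap]
  change [5, (text N m F).length] ++ List.map (fun x => x) (do let a ← text N m F; pure (a : ℕ)) ++
    [(pattern N m).length] ++ List.map (fun x => x) (do let a ← pattern N m; pure (a : ℕ)) ++
    [(constraints N m F 𝓛).length] ++ (constraints N m F 𝓛).flatMap GapConstraint.encode = _
  rw [hval, hval, length_constraints, h₁, h₂, h₃, length_text, length_pattern]

theorem out_emitConstraint (𝓛 : ConstraintKind) (inp : List ℕ) (n m r N D Q x i : ℕ)
    (a b t : NatExpr) (ht : t.eval inp [n, m, r, N, D, Q, x, i] ≤ 4) :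
    (emitConstraint 𝓛 a b t).out inp [n, m, r, N, D, Q, x, i] =
      a.eval inp [n, m, r, N, D, Q, x, i] :: b.eval inp [n, m, r, N, D, Q, x, i] ::
        𝓛.encode (rep 𝓛 (t.eval inp [n, m, r, N, D, Q, x, i])) := by
  rw [← out_emitKind 𝓛 inp n m r N D Q x i _ ht]
  rfl

theorem iterate_double (n : ℕ) : iterate (fun a _ => a * 2) 1 n = 2 ^ n := by
  induction n with
  | zero => rfl
  | succ n ih => rw [iterate, ih, pow_succ]

theorem two_le_two_pow_groupSize (n : ℕ) : 2 ≤ 2 ^ groupSize n := by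
  rw [groupSize, pow_succ]
  have := Nat.one_le_two_pow (n := n / 3)
  omega

theorem out_program (𝓛 : ConstraintKind) (φ : CNF) :
    (program 𝓛).out φ.encode [] = (inst 𝓛 (2 ^ groupSize φ.numVars) φ.clauses.length
      (clauseFails φ.encode (groupSize φ.numVars)) (two_le_two_pow_groupSize _)).encode := by
  rw [encode_inst]
  have hN := two_le_two_pow_groupSize φ.numVars
  obtain ⟨n, hn⟩ : ∃ n, n = φ.numVars := ⟨_, rfl⟩
  obtain ⟨m, hm⟩ : ∃ m, m = φ.clauses.length := ⟨_, rfl⟩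
  obtain ⟨r, hr⟩ : ∃ r, r = groupSize φ.numVars := ⟨_, rfl⟩
  obtain ⟨N, hN'⟩ : ∃ N, N = 2 ^ groupSize φ.numVars := ⟨_, rfl⟩
  have e : (program 𝓛).out φ.encode [] =
      (let ρ := [n, m, r, N, patHalf N m, textHalf N m]
      [5, 40 * textHalf N m] ++
      (List.range (40 * textHalf N m)).flatMap (fun p =>
        [textLetterE.eval φ.encode (ρ ++ [40 * textHalf N m, p])]) ++ [2 * patHalf N m] ++
      (List.range (2 * patHalf N m)).flatMap (fun i =>
        [patLetterE.eval φ.encode (ρ ++ [2 * patHalf N m, i])]) ++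
      [patHalf N m + 2 * (patHalf N m - 1)] ++
      ((List.range (patHalf N m)).flatMap (fun i =>
        (emitConstraint 𝓛 (var 7) (2 * var 4 - 1 - var 7) pairKindE).out φ.encode
          (ρ ++ [patHalf N m, i])) ++
      (List.range (patHalf N m - 1)).flatMap (fun i =>
        (emitConstraint 𝓛 (var 7) (var 7 + 1) (eqE (var 7 % (var 1 + 1)) (var 1))).out φ.encode
          (ρ ++ [patHalf N m - 1, i])) ++
      (List.range (patHalf N m - 1)).flatMap (fun i =>
        (emitConstraint 𝓛 (2 * var 4 - 2 - var 7) (2 * var 4 - 1 - var 7)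
          (4 * eqE (var 7 % (var 1 + 1)) (var 1))).out φ.encode (ρ ++ [patHalf N m - 1, i])))) := by
    -- With the power written as the iteration of `powE`, both sides unfold to the same list.
    rw [hn, hm, hr, hN', ← iterate_double]
    simp only [List.append_assoc]
    rfl
  rw [e]
  rw [← hN', ← hr, ← hm, data, List.flatMap_append, List.flatMap_append, List.flatMap_map,
    List.flatMap_map, List.flatMap_map]
  rw [← hN'] at hN
  simp only [List.cons_append, List.nil_append]
  have c₁ : ∀ i, (emitConstraint 𝓛 (var 7) (2 * var 4 - 1 - var 7) pairKindE).out φ.encode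
      [n, m, r, N, patHalf N m, textHalf N m, patHalf N m, i] =
      i :: (2 * patHalf N m - 1 - i) ::
        𝓛.encode (rep 𝓛 (pairKind m (clauseFails φ.encode r) i)) := by
    intro i
    rw [out_emitConstraint, eval_pairKindE]
    · rfl
    · rw [eval_pairKindE, pairKind]
      have := clauseFails_le φ.encode r 2 (i / (m + 1)) (i % (m + 1) - 1)
      split_ifs <;> omega
  have hborder : ∀ i y, (eqE (var 7 % (var 1 + 1)) (var 1)).eval φ.encode
      [n, m, r, N, patHalf N m, textHalf N m, y, i] = eqNat (i % (m + 1)) m := fun _ _ => rfl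
  have c₂ : ∀ i, (emitConstraint 𝓛 (var 7) (var 7 + 1)
      (eqE (var 7 % (var 1 + 1)) (var 1))).out φ.encode
      [n, m, r, N, patHalf N m, textHalf N m, patHalf N m - 1, i] =
      i :: (i + 1) :: 𝓛.encode (rep 𝓛 (leftKind m i)) := by
    intro i
    rw [out_emitConstraint, hborder, eqNat_eq]
    · rfl
    · rw [hborder, eqNat_eq]
      split_ifs <;> omega
  have hborder' : ∀ i y, (4 * eqE (var 7 % (var 1 + 1)) (var 1)).eval φ.encode
      [n, m, r, N, patHalf N m, textHalf N m, y, i] = rightKind m i := by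
    intro i y
    have : (4 * eqE (var 7 % (var 1 + 1)) (var 1)).eval φ.encode
      [n, m, r, N, patHalf N m, textHalf N m, y, i] = 4 * eqNat (i % (m + 1)) m := rfl
    rw [this, eqNat_eq, rightKind]
    split_ifs <;> rfl
  have c₃ : ∀ i, (emitConstraint 𝓛 (2 * var 4 - 2 - var 7) (2 * var 4 - 1 - var 7)
      (4 * eqE (var 7 % (var 1 + 1)) (var 1))).out φ.encode
      [n, m, r, N, patHalf N m, textHalf N m, patHalf N m - 1, i] =
      (2 * patHalf N m - 2 - i) :: (2 * patHalf N m - 1 - i) ::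
        𝓛.encode (rep 𝓛 (rightKind m i)) := by
    intro i
    rw [out_emitConstraint, hborder']
    · rfl
    · rw [hborder', rightKind]
      split_ifs <;> omega
  simp only [eval_textLetterE _ _ _ _ _ _ _ (show 1 ≤ N by omega), eval_patLetterE, c₁, c₂, c₃,
    ← List.map_eq_flatMap]

end SatReduction


/-! ### Cost of computing the instance -/

namespace SatReduction

open RAM RAM.NatExpr TripleMatch

theorem iterate_eq_of_step {f : ℕ → ℕ → ℕ} (v : ℕ → ℕ) (z n : ℕ) (hz : z = v 0)
    (h : ∀ i, f (v i) i = v (i + 1)) : iterate f z n = v n := by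
  induction n with
  | zero => exact hz
  | succ n ih => rw [iterate, ih, h]

theorem iterate_max_add (z c n : ℕ) :
    iterate (fun a _ => max a (a + 1 + c)) z n = z + n * (1 + c) :=
  iterate_eq_of_step (fun i => z + i * (1 + c)) z n (by simp) fun i => by
    rw [max_eq_right (by omega)]; ring

theorem iterate_max_self (z n : ℕ) : iterate (fun a _ => max a a) z n = z :=
  iterate_eq_of_step (fun _ => z) z n rfl fun _ => max_self z

/-- Each factor is of the form `1 - _`, so the estimated product does not grow with the rounds. -/
theorem bound_clauseFailsE (B n m r N D Q x y g i k : ℕ) :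
    clauseFailsE.bound B [n, m, r, N, D, Q, x, y, g, i, k] = 1 := by
  simp only [clauseFailsE, add_eq, sub_eq, mul_eq, div_eq, mod_eq, one_eq, two_eq,
    List.cons_append, List.nil_append, eqE, bound, List.getD_cons_succ, List.getD_cons_zero, mul_one,
    iterate_max_self]

theorem costBound_clauseFailsE (B n m r N D Q x y g i k : ℕ) :
    clauseFailsE.costBound B [n, m, r, N, D, Q, x, y, g, i, k] =
      17 + k * 19 + k * B * 3 + k * B ^ 2 * 2 + k ^ 2 * 2 + k ^ 2 * B * 2 + B * 89 + B * g +
        B * i + B ^ 2 * 14 := by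
  simp only [clauseFailsE, add_eq, sub_eq, mul_eq, div_eq, mod_eq, one_eq, two_eq,
    List.cons_append, List.nil_append, eqE, bound, costBound, Op.charge, List.getD_cons_succ,
    List.getD_cons_zero, mul_one, iterate_max_self, iterate_max_add]
  ring

/-- The numbers `n`, `m`, `r` are bounded by `B`, the exponentially large ones by multiples of `Q`.
What matters is that the cost is linear in `Q`. -/
theorem costBound_textLetterE (B Q : ℕ) :
    textLetterE.costBound B [B, B, B, Q, Q, Q, 40 * Q, 40 * Q] =
      631 + Q * 472 + Q * B * 42 + B * 114 + B ^ 2 * 19 + B ^ 3 * 4 := by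
  simp only [textLetterE, textCellE, foldE, add_eq, sub_eq, mul_eq, div_eq, mod_eq, one_eq, two_eq,
    four_eq, twenty_eq, List.cons_append, List.nil_append, eqE, bound, costBound, Op.charge,
    List.getD_cons_succ, List.getD_cons_zero, bound_clauseFailsE, costBound_clauseFailsE]
  ring

theorem costBound_patLetterE (B Q : ℕ) :
    patLetterE.costBound B [B, B, B, Q, Q, Q, 2 * Q, 2 * Q] = 56 + Q * 10 + B := by
  simp only [patLetterE, foldE, add_eq, sub_eq, mul_eq, mod_eq, one_eq, two_eq, List.cons_append,
    List.nil_append, bound, costBound, Op.charge, List.getD_cons_succ, List.getD_cons_zero]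
  ring

theorem costBound_pairKindE (B Q : ℕ) :
    pairKindE.costBound B [B, B, B, Q, Q, Q, Q, Q] =
      68 + B * 113 + B * Q + B ^ 2 * 19 + B ^ 3 * 4 := by
  simp only [pairKindE, add_eq, sub_eq, mul_eq, div_eq, mod_eq, one_eq, two_eq, List.cons_append,
    List.nil_append, bound, costBound, Op.charge, List.getD_cons_succ, List.getD_cons_zero,
    bound_clauseFailsE, costBound_clauseFailsE]
  ring

theorem bound_pairKindE (B Q : ℕ) : pairKindE.bound B [B, B, B, Q, Q, Q, Q, Q] = 3 := by
  simp only [pairKindE, add_eq, sub_eq, mul_eq, div_eq, mod_eq, one_eq, two_eq, List.cons_append,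
    List.nil_append, bound, List.getD_cons_succ, List.getD_cons_zero, bound_clauseFailsE]

theorem exists_costBound_emitKind (𝓛 : ConstraintKind) :
    ∃ K : ℕ, ∀ B n m r N D Q x i t : ℕ,
      (emitKind 𝓛).costBound B [n, m, r, N, D, Q, x, i, t] = K + t * 5 := by
  refine ⟨120 + Gen.costBound 0 (Gen.emitList (𝓛.encode (rep 𝓛 0))) [] +
    Gen.costBound 0 (Gen.emitList (𝓛.encode (rep 𝓛 1))) [] +
    Gen.costBound 0 (Gen.emitList (𝓛.encode (rep 𝓛 2))) [] +
    Gen.costBound 0 (Gen.emitList (𝓛.encode (rep 𝓛 3))) [] +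
    Gen.costBound 0 (Gen.emitList (𝓛.encode (rep 𝓛 4))) [], fun B n m r N D Q x i t => ?_⟩
  simp only [emitKind, Gen.costBound, Gen.costBound_emitList B, add_eq, sub_eq, zero_eq, one_eq,
    two_eq, three_eq, four_eq, List.cons_append, List.nil_append, eqE, bound, costBound, Op.charge,
    List.getD_cons_succ, List.getD_cons_zero]
  ring

/-- There are `O(Q)` letters and constraints, each of a cost linear in `Q` because values are
charged. -/
theorem exists_costBound_emitInstance (𝓛 : ConstraintKind) :
    ∃ K : ℕ, ∀ B Q : ℕ, 1 ≤ B → 1 ≤ Q →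
      (emitInstance 𝓛).costBound B [B, B, B, Q, Q, Q] ≤ K * (B ^ 3 * Q ^ 2) := by
  obtain ⟨K, hK⟩ := exists_costBound_emitKind 𝓛
  refine ⟨52372 + 3 * K, fun B Q hB hQ => ?_⟩
  simp only [emitInstance, emitConstraint, Gen.costBound, add_eq, sub_eq, mul_eq, mod_eq, one_eq,
    two_eq, four_eq, five_eq, forty_eq, List.cons_append, List.nil_append, eqE, bound, costBound,
    Op.charge, List.getD_cons_succ, List.getD_cons_zero, costBound_textLetterE,
    costBound_patLetterE, costBound_pairKindE, bound_pairKindE, hK]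
  -- Every monomial of the explicit polynomial is absorbed by the leading one.
  have hmon : ∀ b ≤ 3, ∀ q ≤ 2, B ^ b * Q ^ q ≤ B ^ 3 * Q ^ 2 := fun b hb q hq =>
    Nat.mul_le_mul (Nat.pow_le_pow_right hB hb) (Nat.pow_le_pow_right hQ hq)
  have h₁ := hmon 0 (by omega) 0 (by omega)
  have h₂ := hmon 0 (by omega) 1 (by omega)
  have h₃ := hmon 1 (by omega) 1 (by omega)
  have h₄ := hmon 2 (by omega) 1 (by omega)
  have h₅ := hmon 3 (by omega) 1 (by omega)
  have h₆ := hmon 0 (by omega) 2 (by omega)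
  have h₇ := hmon 1 (by omega) 2 (by omega)
  have h₈ := Nat.mul_le_mul_left K h₂
  simp only [pow_zero, pow_one, one_mul, mul_one] at h₁ h₂ h₃ h₄ h₅ h₆ h₇ h₈
  linarith

theorem cost_powE_le (inp : List ℕ) (n m r : ℕ) :
    powE.cost inp [n, m, r] ≤ 7 + r * 11 + r * 2 ^ r * 2 := by
  obtain ⟨B, hB⟩ : ∃ B, ∀ x ∈ inp, x ≤ B := ⟨inp.sum, fun x hx => List.le_sum_of_mem hx⟩
  refine (powE.cost_le_costBound hB (β := [n, m, r]) ⟨rfl, fun _ => le_rfl⟩).trans ?_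
  have h : ∀ k, iterate (fun a _ => max a (a * 2)) 1 k = 2 ^ k := fun k =>
    iterate_eq_of_step (fun i => 2 ^ i) 1 k (by simp) fun i => by
      rw [max_eq_right (by omega), pow_succ]
  simp only [powE, mul_eq, one_eq, two_eq, List.cons_append, List.nil_append, bound, costBound,
    Op.charge, List.getD_cons_succ, List.getD_cons_zero, h]
  apply le_of_eq
  ring

theorem le_of_mem_encode (φ : CNF) (k : ℕ) (hφ : φ.IsKCNF k) :
    ∀ x ∈ φ.encode, x ≤ 2 * φ.numVars + φ.clauses.length + k + 1 := by
  intro x hx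
  simp only [CNF.encode, List.cons_append, List.nil_append, List.mem_cons, List.mem_flatMap,
    List.mem_map] at hx
  rcases hx with rfl | rfl | ⟨c, hc, rfl | ⟨l, hl, rfl⟩⟩
  · omega
  · omega
  · have := hφ c hc
    omega
  · have h₁ := l.1.2
    have h₂ := l.2.toNat_le
    omega

theorem exists_cost_program_le (𝓛 : ConstraintKind) : ∃ K : ℕ, ∀ (k : ℕ) (φ : CNF), φ.IsKCNF k →
    (program 𝓛).cost φ.encode [] ≤ K * ((2 * φ.numVars + φ.clauses.length + k + 1) ^ 3 *
      textHalf (2 ^ groupSize φ.numVars) φ.clauses.length ^ 2) := by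
  obtain ⟨K, hK⟩ := exists_costBound_emitInstance 𝓛
  refine ⟨K + 100, fun k φ hφ => ?_⟩
  have hB := le_of_mem_encode φ k hφ
  have hN := two_le_two_pow_groupSize φ.numVars
  obtain ⟨n, hn⟩ : ∃ n, n = φ.numVars := ⟨_, rfl⟩
  obtain ⟨m, hm⟩ : ∃ m, m = φ.clauses.length := ⟨_, rfl⟩
  obtain ⟨r, hr⟩ : ∃ r, r = groupSize φ.numVars := ⟨_, rfl⟩
  obtain ⟨N, hN'⟩ : ∃ N, N = 2 ^ groupSize φ.numVars := ⟨_, rfl⟩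
  have e : (program 𝓛).cost φ.encode [] = 2 + (3 + (1 + 4 + 0 + 1 + 2 + (n / 3 + 1) + 1 +
      (powE.cost φ.encode [n, m, r] + (1 + (1 + 2 + (m + 1) + 1) + N * (m + 1) + 1 +
      ((4 + 1 + 3 * N + 1 + 3 + 0 + 1 + (1 + 2 + (m + 1) + 1) + (3 * N - 2) * (m + 1) + 1) +
      (emitInstance 𝓛).cost φ.encode [n, m, r, N, patHalf N m, textHalf N m]))))) := by
    -- The preliminary values are costed exactly; `powE` and the main generator are left to the
    -- estimates above.
    rw [hn, hm, hr, hN', ← iterate_double]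
    rfl
  have hpow := cost_powE_le φ.encode n m r
  rw [← hm, ← hn] at hB
  rw [← hN'] at hN
  rw [← hm, ← hN', ← hn]
  have hr' : r ≤ n + 1 := by
    rw [hr, ← hn, groupSize]
    omega
  obtain ⟨B, hB'⟩ : ∃ B, B = 2 * n + m + k + 1 := ⟨_, rfl⟩
  rw [← hB'] at hB ⊢
  have hNr : N = 2 ^ r := by rw [hN', hr]
  rw [← hNr] at hpow
  have hQ := four_le_textHalf (m := m) hN
  have hDQ := patHalf_le_textHalf (m := m) hN
  have hND : N ≤ patHalf N m := Nat.le_mul_of_pos_right _ (Nat.succ_pos _)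
  have hDe : N * (m + 1) = patHalf N m := rfl
  have hQe : (3 * N - 2) * (m + 1) = textHalf N m := rfl
  rw [hDe, hQe] at e
  obtain ⟨D, hD⟩ : ∃ D, D = patHalf N m := ⟨_, rfl⟩
  obtain ⟨Q, hQ'⟩ : ∃ Q, Q = textHalf N m := ⟨_, rfl⟩
  rw [← hQ'] at hQ
  rw [← hD, ← hQ'] at hDQ e
  rw [← hD] at hND
  rw [← hQ']
  have hbelow : Below [n, m, r, N, D, Q] [B, B, B, Q, Q, Q] :=
    (((((Below.nil.append (v := n) (w := B) (by omega)).append (v := m) (w := B) (by omega)).append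
      (v := r) (w := B) (by omega)).append (v := N) (w := Q) (by omega)).append
      (v := D) (w := Q) (by omega)).append (v := Q) (w := Q) le_rfl
  have hmain := ((emitInstance 𝓛).cost_le_costBound hB hbelow).trans
    (hK B Q (by omega) (by omega))
  have hrN : r * N ≤ B * Q := Nat.mul_le_mul (by omega) (by omega)
  have hBQ : B * Q ≤ B ^ 3 * Q ^ 2 :=
    Nat.mul_le_mul (Nat.le_self_pow (by omega) B) (Nat.le_self_pow (by omega) Q)
  have hB1 : B ≤ B * Q := Nat.le_mul_of_pos_right _ (by omega)
  have hQ1 : Q ≤ B * Q := Nat.le_mul_of_pos_left _ (by omega)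
  have hn3 : n / 3 ≤ n := Nat.div_le_self _ _
  rw [e, add_mul]
  linarith [show 1 ≤ B by omega, show n ≤ B by omega, show m ≤ B by omega, show r ≤ B by omega,
    show N ≤ Q by omega]

/-! ### Time bounds -/

/-- The exponents of the time bound may be negative, so replacing a length by a comparable one costs
a factor with exponent `|g|`. -/
theorem rpow_le_of_mem_Icc {x y c : ℝ} (g : ℝ) (hx : 0 < x) (hxy : x ≤ y) (hc : 1 ≤ c)
    (hy : y ≤ c * x) : y ^ g ≤ c ^ |g| * x ^ g := by
  rcases le_total 0 g with hg | hg
  · rw [abs_of_nonneg hg, ← Real.mul_rpow (by linarith) hx.le]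
    exact Real.rpow_le_rpow (by linarith) hy hg
  · refine (Real.rpow_le_rpow_of_nonpos hx hxy hg).trans ?_
    exact le_mul_of_one_le_left (Real.rpow_nonneg hx.le g) (Real.one_le_rpow hc (abs_nonneg g))

/-- The factor 72 works as `72 * log 2 / 36 > 1`. The exponent `1 / 12` is the room between `2 / 3`
and `3 / 4`. -/
theorem add_one_pow_three_le (n : ℕ) : ((n : ℝ) + 1) ^ 3 ≤ 72 ^ 3 * (2 : ℝ) ^ ((n : ℝ) / 12) := by
  have h : (n : ℝ) + 1 ≤ 72 * (2 : ℝ) ^ ((n : ℝ) / 36) := by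
    have h₁ := Real.add_one_le_exp (Real.log 2 * ((n : ℝ) / 36))
    rw [← Real.rpow_def_of_pos (by norm_num)] at h₁
    have h₂ := Real.log_two_gt_d9
    have h₃ : (0 : ℝ) ≤ n := Nat.cast_nonneg n
    nlinarith
  calc ((n : ℝ) + 1) ^ 3 ≤ (72 * (2 : ℝ) ^ ((n : ℝ) / 36)) ^ 3 := by gcongr
    _ = 72 ^ 3 * (2 : ℝ) ^ ((n : ℝ) / 12) := by
      rw [mul_pow, ← Real.rpow_mul_natCast (by norm_num)]
      congr 2
      push_cast
      ring

theorem two_pow_groupSize_le (n : ℕ) :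
    (2 : ℝ) ^ groupSize n ≤ 2 * (2 : ℝ) ^ ((n : ℝ) / 3) := by
  rw [groupSize, pow_succ, mul_comm, ← Real.rpow_natCast]
  gcongr
  · norm_num
  · exact Nat.cast_div_le

/-- The quadratic factor gives `2 ^ (2 n / 3)`, and the cube of `n + 1` at most another `2 ^ (n /
12)`, up to constants. Three powers of `m + 1` come from the entry bound and two from the text. -/
theorem exists_cost_le_time (𝓛 : ConstraintKind) (k : ℕ) {δ : ℝ} (hδ : 3 / 4 ≤ δ) :
    ∃ K : ℕ, ∀ φ : CNF, φ.IsKCNF k → ((program 𝓛).cost φ.encode [] : ℝ) ≤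
      K * ((2 : ℝ) ^ ((φ.numVars : ℝ) * δ) * ((φ.clauses.length : ℝ) + 1) ^ 5) := by
  obtain ⟨K, hK⟩ := exists_cost_program_le 𝓛
  obtain ⟨K', hK'⟩ := exists_nat_ge ((K : ℝ) * (k + 2) ^ 3 * 36 * 72 ^ 3)
  refine ⟨K', fun φ hφ => ?_⟩
  have h₁ := hK k φ hφ
  obtain ⟨n, hn⟩ : ∃ n, n = φ.numVars := ⟨_, rfl⟩
  obtain ⟨m, hm⟩ : ∃ m, m = φ.clauses.length := ⟨_, rfl⟩
  rw [← hm, ← hn] at h₁ ⊢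
  have hB : 2 * n + m + k + 1 ≤ (k + 2) * ((n + 1) * (m + 1)) := by
    have := Nat.zero_le (k * n * m + 2 * n * m + k * n + k * m + m + 1)
    linarith
  have hQ : textHalf (2 ^ groupSize n) m ≤ 3 * 2 ^ groupSize n * (m + 1) :=
    Nat.mul_le_mul_right _ (Nat.sub_le _ _)
  have h₂ : ((program 𝓛).cost φ.encode [] : ℝ) ≤ K * (((k + 2) * ((n + 1) * (m + 1))) ^ 3 *
      (3 * 2 ^ groupSize n * (m + 1)) ^ 2) := by
    have : (program 𝓛).cost φ.encode [] ≤ K * (((k + 2) * ((n + 1) * (m + 1))) ^ 3 *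
        (3 * 2 ^ groupSize n * (m + 1)) ^ 2) := h₁.trans (by gcongr)
    exact_mod_cast this
  refine h₂.trans ?_
  have h₃ := add_one_pow_three_le n
  have h₄ := two_pow_groupSize_le n
  have h₅ : (2 : ℝ) ^ ((n : ℝ) / 12) * ((2 : ℝ) ^ ((n : ℝ) / 3)) ^ 2 ≤ 2 ^ ((n : ℝ) * δ) := by
    rw [← Real.rpow_mul_natCast (by norm_num), ← Real.rpow_add (by norm_num)]
    refine Real.rpow_le_rpow_of_exponent_le (by norm_num) ?_
    refine le_of_eq_of_le ?_ (mul_le_mul_of_nonneg_left hδ (Nat.cast_nonneg n))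
    push_cast
    ring
  obtain ⟨x, hx⟩ : ∃ x : ℝ, x = 2 ^ ((n : ℝ) / 12) := ⟨_, rfl⟩
  obtain ⟨y, hy⟩ : ∃ y : ℝ, y = 2 ^ ((n : ℝ) / 3) := ⟨_, rfl⟩
  obtain ⟨z, hz⟩ : ∃ z : ℝ, z = 2 ^ ((n : ℝ) * δ) := ⟨_, rfl⟩
  obtain ⟨N, hN⟩ : ∃ N : ℝ, N = 2 ^ groupSize n := ⟨_, rfl⟩
  obtain ⟨c, hc⟩ : ∃ c : ℝ, c = 72 ^ 3 := ⟨_, rfl⟩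
  have hN₀ : 0 ≤ N := hN ▸ by positivity
  have hc₀ : 0 ≤ c := hc ▸ by positivity
  have hx₀ : 0 ≤ x := hx ▸ by positivity
  have hz₀ : 0 ≤ z := hz ▸ by positivity
  rw [← hx, ← hc] at h₃
  rw [← hy, ← hN] at h₄
  rw [← hx, ← hy, ← hz] at h₅
  rw [← hc] at hK'
  rw [← hz, ← hN]
  calc (K : ℝ) * (((k + 2) * ((n + 1) * (m + 1))) ^ 3 * (3 * N * (m + 1)) ^ 2)
      = K * (k + 2) ^ 3 * 9 * (((n : ℝ) + 1) ^ 3 * N ^ 2) * (m + 1) ^ 5 := by ring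
    _ ≤ K * (k + 2) ^ 3 * 9 * ((c * x) * (2 * y) ^ 2) * (m + 1) ^ 5 := by gcongr
    _ = K * (k + 2) ^ 3 * 36 * c * ((x * y ^ 2) * (m + 1) ^ 5) := by ring
    _ ≤ K * (k + 2) ^ 3 * 36 * c * (z * (m + 1) ^ 5) := by gcongr
    _ ≤ K' * (z * (m + 1) ^ 5) := by gcongr

/-- Text length and number of constraints both lie between `D` and `120 * D`, where `D = N * (m +
1)`, so only `D ^ (g + h)` matters. -/
theorem exists_time_le_time (𝓛 : ConstraintKind) (F : CNF → ℕ → ℕ → ℕ → ℕ) {g h δ : ℝ}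
    (hδ₀ : 0 ≤ δ) (hδ₁ : δ ≤ 1) (hgh : g + h ≤ 3 * δ) :
    ∃ K : ℕ, ∀ φ : CNF,
      ((inst 𝓛 (2 ^ groupSize φ.numVars) φ.clauses.length (F φ)
          (two_le_two_pow_groupSize _)).text.length : ℝ) ^ g *
        ((inst 𝓛 (2 ^ groupSize φ.numVars) φ.clauses.length (F φ)
          (two_le_two_pow_groupSize _)).constraints.length : ℝ) ^ h ≤
      K * ((2 : ℝ) ^ ((φ.numVars : ℝ) * δ) * ((φ.clauses.length : ℝ) + 1) ^ 5) := by
  obtain ⟨K, hK⟩ := exists_nat_ge ((120 : ℝ) ^ |g| * 120 ^ |h| * 8)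
  refine ⟨K, fun φ => ?_⟩
  change ((text _ _ _).length : ℝ) ^ g * ((constraints _ _ _ _).length : ℝ) ^ h ≤ _
  rw [length_text, length_constraints]
  have hN := two_le_two_pow_groupSize φ.numVars
  have h₄ := two_pow_groupSize_le φ.numVars
  generalize φ.clauses.length = m
  generalize φ.numVars = n at *
  have hD := two_le_patHalf (m := m) hN
  have hDQ := patHalf_le_textHalf (m := m) hN
  have hQ : textHalf (2 ^ groupSize n) m ≤ 3 * patHalf (2 ^ groupSize n) m := by
    rw [patHalf, ← mul_assoc]
    exact Nat.mul_le_mul_right _ (Nat.sub_le _ _)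
  obtain ⟨D, hD'⟩ : ∃ D, D = patHalf (2 ^ groupSize n) m := ⟨_, rfl⟩
  have hDm : (D : ℝ) = 2 ^ groupSize n * (m + 1) := by
    rw [hD', patHalf]
    push_cast
    rfl
  rw [← hD'] at hD hDQ hQ ⊢
  generalize textHalf (2 ^ groupSize n) m = Q at *
  have hD1 : (1 : ℝ) ≤ D := by exact_mod_cast (show 1 ≤ D by omega)
  have hw : ((40 * Q : ℕ) : ℝ) ^ g ≤ 120 ^ |g| * (D : ℝ) ^ g :=
    rpow_le_of_mem_Icc g (by linarith) (by exact_mod_cast (show D ≤ 40 * Q by omega)) (by norm_num)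
      (by exact_mod_cast (show 40 * Q ≤ 120 * D by omega))
  have hC : ((D + 2 * (D - 1) : ℕ) : ℝ) ^ h ≤ 120 ^ |h| * (D : ℝ) ^ h :=
    rpow_le_of_mem_Icc h (by linarith) (by exact_mod_cast (show D ≤ D + 2 * (D - 1) by omega))
      (by norm_num) (by exact_mod_cast (show D + 2 * (D - 1) ≤ 120 * D by omega))
  have hm1 : (1 : ℝ) ≤ (m : ℝ) + 1 := by
    have : (0 : ℝ) ≤ m := Nat.cast_nonneg m
    linarith
  have hDδ : (D : ℝ) ^ g * (D : ℝ) ^ h ≤ 8 * ((2 : ℝ) ^ ((n : ℝ) * δ) * ((m : ℝ) + 1) ^ 5) :=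
    calc (D : ℝ) ^ g * (D : ℝ) ^ h = (D : ℝ) ^ (g + h) := (Real.rpow_add (by linarith) _ _).symm
      _ ≤ (D : ℝ) ^ (3 * δ) := Real.rpow_le_rpow_of_exponent_le hD1 hgh
      _ = ((2 : ℝ) ^ groupSize n) ^ (3 * δ) * ((m : ℝ) + 1) ^ (3 * δ) := by
        rw [hDm, Real.mul_rpow (by positivity) (by positivity)]
      _ ≤ (2 * (2 : ℝ) ^ ((n : ℝ) / 3)) ^ (3 * δ) * ((m : ℝ) + 1) ^ (5 : ℝ) := by
        gcongr
        linarith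
      _ = (2 : ℝ) ^ (3 * δ) * ((2 : ℝ) ^ ((n : ℝ) * δ) * ((m : ℝ) + 1) ^ 5) := by
        rw [Real.mul_rpow (by norm_num) (by positivity), ← Real.rpow_mul (by norm_num),
          show (n : ℝ) / 3 * (3 * δ) = n * δ by ring, mul_assoc]
        norm_cast
      _ ≤ (2 : ℝ) ^ (3 : ℝ) * ((2 : ℝ) ^ ((n : ℝ) * δ) * ((m : ℝ) + 1) ^ 5) := by
        gcongr
        · norm_num
        · linarith
      _ = _ := by norm_num
  calc ((40 * Q : ℕ) : ℝ) ^ g * ((D + 2 * (D - 1) : ℕ) : ℝ) ^ h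
      ≤ (120 ^ |g| * (D : ℝ) ^ g) * (120 ^ |h| * (D : ℝ) ^ h) := by gcongr
    _ = 120 ^ |g| * 120 ^ |h| * ((D : ℝ) ^ g * (D : ℝ) ^ h) := by ring
    _ ≤ 120 ^ |g| * 120 ^ |h| * (8 * ((2 : ℝ) ^ ((n : ℝ) * δ) * ((m : ℝ) + 1) ^ 5)) := by gcongr
    _ = (120 ^ |g| * 120 ^ |h| * 8) * ((2 : ℝ) ^ ((n : ℝ) * δ) * ((m : ℝ) + 1) ^ 5) := by ring
    _ ≤ _ := by gcongr

theorem not_solvableInTime (hSETH : SETH) (𝓛 : ConstraintKind) {g h : ℝ} (hgh : g + h < 3) :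
    ¬ RAM.SolvableInTime (MatchInstance.encode (𝓛 := 𝓛))
      (fun I => I.NonIntersecting ∧ ∀ C ∈ I.constraints, C.size ≤ 126) (fun I => I.IsMatch)
      (fun I => (I.text.length : ℝ) ^ g * (I.constraints.length : ℝ) ^ h) := by
  intro hsol
  -- The bound `3 / 4` pays for computing the instance, `(g + h) / 3` for solving it.
  obtain ⟨δ, hδ₁, hδ₂, hδ₃⟩ : ∃ δ : ℝ, 3 / 4 ≤ δ ∧ δ < 1 ∧ g + h ≤ 3 * δ :=
    ⟨max (3 / 4) ((g + h) / 3), le_max_left _ _, max_lt (by norm_num) (by linarith), by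
      linarith [le_max_right (3 / 4) ((g + h) / 3)]⟩
  obtain ⟨k, hk⟩ := hSETH (1 - δ) (by linarith)
  obtain ⟨K₁, hK₁⟩ := exists_cost_le_time 𝓛 k hδ₁
  obtain ⟨K₂, hK₂⟩ := exists_time_le_time 𝓛
    (fun φ => clauseFails φ.encode (groupSize φ.numVars)) (by linarith) hδ₂.le hδ₃
  have hone : ∀ φ : CNF,
      1 ≤ (2 : ℝ) ^ ((φ.numVars : ℝ) * δ) * ((φ.clauses.length : ℝ) + 1) ^ 5 := by
    intro φ
    refine one_le_mul_of_one_le_of_one_le ?_ (one_le_pow₀ ?_)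
    · exact Real.one_le_rpow (by norm_num) (by positivity)
    · have : (0 : ℝ) ≤ φ.clauses.length := Nat.cast_nonneg _
      linarith
  refine hk 5 ?_
  simp only [sub_sub_cancel]
  refine hsol.of_reduction (program 𝓛) (fun φ => inst 𝓛 (2 ^ groupSize φ.numVars) φ.clauses.length
    (clauseFails φ.encode (groupSize φ.numVars)) (two_le_two_pow_groupSize _)) (K₁ + K₂)
    (fun φ _ => hone φ) (fun φ _ => ⟨inst_nonIntersecting 𝓛 _, inst_size_le 𝓛 _⟩) ?_
    (fun φ _ => out_program 𝓛 φ) ?_ ?_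
  · intro φ _
    have hF : ∀ g i k, clauseFails φ.encode (groupSize φ.numVars) g i k ≤ 1 :=
      clauseFails_le φ.encode _
    rw [isMatch_inst_iff, satisfiable_iff]
    constructor
    · rintro ⟨e, he⟩
      exact exists_triple_of_isEmbedding (two_le_two_pow_groupSize _) hF he
    · rintro ⟨a, ha, b, hb, c, hc, habc⟩
      exact exists_isEmbedding_of_triple hF ha hb hc habc
  · intro φ hφ
    refine (hK₁ φ hφ).trans (mul_le_mul_of_nonneg_right ?_ (zero_le_one.trans (hone φ)))
    push_cast
    linarith [Nat.cast_nonneg (α := ℝ) K₂]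
  · intro φ _
    refine (hK₂ φ).trans (mul_le_mul_of_nonneg_right ?_ (zero_le_one.trans (hone φ)))
    push_cast
    linarith [Nat.cast_nonneg (α := ℝ) K₁]

end SatReduction

theorem mainTheorem5 (hSETH : SETH) :
    (∀ (𝓛 : ConstraintKind) (g h : ℝ), g + h < 3 →
      ¬ RAM.SolvableInTime (MatchInstance.encode (𝓛 := 𝓛))
        (fun I => I.NonIntersecting) (fun I => I.IsMatch)
        (fun I => (I.text.length : ℝ) ^ g * (I.constraints.length : ℝ) ^ h)) ∧
    -- the same, already for constraints of constant size
    ∃ s : ℕ, ∀ (𝓛 : ConstraintKind) (g h : ℝ), g + h < 3 →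
      ¬ RAM.SolvableInTime (MatchInstance.encode (𝓛 := 𝓛))
        (fun I => I.NonIntersecting ∧ ∀ C ∈ I.constraints, C.size ≤ s) (fun I => I.IsMatch)
        (fun I => (I.text.length : ℝ) ^ g * (I.constraints.length : ℝ) ^ h) := by
  refine ⟨fun 𝓛 g h hgh hsol => ?_, 126, fun 𝓛 g h hgh =>
    SatReduction.not_solvableInTime hSETH 𝓛 hgh⟩
  -- A program for all non-intersecting instances also solves the restricted ones.
  obtain ⟨P, K, c, hP⟩ := hsol
  exact SatReduction.not_solvableInTime hSETH 𝓛 hgh ⟨P, K, c, fun x hx => hP x hx.1⟩
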